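/- Let $\Bbbk$ be an algebraically closed field of characteristic $p>0$. Yangian. $Y_2$ is the associative $\Bbbk$-algebra with generators $t_{i,j}^{(r)}$ ($1\le i,j\le 2$, $r>0$) and relations $$[t_{i,j}^{(r)},t_{k,l}^{(s)}]=\sum_{t=0}^{\min(r,s)-1}\bigl(t_{k,j}^{(t)}t_{i,l}^{(r+s-1-t)}-t_{k,j}^{(r+s-1-t)}t_{i,l}^{(t)}\bigr)\qquad(1\le i,j,k,l\le2,\ r,s>0),$$ where $t_{i,j}^{(0)}=\delta_{i,j}$. Put $t_{i,j}(u)=\sum_{r\ge0}t_{i,j}^{(r)}u^{-r}\in Y_2[[u^{-1}]]$ and define series $d_i(u)=\sum_{r\ge 0} d_i^{(r)}u^{-r}$, $e(u)=\sum_{r>0}e^{(r)}u^{-r}$, $f(u)=\sum_{r>0}f^{(r)}u^{-r}$ by the Gauss factorization $$\begin{pmatrix}t_{1,1}(u)&t_{1,2}(u)\\t_{2,1}(u)&t_{2,2}(u)\end{pmatrix}=\begin{pmatrix}1&0\\f(u)&1\end{pmatrix}\begin{pmatrix}d_1(u)&0\\0&d_2(u)\end{pmatrix}\begin{pmatrix}1&e(u)\\0&1\end{pmatrix}.$$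 Write $\sum_{r\ge0}b_i^{(r)}u^{-r}=d_i(u)d_i(u-1)\cdots d_i(u-p+1)$, expanded in powers of $u^{-1}$. Restricted Yangian. $Y_2^{[p]}$ is the quotient of $Y_2$ by the ideal generated by the generators $b_i^{(rp)}$ ($i=1,2$), $(e^{(r)})^p$, $(f^{(r)})^p$ ($r>0$) of the $p$-center of $Y_2$. Images of elements in $Y_2^{[p]}$ are denoted by the same symbols. Baby Verma modules. A series $g(u)\in1+u^{-1}\Bbbk[[u^{-1}]]$ is restricted if $g(u)g(u-1)\cdots g(u-p+1)=1$; a pair $\lambda(u)=(\lambda_1(u),\lambda_2(u))$ of series $\lambda_i(u)=1+\sum_{r>0}\lambda_i^{(r)}u^{-r}$ is restricted if both $\lambda_1(u)$ and $\lambda_2(u)$ are. For a restricted pair, the baby Verma module $Z^{[p]}(\lambda(u))$ is the quotient of $Y_2^{[p]}$ by the left ideal generated by all $e^{(r)}$ and all $d_i^{(r)}-\lambda_i^{(r)}$ ($i=1,2$, $r>0$). Theorem. (1) For every restricted pair $\lambda(u)$, the sum of all proper submodules of $Z^{[p]}(\lambda(u))$ is its unique maximal proper submodule. Hence the quotient $L^{[p]}(\lambda(u))$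 of $Z^{[p]}(\lambda(u))$ by it is a simple $Y_2^{[p]}$-module. (2) Every finite-dimensional irreducible $Y_2^{[p]}$-module is isomorphic to $L^{[p]}(\lambda(u))$ for some restricted pair $\lambda(u)$. (3) If $\lambda(u)$ and $\mu(u)$ are restricted pairs and $L^{[p]}(\lambda(u))\cong L^{[p]}(\mu(u))$ as $Y_2^{[p]}$-modules, then $\lambda(u)=\mu(u)$. -/

import Mathlib

open scoped PowerSeries

noncomputable section

namespace RestrictedYangianTwo

/-! Throughout, a formal power series in `u⁻¹` with coefficients in a (possibly noncommutative)
ring `A` is an element of `A⟦X⟧`, where the central variable `X` stands for `u⁻¹`. -/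

section Series

variable (K : Type*) [Field K]

/-- The expansion of `(u - c)⁻¹ = u⁻¹ (1 + c u⁻¹ + c² u⁻² + ⋯)` as a power series in `u⁻¹`. -/
def invSub (c : K) : K⟦X⟧ := PowerSeries.X * PowerSeries.mk fun m => c ^ m

theorem invSub_spec (c : K) :
    invSub K c * (1 - PowerSeries.C c * PowerSeries.X) = PowerSeries.X := by
  have h : (PowerSeries.mk fun m => c ^ m) * (1 - PowerSeries.C c * PowerSeries.X) =
      (1 : K⟦X⟧) := by
    ext n
    rcases n with _ | n
    · simp
    · rw [mul_sub, mul_one, ← mul_assoc, map_sub, PowerSeries.coeff_succ_mul_X]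
      simp [PowerSeries.coeff_mk, PowerSeries.coeff_mul_C, PowerSeries.coeff_one, pow_succ]
  rw [invSub, mul_assoc, h, mul_one]

variable {K} {A : Type*} [Ring A] [Algebra K A]

/-- For `g(u) = ∑ g⁽ʳ⁾ u⁻ʳ`, the series `g(u - c) = ∑ g⁽ʳ⁾ (u - c)⁻ʳ`, expanded in `u⁻¹`.
Only `r ≤ n` contribute to the coefficient of `u⁻ⁿ`, as `(u - c)⁻ʳ` is divisible by `u⁻ʳ`. -/
def shift (c : K) (g : A⟦X⟧) : A⟦X⟧ :=
  PowerSeries.mk fun n => ∑ r ∈ Finset.range (n + 1),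
    PowerSeries.coeff n (invSub K c ^ r) • PowerSeries.coeff r g

/-- The ordered product `g(u) g(u - 1) ⋯ g(u - p + 1)`. -/
def shiftProd (K : Type*) [Field K] {A : Type*} [Ring A] [Algebra K A] (p : ℕ) (g : A⟦X⟧) :
    A⟦X⟧ :=
  ((List.range p).map fun j : ℕ => shift (j : K) g).prod

/-- A series `g(u) ∈ 1 + u⁻¹ K⟦u⁻¹⟧` is restricted if `g(u) g(u - 1) ⋯ g(u - p + 1) = 1`. -/
def IsRestricted (p : ℕ) (g : K⟦X⟧) : Prop :=
  PowerSeries.constantCoeff g = 1 ∧ shiftProd K p g = 1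

/-- A pair `(g₁(u), g₂(u))`, indexed by `Fin 2`, is restricted if both its members are. -/
def IsRestrictedPair (p : ℕ) (g : Fin 2 → K⟦X⟧) : Prop := ∀ i, IsRestricted p (g i)

end Series

section Yangian

variable (K : Type*) [Field K]

/-- The free generators: `(i, j, r)` stands for `t_{i,j}⁽ʳ⁺¹⁾`. This is `t_{i,j}⁽ʳ⁾` in the free
algebra on them, with the convention `t_{i,j}⁽⁰⁾ = δ_{i,j}`. -/
def tFree (i j : Fin 2) : ℕ → FreeAlgebra K (Fin 2 × Fin 2 × ℕ)
  | 0 => if i = j then 1 else 0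
  | r + 1 => FreeAlgebra.ι K (i, j, r)

/-- The defining RTT relations of the Yangian of `𝔤𝔩₂`. -/
inductive RTTRel : FreeAlgebra K (Fin 2 × Fin 2 × ℕ) → FreeAlgebra K (Fin 2 × Fin 2 × ℕ) → Prop
  | rtt (i j k l : Fin 2) (r s : ℕ) (hr : 0 < r) (hs : 0 < s) :
      RTTRel (tFree K i j r * tFree K k l s - tFree K k l s * tFree K i j r)
        (∑ t ∈ Finset.range (min r s),
          (tFree K k j t * tFree K i l (r + s - 1 - t) -
            tFree K k j (r + s - 1 - t) * tFree K i l t))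

/-- The Yangian `Y₂` of `𝔤𝔩₂` over `K`. -/
def Yangian : Type _ := RingQuot (RTTRel K)

instance : Ring (Yangian K) := inferInstanceAs (Ring (RingQuot (RTTRel K)))

instance : Algebra K (Yangian K) := inferInstanceAs (Algebra K (RingQuot (RTTRel K)))

/-- The projection from the free algebra to `Y₂`. -/
def mk : FreeAlgebra K (Fin 2 × Fin 2 × ℕ) →ₐ[K] Yangian K := RingQuot.mkAlgHom K (RTTRel K)

/-- The elements `t_{i,j}⁽ʳ⁾` of `Y₂`, for `r ≥ 0`. -/
def t (i j : Fin 2) (r : ℕ) : Yangian K := mk K (tFree K i j r)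

/-- The series `t_{i,j}(u)`; the indices `1, 2` of the usual notation are `0, 1 : Fin 2`. -/
def tSeries (i j : Fin 2) : (Yangian K)⟦X⟧ := PowerSeries.mk (t K i j)

/-- The inverse of `t_{1,1}(u)`, a series with constant term `1`. -/
def tInv : (Yangian K)⟦X⟧ := PowerSeries.invOfUnit (tSeries K 0 0) 1

/-- The series `e(u)` of the Gauss factorization `T(u) = F(u) D(u) E(u)`. -/
def eSeries : (Yangian K)⟦X⟧ := tInv K * tSeries K 0 1

/-- The series `f(u)` of the Gauss factorization. -/
def fSeries : (Yangian K)⟦X⟧ := tSeries K 1 0 * tInv K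

/-- The series `d₁(u)` and `d₂(u)` of the Gauss factorization. -/
def dSeries : Fin 2 → (Yangian K)⟦X⟧ :=
  ![tSeries K 0 0, tSeries K 1 1 - tSeries K 1 0 * tInv K * tSeries K 0 1]

theorem t_zero (i j : Fin 2) : t K i j 0 = if i = j then 1 else 0 := by
  unfold t tFree
  split_ifs <;> simp

theorem tSeries_mul_tInv : tSeries K 0 0 * tInv K = 1 :=
  PowerSeries.mul_invOfUnit _ _ (by simp [tSeries, t_zero])

theorem tInv_mul_tSeries : tInv K * tSeries K 0 0 = 1 :=
  PowerSeries.invOfUnit_mul _ _ (by simp [tSeries, t_zero])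

/-- The Gauss factorization `T(u) = F(u) D(u) E(u)`. -/
theorem gauss :
    Matrix.of (tSeries K) =
      !![1, 0; fSeries K, 1] * Matrix.diagonal (dSeries K) * !![1, eSeries K; 0, 1] := by
  have h1 := tSeries_mul_tInv K
  have h2 := tInv_mul_tSeries K
  have h3 : tSeries K 0 0 * (tInv K * tSeries K 0 1) = tSeries K 0 1 := by
    rw [← mul_assoc, h1, one_mul]
  have h4 : tSeries K 1 0 * tInv K * tSeries K 0 0 = tSeries K 1 0 := by
    rw [mul_assoc, h2, mul_one]
  have h : Matrix.of (tSeries K) = !![tSeries K 0 0, tSeries K 0 1; tSeries K 1 0, tSeries K 1 1] := by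
    ext i j : 2
    fin_cases i <;> fin_cases j <;> rfl
  rw [h]
  simp [Matrix.diagonal_fin_two, dSeries, eSeries, fSeries, h3, h4]
  simp [← mul_assoc]

/-- The Drinfeld generators `e⁽ʳ⁾`. -/
def e (r : ℕ) : Yangian K := PowerSeries.coeff r (eSeries K)

/-- The Drinfeld generators `f⁽ʳ⁾`. -/
def f (r : ℕ) : Yangian K := PowerSeries.coeff r (fSeries K)

/-- The Drinfeld generators `d_i⁽ʳ⁾`. -/
def d (i : Fin 2) (r : ℕ) : Yangian K := PowerSeries.coeff r (dSeries K i)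

/-- The coefficients `b_i⁽ʳ⁾` of `b_i(u) = d_i(u) d_i(u - 1) ⋯ d_i(u - p + 1)`. -/
def b (p : ℕ) (i : Fin 2) (r : ℕ) : Yangian K :=
  PowerSeries.coeff r (shiftProd K p (dSeries K i))

/-- The generators `b_i⁽ʳᵖ⁾`, `(e⁽ʳ⁾)ᵖ`, `(f⁽ʳ⁾)ᵖ` (`r > 0`) of the `p`-center are set to zero. -/
inductive PCenterRel (p : ℕ) : Yangian K → Yangian K → Prop
  | b (i : Fin 2) (r : ℕ) (hr : 0 < r) : PCenterRel p (b K p i (r * p)) 0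
  | e (r : ℕ) (hr : 0 < r) : PCenterRel p (e K r ^ p) 0
  | f (r : ℕ) (hr : 0 < r) : PCenterRel p (f K r ^ p) 0

/-- The restricted Yangian `Y₂^{[p]}`: the quotient of `Y₂` by the ideal generated by the
generators of the `p`-center. -/
def RestrictedYangian (p : ℕ) : Type _ := RingQuot (PCenterRel K p)

instance (p : ℕ) : Ring (RestrictedYangian K p) :=
  inferInstanceAs (Ring (RingQuot (PCenterRel K p)))

instance (p : ℕ) : Algebra K (RestrictedYangian K p) :=
  inferInstanceAs (Algebra K (RingQuot (PCenterRel K p)))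

/-- The projection `Y₂ → Y₂^{[p]}`. -/
def proj (p : ℕ) : Yangian K →ₐ[K] RestrictedYangian K p := RingQuot.mkAlgHom K (PCenterRel K p)

end Yangian

section Modules

variable {K : Type*} [Field K] (p : ℕ) (lam : Fin 2 → K⟦X⟧)

/-- The left ideal of `Y₂^{[p]}` generated by `e⁽ʳ⁾` and `d_i⁽ʳ⁾ - λ_i⁽ʳ⁾` for `r > 0`. -/
def babyVermaIdeal : Submodule (RestrictedYangian K p) (RestrictedYangian K p) :=
  Submodule.span (RestrictedYangian K p)
    ({x | ∃ r : ℕ, 0 < r ∧ x = proj K p (e K r)} ∪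
      {x | ∃ (i : Fin 2) (r : ℕ), 0 < r ∧
        x = proj K p (d K i r) -
          algebraMap K (RestrictedYangian K p) (PowerSeries.coeff r (lam i))})

/-- The baby Verma module `Z^{[p]}(λ(u))`. -/
abbrev BabyVerma : Type _ := RestrictedYangian K p ⧸ babyVermaIdeal p lam

/-- The sum of all proper submodules of `Z^{[p]}(λ(u))`. For a restricted pair `λ(u)` it is the
unique maximal proper submodule, which is part of the theorem. -/
def maxSubmodule : Submodule (RestrictedYangian K p) (BabyVerma p lam) :=
  sSup {N | N ≠ ⊤}

/-- The simple head `L^{[p]}(λ(u))` of the baby Verma module. -/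
abbrev SimpleHead : Type _ := BabyVerma p lam ⧸ maxSubmodule p lam

end Modules

end RestrictedYangianTwo

end

/-! Three facts carry the theorem.

(a) Nilpotency. The commutator of `e⁽ʳ⁾` and `e⁽ˢ⁾` is a combination of products of two generators
with total index `r + s - 1` and with no larger index. Factors can therefore be reordered modulo
products of smaller total index. As `(e⁽ʳ⁾)ᵖ = 0`, the pigeonhole principle kills every long enough
product of `e⁽¹⁾, …, e⁽ˡ⁾` (`HalfRel.list_prod_eq_zero`); passing to the opposite ring gives the
same for `f`. This replaces a weight grading, which in characteristic `p` separates weights only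
modulo `p`.

(b) Triangularity. In a module generated by a highest weight vector `v` every vector is `c v + y v`,
with `y` in the span of nonempty products of `f⁽ʳ⁾`, hence nilpotent. If `c ≠ 0` then `c + y` is a
unit and the vector generates. So proper submodules lie in the subspace `∑ t₂₁⁽ʳ⁾ V`, which misses
`v` when `v ≠ 0`. This gives the unique maximal submodule and the uniqueness of the highest weight.
Conversely, on a nonzero finite-dimensional module the `e⁽ʳ⁾` have a common kernel by (a), the
diagonal generators commute there, and a common eigenvector is a highest weight vector. Its weight
is restricted: the series `λ(u) ⋯ λ(u - p + 1)` is invariant under `u ↦ u - 1`, so its coefficients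
are controlled by those at multiples of `p`, which the relations set to zero.

(c) Nonvanishing of baby Verma modules, without a PBW theorem (`one_notMem_babyVermaIdeal`). A
relation putting `1` in the left ideal sees only finitely many coefficients of `λ`. It is enough to
approximate `λ` to any order by weights `μ` that occur in actual representations. The
representations are iterated tensor products of vector representations with parameters `y ∈ S`, of
weight `μ₁ / μ₂ = ∏ (u - y) / (u - y - 1)`. When no two parameters differ by `1`, the series `e(u)`
and `f(u)` have simple poles in `S`, with residues that square to zero and commute up to scalars.
The `p`-th power of a combination of such residues is divisible by `p!`, so it vanishes. The
approximation comes from writing `λ₁ / λ₂ = G(u) / G(u - 1)` as in Hilbert's Theorem 90 and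
replacing `G` by a generic product. -/

open scoped PowerSeries

noncomputable section

namespace RestrictedYangianTwo

/-! ### Scalar power series acting on series over an algebra -/

section Scalars

variable {K : Type*} [Field K] {A : Type*} [Ring A] [Algebra K A]

/-- Power series over a `K`-algebra form an algebra over the power series over `K`. -/
@[reducible] def seriesAlgebra (K : Type*) [Field K] (A : Type*) [Ring A] [Algebra K A] :
    Algebra K⟦X⟧ A⟦X⟧ :=
  (PowerSeries.map (algebraMap K A)).toAlgebra' fun c g => by
    ext n
    simp only [PowerSeries.coeff_mul, PowerSeries.coeff_map]
    rw [← Finset.Nat.sum_antidiagonal_swap]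
    exact Finset.sum_congr rfl fun x _ => Algebra.commutes _ _

attribute [local instance] seriesAlgebra

theorem series_smul_def (c : K⟦X⟧) (g : A⟦X⟧) :
    c • g = PowerSeries.map (algebraMap K A) c * g := rfl

theorem coeff_series_smul (n : ℕ) (c : K⟦X⟧) (g : A⟦X⟧) :
    PowerSeries.coeff n (c • g) = ∑ x ∈ Finset.HasAntidiagonal.antidiagonal n,
      PowerSeries.coeff x.1 c • PowerSeries.coeff x.2 g := by
  rw [series_smul_def, PowerSeries.coeff_mul]
  simp [Algebra.smul_def]

theorem X_smul (g : A⟦X⟧) : (PowerSeries.X : K⟦X⟧) • g = PowerSeries.X * g := by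
  rw [series_smul_def, PowerSeries.map_X]

theorem C_smul (c : K) (g : A⟦X⟧) : (PowerSeries.C c : K⟦X⟧) • g = c • g := by
  ext n
  rw [series_smul_def, PowerSeries.map_C, PowerSeries.coeff_C_mul, PowerSeries.coeff_smul,
    Algebra.smul_def]

end Scalars

/-! ### The substitution `u ↦ u - c` -/

section Shift

variable {K : Type*} [Field K] {A : Type*} [Ring A] [Algebra K A]

attribute [local instance] seriesAlgebra

theorem coeff_invSub_pow_of_lt (c : K) {n r : ℕ} (h : n < r) :
    PowerSeries.coeff n (invSub K c ^ r) = 0 := by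
  rw [invSub, mul_pow, PowerSeries.coeff_X_pow_mul', if_neg (by omega)]

/-- A common cutoff `N` for several coefficients makes it possible to interchange the sums below. -/
theorem coeff_shift_of_lt (c : K) (g : A⟦X⟧) {n N : ℕ} (h : n < N) :
    PowerSeries.coeff n (shift c g) = ∑ r ∈ Finset.range N,
      PowerSeries.coeff n (invSub K c ^ r) • PowerSeries.coeff r g := by
  rw [shift, PowerSeries.coeff_mk]
  apply Finset.sum_subset
  · intro x hx
    simp only [Finset.mem_range] at *
    omega
  · intro x _ hx
    simp only [Finset.mem_range] at *
    rw [coeff_invSub_pow_of_lt c (by omega), zero_smul]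

/-- Both sides are sums over pairs `(i, j)` of `(u - c)^{-(i + j)} g⁽ⁱ⁾ h⁽ʲ⁾`. One side uses the
square `i, j ≤ n`, the other the triangle `i + j ≤ n`; the additional pairs contribute zero because
`(u - c)^{-(i + j)}` is divisible by `u^{-(i + j)}`. -/
theorem shift_mul (c : K) (g h : A⟦X⟧) : shift c (g * h) = shift c g * shift c h := by
  ext n
  rw [PowerSeries.coeff_mul, coeff_shift_of_lt c _ (Nat.lt_succ_self n)]
  have h1 : ∀ x ∈ Finset.HasAntidiagonal.antidiagonal n,
      PowerSeries.coeff x.1 (shift c g) * PowerSeries.coeff x.2 (shift c h) =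
      ∑ i ∈ Finset.range (n + 1), ∑ j ∈ Finset.range (n + 1),
        (PowerSeries.coeff x.1 (invSub K c ^ i) * PowerSeries.coeff x.2 (invSub K c ^ j)) •
          (PowerSeries.coeff i g * PowerSeries.coeff j h) := by
    intro x hx
    have := Finset.HasAntidiagonal.mem_antidiagonal.1 hx
    rw [coeff_shift_of_lt c g (show x.1 < n + 1 by omega),
      coeff_shift_of_lt c h (show x.2 < n + 1 by omega), Finset.sum_mul_sum]
    refine Finset.sum_congr rfl fun i _ => Finset.sum_congr rfl fun j _ => ?_
    rw [smul_mul_smul_comm]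
  rw [Finset.sum_congr rfl h1, Finset.sum_comm]
  have h2 : ∀ i j, ∑ x ∈ Finset.HasAntidiagonal.antidiagonal n,
      (PowerSeries.coeff x.1 (invSub K c ^ i) * PowerSeries.coeff x.2 (invSub K c ^ j)) •
          (PowerSeries.coeff i g * PowerSeries.coeff j h) =
      PowerSeries.coeff n (invSub K c ^ (i + j)) • (PowerSeries.coeff i g * PowerSeries.coeff j h) := by
    intro i j
    rw [pow_add, PowerSeries.coeff_mul, Finset.sum_smul]
  have h3 : ∀ i ∈ Finset.range (n + 1), ∑ x ∈ Finset.HasAntidiagonal.antidiagonal n,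
      ∑ j ∈ Finset.range (n + 1),
      (PowerSeries.coeff x.1 (invSub K c ^ i) * PowerSeries.coeff x.2 (invSub K c ^ j)) •
          (PowerSeries.coeff i g * PowerSeries.coeff j h) =
      ∑ j ∈ Finset.range (n + 1), 
      PowerSeries.coeff n (invSub K c ^ (i + j)) • (PowerSeries.coeff i g * PowerSeries.coeff j h) := by
    intro i _
    rw [Finset.sum_comm]
    exact Finset.sum_congr rfl fun j _ => h2 i j
  rw [Finset.sum_congr rfl h3, ← Finset.sum_product']
  simp_rw [PowerSeries.coeff_mul, Finset.smul_sum]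
  rw [Finset.sum_sigma']
  apply Finset.sum_of_injOn (fun x => (x.2.1, x.2.2))
  · rintro ⟨a, b, c⟩ hx ⟨a', b', c'⟩ hx' h
    simp only [Finset.coe_sigma, Set.mem_sigma_iff, Finset.mem_coe, Finset.mem_range,
      Finset.HasAntidiagonal.mem_antidiagonal, Prod.mk.injEq] at hx hx' h
    obtain ⟨rfl, rfl⟩ := h
    obtain ⟨_, rfl⟩ := hx
    obtain ⟨_, rfl⟩ := hx'
    rfl
  · rintro ⟨a, b, c⟩ hx
    simp only [Finset.coe_sigma, Set.mem_sigma_iff, Finset.mem_coe, Finset.mem_range,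
      Finset.HasAntidiagonal.mem_antidiagonal, Finset.mem_product] at hx ⊢
    omega
  · rintro ⟨i, j⟩ hx hx'
    have : n < i + j := by
      by_contra hlt
      refine hx' ⟨⟨i + j, i, j⟩, ?_, rfl⟩
      simp
      omega
    rw [coeff_invSub_pow_of_lt c this, zero_smul]
  · rintro ⟨a, b, c⟩ hx
    simp only [Finset.mem_sigma, Finset.HasAntidiagonal.mem_antidiagonal] at hx
    simp [hx.2]

theorem shift_add (c : K) (g h : A⟦X⟧) : shift c (g + h) = shift c g + shift c h := by
  ext n
  simp [shift, smul_add, Finset.sum_add_distrib]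

theorem shift_C (c : K) (a : A) : shift c (PowerSeries.C a) = PowerSeries.C a := by
  ext n
  rw [shift, PowerSeries.coeff_mk, Finset.sum_eq_single 0]
  · simp [PowerSeries.coeff_one, PowerSeries.coeff_C]
  · intro r _ hr
    rw [PowerSeries.coeff_C, if_neg hr, smul_zero]
  · simp

/-- The substitution `u ↦ u - c` as a ring homomorphism. -/
def shiftHom (K : Type*) [Field K] (A : Type*) [Ring A] [Algebra K A] (c : K) : A⟦X⟧ →+* A⟦X⟧ where
  toFun := shift c
  map_zero' := by simpa using shift_C c (0 : A)
  map_one' := by simpa using shift_C c (1 : A)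
  map_add' := shift_add c
  map_mul' := shift_mul c

theorem shiftHom_apply (c : K) (g : A⟦X⟧) : shiftHom K A c g = shift c g := rfl

theorem shift_one (c : K) : shift c (1 : A⟦X⟧) = 1 := map_one (shiftHom K A c)

theorem shift_sub (c : K) (g h : A⟦X⟧) : shift c (g - h) = shift c g - shift c h :=
  map_sub (shiftHom K A c) g h

theorem constantCoeff_shift (c : K) (g : A⟦X⟧) :
    PowerSeries.constantCoeff (shift c g) = PowerSeries.constantCoeff g := by
  rw [← PowerSeries.coeff_zero_eq_constantCoeff_apply, ← PowerSeries.coeff_zero_eq_constantCoeff_apply,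
    shift, PowerSeries.coeff_mk]
  simp

theorem map_shift {B : Type*} [Ring B] [Algebra K B] (φ : A →ₐ[K] B) (c : K) (g : A⟦X⟧) :
    PowerSeries.map φ.toRingHom (shift c g) = shift c (PowerSeries.map φ.toRingHom g) := by
  ext n
  simp [shift]

theorem map_shiftProd {B : Type*} [Ring B] [Algebra K B] (φ : A →ₐ[K] B) (p : ℕ) (g : A⟦X⟧) :
    PowerSeries.map φ.toRingHom (shiftProd K p g) =
      shiftProd K p (PowerSeries.map φ.toRingHom g) := by
  rw [shiftProd, shiftProd, map_list_prod, List.map_map]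
  congr 1
  exact List.map_congr_left fun j _ => map_shift φ _ g

theorem shift_smul (c : K) (φ : K⟦X⟧) (g : A⟦X⟧) : shift c (φ • g) = shift c φ • shift c g := by
  rw [series_smul_def, series_smul_def, shift_mul]
  congr 1
  exact (map_shift (Algebra.ofId K A) c φ).symm

theorem shift_X (c : K) : shift c (PowerSeries.X : K⟦X⟧) = invSub K c := by
  ext n
  rw [coeff_shift_of_lt c _ (show n < n + 2 by omega), Finset.sum_eq_single 1]
  · simp
  · intro r _ hr
    rw [PowerSeries.coeff_X, if_neg hr, smul_zero]
  · simp

theorem one_sub_C_mul_X_ne_zero (c : K) : (1 - PowerSeries.C c * PowerSeries.X : K⟦X⟧) ≠ 0 := by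
  intro h
  simpa using congrArg PowerSeries.constantCoeff h

theorem shift_invSub (c d : K) : shift c (invSub K d) = invSub K (c + d) := by
  have h1 := congrArg (shift c) (invSub_spec K d)
  rw [shift_mul, shift_sub, shift_one, shift_mul, shift_C, shift_X] at h1
  have h2 := invSub_spec K c
  have h3 := invSub_spec K (c + d)
  apply mul_right_cancel₀ (one_sub_C_mul_X_ne_zero (c + d))
  rw [h3]
  rw [map_add]
  linear_combination (1 - PowerSeries.C c * PowerSeries.X) * h1 + h2 +
    PowerSeries.C d * shift c (invSub K d) * h2

theorem shift_pow (c : K) (g : A⟦X⟧) (n : ℕ) : shift c (g ^ n) = shift c g ^ n :=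
  map_pow (shiftHom K A c) g n

theorem shift_shift (c d : K) (g : A⟦X⟧) : shift c (shift d g) = shift (c + d) g := by
  ext n
  rw [coeff_shift_of_lt c _ n.lt_succ_self, coeff_shift_of_lt (c + d) _ n.lt_succ_self]
  have : ∀ r ∈ Finset.range (n + 1), PowerSeries.coeff n (invSub K c ^ r) •
      PowerSeries.coeff r (shift d g) = ∑ s ∈ Finset.range (n + 1),
        (PowerSeries.coeff n (invSub K c ^ r) * PowerSeries.coeff r (invSub K d ^ s)) •
          PowerSeries.coeff s g := by
    intro r hr
    rw [coeff_shift_of_lt d g (Finset.mem_range.1 hr), Finset.smul_sum]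
    simp_rw [smul_smul]
  rw [Finset.sum_congr rfl this, Finset.sum_comm]
  refine Finset.sum_congr rfl fun s _ => ?_
  rw [← Finset.sum_smul, ← shift_invSub, ← shift_pow, coeff_shift_of_lt c _ n.lt_succ_self]
  simp

theorem invSub_zero : invSub K 0 = PowerSeries.X := by
  simpa using invSub_spec K 0

theorem shift_zero (g : A⟦X⟧) : shift (0 : K) g = g := by
  ext n
  rw [coeff_shift_of_lt 0 _ n.lt_succ_self, Finset.sum_eq_single n]
  · simp [invSub_zero, PowerSeries.coeff_X_pow]
  · intro r _ hr
    rw [invSub_zero, PowerSeries.coeff_X_pow, if_neg (Ne.symm hr), zero_smul]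
  · simp

/-- `g(u) g(u - 1) ⋯ g(u - p + 1)` for commutative coefficients, as a multiplicative map. -/
theorem shiftProd_eq_prod (p : ℕ) (g : K⟦X⟧) :
    shiftProd K p g = ∏ j ∈ Finset.range p, shift (j : K) g := by
  rw [shiftProd, Finset.prod_eq_multiset_prod, Finset.range_val, Multiset.range,
    Multiset.map_coe, Multiset.prod_coe]

end Shift

/-! ### Relations in two variables and their coefficient forms -/

section TwoVariables

variable {A : Type*} [Ring A]

/-- `g(x)` as a series in the two central variables `x` (inner) and `y` (outer). -/
def inX (A : Type*) [Ring A] : A⟦X⟧ →+* A⟦X⟧⟦X⟧ := PowerSeries.C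

/-- `g(y)` as a series in the two central variables `x` (inner) and `y` (outer). -/
def inY (A : Type*) [Ring A] : A⟦X⟧ →+* A⟦X⟧⟦X⟧ := PowerSeries.map PowerSeries.C

theorem ext_two {F G : A⟦X⟧⟦X⟧} (h : ∀ r s, PowerSeries.coeff r (PowerSeries.coeff s F) =
    PowerSeries.coeff r (PowerSeries.coeff s G)) : F = G :=
  PowerSeries.ext fun s => PowerSeries.ext fun r => h r s

theorem coeff_inX_mul_inY (g h : A⟦X⟧) (r s : ℕ) :
    PowerSeries.coeff r (PowerSeries.coeff s (inX A g * inY A h)) =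
      PowerSeries.coeff r g * PowerSeries.coeff s h := by
  rw [inX, inY, PowerSeries.coeff_C_mul, PowerSeries.coeff_map, PowerSeries.coeff_mul_C]

theorem coeff_inY_mul_inX (g h : A⟦X⟧) (r s : ℕ) :
    PowerSeries.coeff r (PowerSeries.coeff s (inY A h * inX A g)) =
      PowerSeries.coeff s h * PowerSeries.coeff r g := by
  rw [inX, inY, PowerSeries.coeff_mul_C, PowerSeries.coeff_map, PowerSeries.coeff_C_mul]

/-- The variable `x`, as a central element. -/
def cX (A : Type*) [Ring A] : Subring.center A⟦X⟧⟦X⟧ :=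
  ⟨PowerSeries.C PowerSeries.X, Subring.mem_center_iff.2 fun g => by
    ext s : 1
    rw [PowerSeries.coeff_C_mul, PowerSeries.coeff_mul_C]
    exact PowerSeries.commute_X _⟩

/-- The variable `y`, as a central element. -/
def cY (A : Type*) [Ring A] : Subring.center A⟦X⟧⟦X⟧ :=
  ⟨PowerSeries.X, Subring.mem_center_iff.2 fun g => PowerSeries.commute_X g⟩

theorem coeff_cX_smul_succ (F : A⟦X⟧⟦X⟧) (r s : ℕ) :
    PowerSeries.coeff (r + 1) (PowerSeries.coeff s (cX A • F)) =
      PowerSeries.coeff r (PowerSeries.coeff s F) := by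
  change PowerSeries.coeff (r + 1) (PowerSeries.coeff s (PowerSeries.C PowerSeries.X * F)) = _
  rw [PowerSeries.coeff_C_mul, PowerSeries.coeff_succ_X_mul]

theorem coeff_cX_smul_zero (F : A⟦X⟧⟦X⟧) (s : ℕ) :
    PowerSeries.coeff 0 (PowerSeries.coeff s (cX A • F)) = 0 := by
  change PowerSeries.coeff 0 (PowerSeries.coeff s (PowerSeries.C PowerSeries.X * F)) = _
  rw [PowerSeries.coeff_C_mul, PowerSeries.coeff_zero_X_mul]

theorem coeff_cY_smul_succ (F : A⟦X⟧⟦X⟧) (r s : ℕ) :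
    PowerSeries.coeff r (PowerSeries.coeff (s + 1) (cY A • F)) =
      PowerSeries.coeff r (PowerSeries.coeff s F) := by
  change PowerSeries.coeff r (PowerSeries.coeff (s + 1) (PowerSeries.X * F)) = _
  rw [PowerSeries.coeff_succ_X_mul]

theorem coeff_cY_smul_zero (F : A⟦X⟧⟦X⟧) (r : ℕ) :
    PowerSeries.coeff r (PowerSeries.coeff 0 (cY A • F)) = 0 := by
  change PowerSeries.coeff r (PowerSeries.coeff 0 (PowerSeries.X * F)) = _
  rw [PowerSeries.coeff_zero_X_mul, map_zero]

/-- The relation `(u - v) [g(u), h(v)] = g₁(u) h₁(v) - g₂(v) h₂(u)`, multiplied by `u⁻¹ v⁻¹`. -/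
def TwoVarRel (g h g₁ h₁ g₂ h₂ : A⟦X⟧) : Prop :=
  (cY A - cX A) • (inX A g * inY A h - inY A h * inX A g) =
    (cX A * cY A) • (inX A g₁ * inY A h₁ - inY A g₂ * inX A h₂)

/-- The coefficient form of `(u - v) [g(u), h(v)] = g₁(u) h₁(v) - g₂(v) h₂(u)`. -/
structure CoeffRel (g h g₁ h₁ g₂ h₂ : A⟦X⟧) : Prop where
  left : ∀ s, Commute (PowerSeries.coeff 0 g) (PowerSeries.coeff s h)
  right : ∀ r, Commute (PowerSeries.coeff r g) (PowerSeries.coeff 0 h)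
  rel : ∀ r s,
    (PowerSeries.coeff (r + 1) g * PowerSeries.coeff s h -
        PowerSeries.coeff s h * PowerSeries.coeff (r + 1) g) -
      (PowerSeries.coeff r g * PowerSeries.coeff (s + 1) h -
        PowerSeries.coeff (s + 1) h * PowerSeries.coeff r g) =
    PowerSeries.coeff r g₁ * PowerSeries.coeff s h₁ - PowerSeries.coeff s g₂ * PowerSeries.coeff r h₂

theorem CoeffRel.twoVarRel {g h g₁ h₁ g₂ h₂ : A⟦X⟧} (H : CoeffRel g h g₁ h₁ g₂ h₂) :
    TwoVarRel g h g₁ h₁ g₂ h₂ := by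
  apply ext_two
  intro r s
  rw [sub_smul, mul_smul]
  rcases r with _ | r <;> rcases s with _ | s <;>
  simp only [map_sub, coeff_cX_smul_zero, coeff_cY_smul_zero, coeff_cX_smul_succ,
    coeff_cY_smul_succ, coeff_inX_mul_inY, coeff_inY_mul_inX, sub_zero, zero_sub, neg_eq_zero]
  · exact sub_eq_zero.2 (H.left s)
  · exact sub_eq_zero.2 (H.right r)
  · exact H.rel r s

theorem TwoVarRel.coeffRel {g h g₁ h₁ g₂ h₂ : A⟦X⟧} (H : TwoVarRel g h g₁ h₁ g₂ h₂) :
    CoeffRel g h g₁ h₁ g₂ h₂ := by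
  have key := fun r s => congrArg (fun F => PowerSeries.coeff r (PowerSeries.coeff s F)) H
  rw [sub_smul, mul_smul] at key
  refine ⟨fun s => ?_, fun r => ?_, fun r s => ?_⟩
  · have := key 0 (s + 1)
    simp only [map_sub, coeff_cX_smul_zero, coeff_cY_smul_succ, coeff_inX_mul_inY, coeff_inY_mul_inX,
      sub_zero] at this
    exact sub_eq_zero.1 this
  · have := key (r + 1) 0
    simp only [map_sub, coeff_cY_smul_zero, coeff_cX_smul_succ, coeff_inX_mul_inY, coeff_inY_mul_inX,
      zero_sub, neg_eq_zero] at this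
    exact sub_eq_zero.1 this
  · have := key (r + 1) (s + 1)
    simpa only [map_sub, coeff_cX_smul_zero, coeff_cY_smul_zero, coeff_cX_smul_succ,
      coeff_cY_smul_succ, coeff_inX_mul_inY, coeff_inY_mul_inX, sub_zero] using this

end TwoVariables

/-! ### Exchange relations after division by `a(u)` -/

section HalfAbstract

variable {R S : Type*} [CommRing R] [Ring S] [Algebra R S] {x y : R} {a a' b b' e e' : S}

/-- With `x = u⁻¹`, `y = v⁻¹` and primes for the variable `v`, this is `(u - v) [a(u), e(v)] = a(u)
(e(v) - e(u))`. Multiplying by `a(v)` on the left, which commutes with `a(u)`, turns it into the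
relation between `a` and `b`. -/
theorem exchange_a_e (hu : IsUnit a') (haa : a * a' = a' * a) (hb : a * e = b) (hb' : a' * e' = b')
    (H : (y - x) • (a * b' - b' * a) = (x * y) • (a * b' - a' * b)) :
    (y - x) • (a * e' - e' * a) = (x * y) • (a * (e' - e)) := by
  apply hu.mul_left_cancel
  rw [mul_smul_comm, mul_smul_comm]
  have h1 : a' * (a * e' - e' * a) = a * b' - b' * a := by
    rw [mul_sub, ← mul_assoc, ← mul_assoc, ← haa, hb', mul_assoc, hb']
  have h2 : a' * (a * (e' - e)) = a * b' - a' * b := by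
    rw [mul_sub, mul_sub, ← mul_assoc, ← haa, mul_assoc, hb', hb]
  rw [h1, h2, H]

/-- This is `(u - v) [e(u), e(v)] = (e(u) - e(v))²`. It comes from `b(u) b(v) = b(v) b(u)`: write `b
= a e` in each factor and move the inner `a` to the left by the previous relation. -/
theorem exchange_e_e (hu : IsUnit a) (hu' : IsUnit a') (haa : a * a' = a' * a)
    (hbb : b * b' = b' * b)
    (hb : a * e = b) (hb' : a' * e' = b')
    (H : (y - x) • (a * e' - e' * a) = (x * y) • (a * (e' - e)))
    (H' : (x - y) • (a' * e - e * a') = (y * x) • (a' * (e - e'))) :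
    (y - x) • (e * e' - e' * e) = (x * y) • (e * e + e' * e' - e * e' - e' * e) := by
  apply (hu.mul hu').mul_left_cancel
  have h1 : (y - x) • (b * b') = (a * a') * ((y - x) • (e * e') + (x * y) • ((e - e') * e')) := by
    have : (y - x) • (e * a') = (y - x) • (a' * e) + (x * y) • (a' * (e - e')) := by
      rw [← sub_eq_zero] at H' ⊢
      rw [← H']
      module
    calc (y - x) • (b * b') = a * ((y - x) • (e * a')) * e' := by
          rw [mul_smul_comm, smul_mul_assoc, ← hb, ← hb']; simp only [mul_assoc]
      _ = _ := by
          rw [this]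
          simp only [mul_add, add_mul, mul_smul_comm, smul_mul_assoc, mul_assoc, mul_sub, sub_mul]
  have h2 : (y - x) • (b' * b) = (a * a') * ((y - x) • (e' * e) - (x * y) • ((e' - e) * e)) := by
    have : (y - x) • (e' * a) = (y - x) • (a * e') - (x * y) • (a * (e' - e)) := by
      rw [← sub_eq_zero] at H ⊢
      rw [← neg_eq_zero, ← H]
      module
    calc (y - x) • (b' * b) = a' * ((y - x) • (e' * a)) * e := by
          rw [mul_smul_comm, smul_mul_assoc, ← hb, ← hb']; simp only [mul_assoc]
      _ = _ := by
          rw [this, haa]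
          simp only [mul_sub, sub_mul, mul_smul_comm, smul_mul_assoc, mul_assoc]
  rw [← hbb, h1] at h2
  rw [← sub_eq_zero, ← mul_sub] at h2 ⊢
  rw [← h2]
  congr 1
  simp only [sub_mul]
  module

end HalfAbstract

/-! ### The relations between `a(u)` and `e(u)` -/

section Half

variable {A : Type*} [Ring A]

/-- The part of the RTT relations that involves only the first row `(a(u), b(u))` of `T(u)`. -/
structure RowRel (a b : A⟦X⟧) : Prop where
  const_a : PowerSeries.coeff 0 a = 1
  const_b : PowerSeries.coeff 0 b = 0
  comm_a : ∀ r s, Commute (PowerSeries.coeff r a) (PowerSeries.coeff s a)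
  comm_b : ∀ r s, Commute (PowerSeries.coeff r b) (PowerSeries.coeff s b)
  rel : CoeffRel a b a b a b

theorem inX_inY_comm {g h : A⟦X⟧} (H : ∀ r s, Commute (PowerSeries.coeff r g) (PowerSeries.coeff s h)) :
    inX A g * inY A h = inY A h * inX A g := by
  apply ext_two
  intro r s
  rw [coeff_inX_mul_inY, coeff_inY_mul_inX]
  exact H r s

theorem coeff_inX (g : A⟦X⟧) (r s : ℕ) : PowerSeries.coeff r (PowerSeries.coeff s (inX A g)) =
    if s = 0 then PowerSeries.coeff r g else 0 := by
  rw [inX, PowerSeries.coeff_C]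
  split_ifs <;> simp

theorem coeff_inY (g : A⟦X⟧) (r s : ℕ) : PowerSeries.coeff r (PowerSeries.coeff s (inY A g)) =
    if r = 0 then PowerSeries.coeff s g else 0 := by
  rw [inY, PowerSeries.coeff_map, PowerSeries.coeff_C]

/-- The relations between `a(u)` and `e(u) = a(u)⁻¹ b(u)`. -/
structure HalfRel (a e : A⟦X⟧) : Prop where
  const_e : PowerSeries.coeff 0 e = 0
  a_e : ∀ r s, 0 < s →
    (PowerSeries.coeff (r + 1) a * PowerSeries.coeff s e -
        PowerSeries.coeff s e * PowerSeries.coeff (r + 1) a) -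
      (PowerSeries.coeff r a * PowerSeries.coeff (s + 1) e -
        PowerSeries.coeff (s + 1) e * PowerSeries.coeff r a) =
    PowerSeries.coeff r a * PowerSeries.coeff s e
  e_e : ∀ r s, 0 < r → 0 < s →
    (PowerSeries.coeff (r + 1) e * PowerSeries.coeff s e -
        PowerSeries.coeff s e * PowerSeries.coeff (r + 1) e) -
      (PowerSeries.coeff r e * PowerSeries.coeff (s + 1) e -
        PowerSeries.coeff (s + 1) e * PowerSeries.coeff r e) =
    -(PowerSeries.coeff r e * PowerSeries.coeff s e + PowerSeries.coeff s e * PowerSeries.coeff r e)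
  e_one : ∀ r, PowerSeries.coeff 1 e * PowerSeries.coeff r e -
    PowerSeries.coeff r e * PowerSeries.coeff 1 e = PowerSeries.coeff r (e * e)

theorem RowRel.halfRel {a b ai : A⟦X⟧} (H : RowRel a b) (h1 : a * ai = 1) (h2 : ai * a = 1) :
    HalfRel a (ai * b) := by
  set e := ai * b with he
  have hae : a * e = b := by rw [he, ← mul_assoc, h1, one_mul]
  have const_ai : PowerSeries.coeff 0 ai = 1 := by
    have := congrArg (PowerSeries.coeff 0) h1
    simpa [PowerSeries.coeff_mul, H.const_a, PowerSeries.coeff_one] using this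
  have const_e : PowerSeries.coeff 0 e = 0 := by
    simp [he, PowerSeries.coeff_mul, H.const_b]
  clear_value e
  have unit_a : IsUnit a := ⟨⟨a, ai, h1, h2⟩, rfl⟩
  have haa := inX_inY_comm H.comm_a
  have hbb := inX_inY_comm H.comm_b
  have hX : inX A a * inX A e = inX A b := by rw [← map_mul, hae]
  have hY : inY A a * inY A e = inY A b := by rw [← map_mul, hae]
  have uX : IsUnit (inX A a) := unit_a.map (inX A)
  have uY : IsUnit (inY A a) := unit_a.map (inY A)
  have E1 := exchange_a_e uY haa hX hY H.rel.twoVarRel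
  -- The same relation with the two variables interchanged, needed to move `a(v)` past `e(u)`.
  have H' : (cX A - cY A) • (inY A a * inX A b - inX A b * inY A a) =
      (cY A * cX A) • (inY A a * inX A b - inX A a * inY A b) := by
    have h := H.rel
    apply ext_two
    intro r s
    rw [sub_smul, mul_smul]
    rcases r with _ | r <;> rcases s with _ | s <;>
    simp only [map_sub, coeff_cX_smul_zero, coeff_cY_smul_zero, coeff_cX_smul_succ,
      coeff_cY_smul_succ, coeff_inX_mul_inY, coeff_inY_mul_inX, sub_zero, zero_sub, neg_eq_zero]
    · exact sub_eq_zero.2 (h.right _)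
    · exact sub_eq_zero.2 (h.left _)
    · exact h.rel s r
  have E1' := exchange_a_e uX haa.symm hY hX H'
  have E2 := exchange_e_e uX uY haa hbb hX hY E1 E1'
  refine ⟨const_e, fun r s hs => ?_, fun r s hr hs => ?_, fun r => ?_⟩
  · have := congrArg (fun F => PowerSeries.coeff (r + 1) (PowerSeries.coeff (s + 1) F)) E1
    rw [sub_smul, mul_smul, mul_sub, hX] at this
    simpa only [map_sub, coeff_cX_smul_zero, coeff_cY_smul_zero, coeff_cX_smul_succ,
      coeff_cY_smul_succ, coeff_inX_mul_inY, coeff_inY_mul_inX, sub_zero, coeff_inX,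
      if_neg hs.ne'] using this
  · have := congrArg (fun F => PowerSeries.coeff (r + 1) (PowerSeries.coeff (s + 1) F)) E2
    rw [sub_smul, mul_smul, ← map_mul, ← map_mul] at this
    simp only [map_sub, map_add, coeff_cX_smul_succ, coeff_cY_smul_succ, coeff_inX_mul_inY,
      coeff_inY_mul_inX, coeff_inX, coeff_inY, if_neg hs.ne', if_neg hr.ne'] at this
    rw [this]
    abel
  -- Here `e⁽¹⁾ = b⁽¹⁾`, and commutation with `b⁽¹⁾` is a derivation that sends `a` to `-b` and `b`
  -- to `0`. Applied to `a e = b` it gives `[b⁽¹⁾, e] = a⁻¹ b e = e²`.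
  · have hb1 : PowerSeries.coeff 1 e = PowerSeries.coeff 1 b := by
      have := congrArg (PowerSeries.coeff 1) hae
      simpa [PowerSeries.coeff_mul, Finset.Nat.antidiagonal_succ, H.const_a, const_e] using this
    have hC : PowerSeries.C (PowerSeries.coeff 1 b) * a = a * PowerSeries.C (PowerSeries.coeff 1 b) - b := by
      ext s
      have := H.rel.rel s 0
      simp only [H.const_b, H.const_a, mul_zero, zero_mul, sub_zero, zero_sub, one_mul, zero_add] at this
      rw [map_sub, PowerSeries.coeff_C_mul, PowerSeries.coeff_mul_C]
      rw [← sub_eq_zero] at this ⊢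
      rw [← this]
      abel
    have hCb : PowerSeries.C (PowerSeries.coeff 1 b) * b = b * PowerSeries.C (PowerSeries.coeff 1 b) := by
      ext s
      rw [PowerSeries.coeff_C_mul, PowerSeries.coeff_mul_C]
      exact H.comm_b _ _
    have : PowerSeries.C (PowerSeries.coeff 1 b) * e - e * PowerSeries.C (PowerSeries.coeff 1 b) = e * e := by
      apply unit_a.mul_left_cancel
      rw [mul_sub, ← mul_assoc a _ e, ← mul_assoc a e, ← mul_assoc a e e, hae, ← hCb]
      have : a * PowerSeries.C (PowerSeries.coeff 1 b) = PowerSeries.C (PowerSeries.coeff 1 b) * a + b := by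
        rw [hC]; abel
      rw [this, add_mul, mul_assoc _ a e, hae]
      abel
    rw [← this, map_sub, PowerSeries.coeff_C_mul, PowerSeries.coeff_mul_C, hb1]

end Half

/-! ### Passage to the opposite ring -/

section Opposite

variable {A : Type*} [Ring A]

/-- A power series over `A`, regarded as a power series over the opposite ring. -/
def opSeries (g : A⟦X⟧) : (Aᵐᵒᵖ)⟦X⟧ := PowerSeries.mk fun n => MulOpposite.op (PowerSeries.coeff n g)

theorem coeff_opSeries (g : A⟦X⟧) (n : ℕ) :
    PowerSeries.coeff n (opSeries g) = MulOpposite.op (PowerSeries.coeff n g) := PowerSeries.coeff_mk _ _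

theorem opSeries_mul (g h : A⟦X⟧) : opSeries (g * h) = opSeries h * opSeries g := by
  ext n
  rw [coeff_opSeries, PowerSeries.coeff_mul, PowerSeries.coeff_mul, Finset.op_sum,
    ← Finset.Nat.sum_antidiagonal_swap]
  simp [coeff_opSeries]

theorem opSeries_one : opSeries (1 : A⟦X⟧) = 1 := by
  ext n
  rw [coeff_opSeries, PowerSeries.coeff_one, PowerSeries.coeff_one]
  split_ifs <;> simp

end Opposite

/-! ### Solutions of the RTT relations -/

section RTT

variable {A : Type*} [Ring A]

/-- The RTT relations for a `2 × 2` matrix `T(u)` of series with constant term the identity. -/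
structure IsRTT (T : Fin 2 → Fin 2 → A⟦X⟧) : Prop where
  const : ∀ i j, PowerSeries.coeff 0 (T i j) = if i = j then 1 else 0
  rel : ∀ i j k l r s,
    (PowerSeries.coeff (r + 1) (T i j) * PowerSeries.coeff s (T k l) -
        PowerSeries.coeff s (T k l) * PowerSeries.coeff (r + 1) (T i j)) -
      (PowerSeries.coeff r (T i j) * PowerSeries.coeff (s + 1) (T k l) -
        PowerSeries.coeff (s + 1) (T k l) * PowerSeries.coeff r (T i j)) =
    PowerSeries.coeff r (T k j) * PowerSeries.coeff s (T i l) -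
      PowerSeries.coeff s (T k j) * PowerSeries.coeff r (T i l)

namespace IsRTT

variable {T : Fin 2 → Fin 2 → A⟦X⟧} (H : IsRTT T)
include H

theorem commute_const_left (i j k l : Fin 2) (s : ℕ) :
    Commute (PowerSeries.coeff 0 (T i j)) (PowerSeries.coeff s (T k l)) := by
  rw [H.const]
  split_ifs
  exacts [Commute.one_left _, Commute.zero_left _]

theorem coeffRel (i j k l : Fin 2) : CoeffRel (T i j) (T k l) (T k j) (T i l) (T k j) (T i l) :=
  ⟨fun s => H.commute_const_left _ _ _ _ s, fun r => (H.commute_const_left _ _ _ _ r).symm,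
    H.rel i j k l⟩

/-- The commutator of two coefficients as a finite sum. -/
theorem commutator (i j k l : Fin 2) (r s : ℕ) :
    PowerSeries.coeff r (T i j) * PowerSeries.coeff s (T k l) -
        PowerSeries.coeff s (T k l) * PowerSeries.coeff r (T i j) =
    ∑ t ∈ Finset.range r, (PowerSeries.coeff t (T k j) * PowerSeries.coeff (r + s - 1 - t) (T i l) -
      PowerSeries.coeff (r + s - 1 - t) (T k j) * PowerSeries.coeff t (T i l)) := by
  induction r generalizing s with
  | zero => simpa using sub_eq_zero.2 (H.commute_const_left i j k l s)
  | succ r ih =>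
    rw [Finset.sum_range_succ, sub_eq_iff_eq_add.1 (H.rel i j k l r s), ih (s + 1)]
    have h1 : r + 1 + s - 1 = r + (s + 1) - 1 := by omega
    have h2 : r + (s + 1) - 1 - r = s := by omega
    rw [h1, h2, add_comm]

/-- For equal index pairs the commutator formula contains only commutators of the same entry with
total index `r + s - 1`, so induction applies. -/
theorem commute_self (i j : Fin 2) (r s : ℕ) :
    Commute (PowerSeries.coeff r (T i j)) (PowerSeries.coeff s (T i j)) := by
  induction hm : r + s using Nat.strong_induction_on generalizing r s with
  | _ m ih =>
    rw [Commute, SemiconjBy, ← sub_eq_zero, H.commutator]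
    refine Finset.sum_eq_zero fun t ht => sub_eq_zero.2 ?_
    rw [Finset.mem_range] at ht
    exact ih (r + s - 1) (by omega) t _ (by omega)

theorem rowRel : RowRel (T 0 0) (T 0 1) where
  const_a := by simp [H.const]
  const_b := by simp [H.const]
  comm_a := H.commute_self 0 0
  comm_b := H.commute_self 0 1
  rel := H.coeffRel 0 0 0 1

/-- In the opposite ring the first column satisfies the relations of a first row. Every statement
about `f(u)` thus follows from the one about `e(u)`. -/
theorem colRel : RowRel (opSeries (T 0 0)) (opSeries (T 1 0)) where
  const_a := by simp [coeff_opSeries, H.const]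
  const_b := by simp [coeff_opSeries, H.const]
  comm_a r s := by simpa only [coeff_opSeries] using (H.commute_self 0 0 r s).op
  comm_b r s := by simpa only [coeff_opSeries] using (H.commute_self 1 0 r s).op
  rel := by
    refine ⟨fun s => ?_, fun r => ?_, fun r s => ?_⟩
    · simpa only [coeff_opSeries] using (H.commute_const_left 0 0 1 0 s).op
    · simpa only [coeff_opSeries] using (H.commute_const_left 1 0 0 0 r).symm.op
    · have := H.rel 0 0 1 0 r s
      simp only [coeff_opSeries, ← MulOpposite.op_mul, ← MulOpposite.op_sub]
      congr 1
      rw [← neg_inj, ← sub_eq_zero] at this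
      rw [← sub_eq_zero, ← this]
      abel

theorem halfRel {ai : A⟦X⟧} (h1 : T 0 0 * ai = 1) (h2 : ai * T 0 0 = 1) :
    HalfRel (T 0 0) (ai * T 0 1) := H.rowRel.halfRel h1 h2

theorem halfRel_op {ai : A⟦X⟧} (h1 : T 0 0 * ai = 1) (h2 : ai * T 0 0 = 1) :
    HalfRel (opSeries (T 0 0)) (opSeries (T 1 0 * ai)) := by
  rw [opSeries_mul]
  exact H.colRel.halfRel (by rw [← opSeries_mul, h2, opSeries_one])
    (by rw [← opSeries_mul, h1, opSeries_one])

end IsRTT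

end RTT

/-! ### Vanishing of long products -/

section Nilpotent

variable {A : Type*} [Ring A] {a e : A⟦X⟧}

/-- The case `s = 1` is the formula for `[e⁽¹⁾, e⁽ʳ⁾]`, and the exchange relation raises `s`. What
matters later is that both indices in each term lie between `s` and `r - 1`, and that their sum is
`r + s - 1`. -/
theorem HalfRel.commutator (H : HalfRel a e) {s r : ℕ} (hs : 0 < s) (hsr : s < r) :
    PowerSeries.coeff r e * PowerSeries.coeff s e - PowerSeries.coeff s e * PowerSeries.coeff r e =
      - ∑ t ∈ Finset.Ico s r, PowerSeries.coeff t e * PowerSeries.coeff (r + s - 1 - t) e := by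
  induction s, hs using Nat.le_induction generalizing r with
  | base =>
    simp only [Nat.succ_eq_add_one, zero_add] at hsr ⊢
    rw [← neg_sub, H.e_one, PowerSeries.coeff_mul, Finset.Nat.sum_antidiagonal_eq_sum_range_succ
      (fun i j => PowerSeries.coeff i e * PowerSeries.coeff j e), Finset.sum_range_succ,
      Finset.range_eq_Ico, Finset.sum_eq_sum_Ico_succ_bot (by omega)]
    simp [H.const_e]
  | succ s hs ih =>
    have h1 := H.e_e r s (by omega) hs
    rw [ih (show s < r + 1 by omega), Finset.sum_Ico_succ_top (by omega),
      Finset.sum_eq_sum_Ico_succ_bot (by omega)] at h1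
    have h2 : r + 1 + s - 1 = r + s := by omega
    have h3 : r + (s + 1) - 1 = r + s := by omega
    rw [h2, Nat.add_sub_cancel, Nat.add_sub_cancel_left] at h1
    rw [h3, ← sub_eq_zero]
    rw [← sub_eq_zero] at h1
    rw [← neg_eq_zero, ← h1]
    abel

/-- If `(e⁽ʳ⁾)ᵖ = 0` for all `r > 0`, then long products of `e⁽¹⁾, …, e⁽ˡ⁾` vanish. -/
theorem HalfRel.list_prod_eq_zero (H : HalfRel a e) {p : ℕ}
    (hp : ∀ r, 0 < r → PowerSeries.coeff r e ^ p = 0) (l : ℕ) (L : List ℕ)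
    (hL : ∀ x ∈ L, 0 < x ∧ x ≤ l) (hlen : l * (p - 1) < L.length) :
    (L.map fun r => PowerSeries.coeff r e).prod = 0 := by
  induction hm : L.sum using Nat.strong_induction_on generalizing L with
  | _ m ih =>
  -- The induction is on the sum of the indices. A swap of neighbours changes the product by
  -- products with the same length and index bound but a smaller sum, which vanish by induction; so
  -- the product does not depend on the order. The prefix `P` carries the factors already passed.
  have perm : ∀ {L₁ L₂ : List ℕ}, L₁.Perm L₂ → ∀ P : List ℕ,
      (∀ x ∈ P ++ L₁, 0 < x ∧ x ≤ l) → l * (p - 1) < (P ++ L₁).length → (P ++ L₁).sum = m →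
      ((P ++ L₁).map fun r => PowerSeries.coeff r e).prod =
        ((P ++ L₂).map fun r => PowerSeries.coeff r e).prod := by
    intro L₁ L₂ hperm
    induction hperm with
    | nil => intros; rfl
    | cons x _ ih' =>
      intro P h1 h2 h3
      simpa using ih' (P ++ [x]) (by simpa using h1) (by simpa using h2) (by simpa using h3)
    | @swap x y L =>
      intro P h1 h2 h3
      have key : ∀ x y : ℕ, 0 < y → y < x → x ≤ l → l * (p - 1) < P.length + (L.length + 2) →
          P.sum + (x + (y + L.sum)) = m →
          ((P.map fun r => PowerSeries.coeff r e).prod * ((PowerSeries.coeff x e * PowerSeries.coeff y e -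
            PowerSeries.coeff y e * PowerSeries.coeff x e) *
            (L.map fun r => PowerSeries.coeff r e).prod)) = 0 := by
        intro x y hy hxy hx hlen hsum
        rw [H.commutator hy hxy, neg_mul, mul_neg, Finset.sum_mul, Finset.mul_sum, neg_eq_zero]
        refine Finset.sum_eq_zero fun t ht => ?_
        rw [Finset.mem_Ico] at ht
        have := ih (P ++ t :: (x + y - 1 - t) :: L).sum (by simp; omega) (P ++ t :: (x + y - 1 - t) :: L)
          ?_ (by simp; omega) rfl
        · simpa [mul_assoc] using this
        · intro z hz
          simp only [List.mem_append, List.mem_cons] at hz h1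
          rcases hz with hz | rfl | rfl | hz
          · exact h1 z (Or.inl hz)
          · omega
          · omega
          · exact h1 z (by simp [hz])
      have hx := h1 x (by simp)
      have hy := h1 y (by simp)
      simp only [List.length_append, List.length_cons] at h2
      simp only [List.sum_append, List.sum_cons] at h3
      rw [← sub_eq_zero]
      simp only [List.map_append, List.map_cons, List.prod_append, List.prod_cons, ← mul_assoc, ← sub_mul]
      rcases lt_trichotomy x y with h | rfl | h
      · have := key y x hx.1 h hy.2 (by omega) (by omega)
        simpa [mul_sub, sub_mul, mul_assoc] using this
      · simp
      · have := key x y hy.1 h hx.2 (by omega) (by omega)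
        rw [← neg_eq_zero]
        simpa [mul_sub, sub_mul, mul_assoc] using this
    | trans h₁ h₂ ih₁ ih₂ =>
      intro P h1 h2 h3
      rw [ih₁ P h1 h2 h3, ih₂ P]
      · intro x hx
        apply h1
        rcases List.mem_append.1 hx with hx | hx
        · simp [hx]
        · simp [h₁.mem_iff.2 hx]
      · simpa [h₁.length_eq] using h2
      · simpa [h₁.sum_eq] using h3
  -- Pigeonhole: if each of the `l` indices occurred at most `p - 1` times, the list would be too
  -- short. An index occurring `p` times is then moved to the front.
  obtain ⟨c, hc, hcount⟩ : ∃ c ∈ L, p ≤ L.count c := by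
    by_contra! hcon
    have h1 : L.length ≤ ∑ c ∈ Finset.Icc 1 l, (p - 1) := by
      have h2 : L.length = ∑ c ∈ Finset.Icc 1 l, L.count c := by
        have := Multiset.sum_count_eq_card (s := Finset.Icc 1 l) (m := (L : Multiset ℕ)) (by
          intro x hx
          have := hL x (by simpa using hx)
          simp; omega)
        simpa using this.symm
      rw [h2]
      refine Finset.sum_le_sum fun c _ => ?_
      by_cases hc : c ∈ L
      · have := hcon c hc
        omega
      · rw [List.count_eq_zero_of_not_mem hc]
        omega
    simp at h1
    omega
  obtain ⟨L', hL'⟩ := (List.replicate_sublist_iff.2 hcount).exists_perm_append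
  have := perm hL' [] (by simpa using hL) (by simpa using hlen) (by simpa using hm)
  rw [List.nil_append, List.nil_append] at this
  rw [this, List.map_append, List.prod_append, List.map_replicate, List.prod_replicate,
    hp c (hL c hc).1, zero_mul]

end Nilpotent

/-! ### `p`-th powers of sums of elements that commute up to scalars -/

section Exchange

variable {K : Type*} [Field K]

/-- The exchange factor `(x - y - 1) / (x - y)`. -/
def exch (x y : K) : K := (x - y - 1) / (x - y)

/-- Lagrange interpolation at the points of `T`, applied to `∏ (X - j - 1) - ∏ (X - j)`. This has
degree below `|T|`, its coefficient in degree `|T| - 1` is `-|T|`, and its value at `k` is `-∏_{j ≠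
k} (k - j - 1)`. -/
theorem sum_prod_exch [DecidableEq K] (T : Finset K) :
    ∑ k ∈ T, ∏ j ∈ T.erase k, exch k j = (T.card : K) := by
  rcases T.eq_empty_or_nonempty with rfl | hT
  · simp
  set n := T.card with hn
  have hn0 : 0 < n := hT.card_pos
  set Q₁ : Polynomial K := ∏ j ∈ T, (Polynomial.X - Polynomial.C (j + 1)) with hQ₁
  set Q₀ : Polynomial K := ∏ j ∈ T, (Polynomial.X - Polynomial.C j) with hQ₀
  have hm₁ : Q₁.Monic := Polynomial.monic_prod_of_monic _ _ fun j _ => Polynomial.monic_X_sub_C _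
  have hm₀ : Q₀.Monic := Polynomial.monic_prod_of_monic _ _ fun j _ => Polynomial.monic_X_sub_C _
  have hd₁ : Q₁.natDegree = n := by
    rw [hQ₁, Polynomial.natDegree_prod_of_monic _ _ fun j _ => Polynomial.monic_X_sub_C _]
    simp only [Polynomial.natDegree_X_sub_C, Finset.sum_const, smul_eq_mul, mul_one, hn]
  have hd₀ : Q₀.natDegree = n := by
    rw [hQ₀, Polynomial.natDegree_prod_of_monic _ _ fun j _ => Polynomial.monic_X_sub_C _]
    simp only [Polynomial.natDegree_X_sub_C, Finset.sum_const, smul_eq_mul, mul_one, hn]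
  have hdeg : (Q₁ - Q₀).degree < T.card := by
    have h1 : Q₁.degree = n := by rw [Polynomial.degree_eq_natDegree hm₁.ne_zero, hd₁]
    have h0 : Q₀.degree = n := by rw [Polynomial.degree_eq_natDegree hm₀.ne_zero, hd₀]
    rw [← hn, ← h1]
    exact Polynomial.degree_sub_lt_left (h1.trans h0.symm) hm₁.ne_zero (by rw [hm₁.leadingCoeff, hm₀.leadingCoeff])
  have key := Lagrange.coeff_eq_sum (s := T) (v := id) (Function.injective_id.injOn) hdeg
  have hc : (Q₁ - Q₀).coeff (T.card - 1) = -(n : K) := by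
    have h1 : Q₁.coeff (T.card - 1) = - ∑ j ∈ T, (j + 1) := Polynomial.prod_X_sub_C_coeff_card_pred T _ hn0
    have h0 : Q₀.coeff (T.card - 1) = - ∑ j ∈ T, j := Polynomial.prod_X_sub_C_coeff_card_pred T _ hn0
    rw [Polynomial.coeff_sub, h1, h0, Finset.sum_add_distrib]
    simp [hn]
  rw [hc] at key
  rw [← neg_inj, key, ← Finset.sum_neg_distrib]
  refine Finset.sum_congr rfl fun k hk => ?_
  have e0 : Q₀.eval k = 0 := by
    rw [hQ₀, Polynomial.eval_prod]
    exact Finset.prod_eq_zero hk (by simp)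
  have e1 : Q₁.eval k = - ∏ j ∈ T.erase k, (k - j - 1) := by
    rw [hQ₁, Polynomial.eval_prod, ← Finset.mul_prod_erase T _ hk]
    simp [sub_sub]
  simp only [id, Polynomial.eval_sub, e0, e1, sub_zero, exch, Finset.prod_div_distrib, neg_div]

variable {B : Type*} [Ring B] [Algebra K B] (E : K → B)

/-- The ordered product of the `E k` for `k` in a list, normalized so as not to depend on the
order. -/
def normProd : List K → B
  | [] => 1
  | k :: L => (L.map fun j => exch k j).prod⁻¹ • (E k * normProd L)

variable {E} {S : Set K}

/-- The exchange relation says that `E k * E l` and `E l * E k` differ by exactly the ratio of the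
factors `exch k l` and `exch l k`. Since no two points differ by `1`, these factors can be inverted.
-/
theorem normProd_perm (hE : ∀ k ∈ S, ∀ l ∈ S, k ≠ l → (k - l + 1) • (E k * E l) = (k - l - 1) • (E l * E k))
    (hS : ∀ k ∈ S, ∀ l ∈ S, k - l ≠ 1) {L L' : List K} (h : L.Perm L') (hL : ∀ k ∈ L, k ∈ S)
    : normProd E L = normProd E L' := by
  induction h with
  | nil => rfl
  | cons k h ih =>
    rw [normProd, normProd, ih fun k hk => hL k (List.mem_cons_of_mem _ hk), (h.map _).prod_eq]
  | swap k l L =>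
    by_cases hkl : k = l
    · rw [hkl]
    have hk := hL k (by simp)
    have hl := hL l (by simp)
    have h1 : k - l ≠ 0 := sub_ne_zero.2 hkl
    have h2 : l - k ≠ 0 := sub_ne_zero.2 (Ne.symm hkl)
    have h3 : k - l - 1 ≠ 0 := sub_ne_zero.2 (hS k hk l hl)
    have h4 : l - k - 1 ≠ 0 := sub_ne_zero.2 (hS l hl k hk)
    have h5 : k - l + 1 ≠ 0 := fun h => h4 (by linear_combination -h)
    have rel := hE k hk l hl hkl
    have rel' : E l * E k = ((k - l + 1) / (k - l - 1)) • (E k * E l) := by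
      rw [div_eq_inv_mul, mul_smul, rel, smul_smul, inv_mul_cancel₀ h3, one_smul]
    simp only [normProd, List.map_cons, List.prod_cons, mul_smul_comm, smul_smul, ← mul_assoc, rel', smul_mul_assoc]
    congr 1
    simp only [exch, mul_inv, inv_div]
    have : k - l = -(l - k) := by ring
    field_simp
    ring
  | trans h₁ h₂ ih₁ ih₂ =>
    rw [ih₁ hL, ih₂ fun k hk => hL k (h₁.mem_iff.2 hk)]

theorem mul_normProd_toList [DecidableEq K]
    (hE : ∀ k ∈ S, ∀ l ∈ S, k ≠ l → (k - l + 1) • (E k * E l) = (k - l - 1) • (E l * E k))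
    (hE2 : ∀ k ∈ S, E k * E k = 0)
    (hS : ∀ k ∈ S, ∀ l ∈ S, k - l ≠ 1) {T : Finset K} (hT : ∀ k ∈ T, k ∈ S) {k : K} (hk : k ∈ S) :
    E k * normProd E T.toList =
      if k ∈ T then 0 else (∏ j ∈ T, exch k j) • normProd E (insert k T).toList := by
  split_ifs with hkT
  · have hp : T.toList.Perm (k :: (T.erase k).toList) := by
      have := Finset.toList_insert (Finset.notMem_erase k T)
      rwa [Finset.insert_erase hkT] at this
    rw [normProd_perm hE hS hp (by simpa using hT), normProd, mul_smul_comm, ← mul_assoc, hE2 k hk,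
      zero_mul, smul_zero]
  · rw [normProd_perm hE hS (Finset.toList_insert hkT) (by simpa using ⟨hk, hT⟩), normProd, smul_smul,
      Finset.prod_map_toList, mul_inv_cancel₀, one_smul]
    refine Finset.prod_ne_zero_iff.2 fun j hj => div_ne_zero ?_ ?_
    · exact sub_ne_zero.2 (hS k hk j (hT j hj))
    · exact sub_ne_zero.2 fun h => hkT (h ▸ hj)

/-- An analogue of the multinomial theorem for square-zero elements. In `(∑ E k)^(m+1)` the product
over a set `T` arises once for each choice of the leftmost factor `k ∈ T`, with coefficient `∏ exch
k j`; by `sum_prod_exch` these coefficients add up to `|T| = m + 1`. -/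
theorem sum_pow_eq {S : Finset K}
    (hE : ∀ k ∈ S, ∀ l ∈ S, k ≠ l → (k - l + 1) • (E k * E l) = (k - l - 1) • (E l * E k))
    (hE2 : ∀ k ∈ S, E k * E k = 0) (hS : ∀ k ∈ S, ∀ l ∈ S, k - l ≠ 1) (m : ℕ) :
    (∑ k ∈ S, E k) ^ m = (m.factorial : K) • ∑ T ∈ S.powersetCard m, normProd E T.toList := by
  classical
  induction m with
  | zero => simp [normProd]
  | succ m ih =>
    rw [pow_succ', ih, mul_smul_comm, Finset.sum_mul_sum, Nat.factorial_succ, mul_comm (m + 1),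
      Nat.cast_mul, mul_smul]
    congr 1
    have h1 : ∀ k ∈ S, ∑ T ∈ S.powersetCard m, E k * normProd E T.toList =
        ∑ T ∈ (S.powersetCard m).filter fun T => k ∉ T,
          (∏ j ∈ T, exch k j) • normProd E (insert k T).toList := by
      intro k hk
      rw [Finset.sum_filter]
      refine Finset.sum_congr rfl fun T hT => ?_
      rw [mul_normProd_toList (S := (S : Set K)) (by simpa using hE) (by simpa using hE2) (by simpa using hS)
        (fun j hj => (Finset.mem_powersetCard.1 hT).1 hj) hk]
      by_cases h : k ∈ T <;> simp [h]
    rw [Finset.sum_congr rfl h1, Finset.smul_sum]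
    have h2 : ∀ T ∈ S.powersetCard (m + 1), ((m + 1 : ℕ) : K) • normProd E T.toList =
        ∑ k ∈ T, (∏ j ∈ T.erase k, exch k j) • normProd E T.toList := by
      intro T hT
      rw [← Finset.sum_smul, sum_prod_exch, (Finset.mem_powersetCard.1 hT).2]
    rw [Finset.sum_congr rfl h2, Finset.sum_sigma', Finset.sum_sigma']
    refine Finset.sum_bij' (fun x _ => ⟨insert x.1 x.2, x.1⟩) (fun x _ => ⟨x.2, x.1.erase x.2⟩)
      ?_ ?_ ?_ ?_ ?_
    · rintro ⟨k, T⟩ h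
      simp only [Finset.mem_sigma, Finset.mem_filter, Finset.mem_powersetCard] at h ⊢
      exact ⟨⟨Finset.insert_subset h.1 h.2.1.1, by rw [Finset.card_insert_of_notMem h.2.2, h.2.1.2]⟩,
        Finset.mem_insert_self _ _⟩
    · rintro ⟨T, k⟩ h
      simp only [Finset.mem_sigma, Finset.mem_filter, Finset.mem_powersetCard] at h ⊢
      exact ⟨h.1.1 h.2, ⟨(Finset.erase_subset _ _).trans h.1.1, by
        rw [Finset.card_erase_of_mem h.2, h.1.2, Nat.add_sub_cancel]⟩, Finset.notMem_erase _ _⟩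
    · rintro ⟨k, T⟩ h
      simp only [Finset.mem_sigma, Finset.mem_filter, Finset.mem_powersetCard] at h ⊢
      rw [Finset.erase_insert h.2.2]
    · rintro ⟨T, k⟩ h
      simp only [Finset.mem_sigma, Finset.mem_powersetCard] at h ⊢
      rw [Finset.insert_erase h.2]
    · rintro ⟨k, T⟩ h
      simp only [Finset.mem_sigma, Finset.mem_filter, Finset.mem_powersetCard] at h ⊢
      rw [Finset.erase_insert h.2.2]

/-- The Frobenius-type vanishing: `(∑ E k)ᵖ = 0` in characteristic `p`. -/
theorem sum_pow_char_eq_zero (p : ℕ) (hp : 0 < p) [CharP K p] {S : Finset K}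
    (hE : ∀ k ∈ S, ∀ l ∈ S, k ≠ l → (k - l + 1) • (E k * E l) = (k - l - 1) • (E l * E k))
    (hE2 : ∀ k ∈ S, E k * E k = 0) (hS : ∀ k ∈ S, ∀ l ∈ S, k - l ≠ 1) (c : K → K) :
    (∑ k ∈ S, c k • E k) ^ p = 0 := by
  -- The scalars `c k` are absorbed into `E k`, because the required relations are homogeneous in
  -- each `E k`.
  rw [sum_pow_eq (E := fun k => c k • E k) _ _ hS, (CharP.cast_eq_zero_iff K p _).2
    (Nat.dvd_factorial hp le_rfl), zero_smul]
  · intro k hk l hl hkl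
    simp only [smul_mul_smul_comm]
    rw [smul_comm, hE k hk l hl hkl, smul_comm (k - l - 1), mul_comm]
  · intro k hk
    simp only [smul_mul_smul_comm]
    rw [hE2 k hk, smul_zero]

end Exchange

/-! ### Vandermonde arguments -/

section Poles

variable {K : Type*} [Field K] {M : Type*} [AddCommGroup M] [Module K M]

theorem eval_smul_sum_eq_zero {S : Finset K} {G : K → M} (h : ∀ r : ℕ, ∑ y ∈ S, y ^ r • G y = 0)
    (P : Polynomial K) : ∑ y ∈ S, P.eval y • G y = 0 := by
  have : ∀ y ∈ S, P.eval y • G y = ∑ r ∈ P.support, P.coeff r • (y ^ r • G y) := by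
    intro y _
    rw [Polynomial.eval_eq_sum, Polynomial.sum, Finset.sum_smul]
    simp_rw [mul_smul]
  rw [Finset.sum_congr rfl this, Finset.sum_comm]
  simp_rw [← Finset.smul_sum, h, smul_zero, Finset.sum_const_zero]

/-- Powers may be replaced by any polynomial; one that vanishes on `S` except at `y` isolates `G y`.
-/
theorem eq_zero_of_pow_smul_sum {S : Finset K} {G : K → M}
    (h : ∀ r : ℕ, ∑ y ∈ S, y ^ r • G y = 0) {y : K} (hy : y ∈ S) : G y = 0 := by
  classical
  have := eval_smul_sum_eq_zero h (∏ j ∈ S.erase y, (Polynomial.X - Polynomial.C j))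
  rw [Finset.sum_eq_single y] at this
  · refine (smul_eq_zero.1 this).resolve_left ?_
    rw [Polynomial.eval_prod]
    refine Finset.prod_ne_zero_iff.2 fun j hj => ?_
    simpa using sub_ne_zero.2 (Finset.ne_of_mem_erase hj).symm
  · intro j hj hjy
    rw [Polynomial.eval_prod, Finset.prod_eq_zero (Finset.mem_erase.2 ⟨hjy, hj⟩) (by simp), zero_smul]
  · exact fun h => absurd hy h

/-- A confluent Vandermonde argument: it reads off the coefficient of a double pole, with `H`
collecting the simple poles. -/
theorem eq_zero_of_confluent_sum {S : Finset K} {G H : K → M}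
    (h : ∀ r : ℕ, ∑ y ∈ S, ((r * y ^ (r - 1)) • G y + y ^ r • H y) = 0) {y : K} (hy : y ∈ S) :
    G y = 0 := by
  classical
  have key : ∀ P : Polynomial K, ∑ y ∈ S, (P.derivative.eval y • G y + P.eval y • H y) = 0 := by
    intro P
    induction P using Polynomial.induction_on' with
    | add P Q hP hQ =>
      rw [← add_zero (0 : M)]
      nth_rewrite 1 [← hP]
      rw [← hQ, ← Finset.sum_add_distrib]
      refine Finset.sum_congr rfl fun y _ => ?_
      simp only [Polynomial.derivative_add, Polynomial.eval_add]
      module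
    | monomial n a =>
      rw [← smul_zero a, ← h n, Finset.smul_sum]
      refine Finset.sum_congr rfl fun y _ => ?_
      simp only [Polynomial.derivative_monomial, Polynomial.eval_monomial]
      module
  set Q : Polynomial K := ∏ j ∈ S.erase y, (Polynomial.X - Polynomial.C j) with hQ
  have hQ0 : Q.eval y ≠ 0 := by
    rw [hQ, Polynomial.eval_prod]
    refine Finset.prod_ne_zero_iff.2 fun j hj => ?_
    simpa using sub_ne_zero.2 (Finset.ne_of_mem_erase hj).symm
  -- The factor `Q * Q` kills value and derivative at every other point; the factor `X - y` kills
  -- the value at `y` and leaves the derivative `Q(y)²`.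
  have := key ((Polynomial.X - Polynomial.C y) * (Q * Q))
  rw [Finset.sum_eq_single y] at this
  · simp only [Polynomial.derivative_mul, Polynomial.derivative_sub, Polynomial.derivative_X,
      Polynomial.derivative_C, Polynomial.eval_add, Polynomial.eval_mul, Polynomial.eval_sub,
      Polynomial.eval_X, Polynomial.eval_C, sub_self, zero_mul, add_zero, sub_zero, one_mul,
      zero_smul] at this
    exact (smul_eq_zero.1 this).resolve_left (mul_ne_zero hQ0 hQ0)
  · intro j hj hjy
    have : Q.eval j = 0 := by
      rw [hQ, Polynomial.eval_prod, Finset.prod_eq_zero (Finset.mem_erase.2 ⟨hjy, hj⟩) (by simp)]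
    simp [Polynomial.derivative_mul, this]
  · exact fun h => absurd hy h

end Poles

/-! ### Series with simple poles and the relations of their residues -/

section HasPoles

variable {K : Type*} [Field K] {B : Type*} [Ring B] [Algebra K B]

attribute [local instance] seriesAlgebra

theorem coeff_succ_invSub (y : K) (r : ℕ) : PowerSeries.coeff (r + 1) (invSub K y) = y ^ r := by
  rw [invSub, PowerSeries.coeff_succ_X_mul, PowerSeries.coeff_mk]

theorem coeff_zero_invSub (y : K) : PowerSeries.coeff 0 (invSub K y) = 0 := by
  rw [invSub, PowerSeries.coeff_zero_X_mul]

theorem coeff_smul_C (r : ℕ) (φ : K⟦X⟧) (b : B) :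
    PowerSeries.coeff r (φ • (PowerSeries.C b : B⟦X⟧)) = PowerSeries.coeff r φ • b := by
  rw [series_smul_def, PowerSeries.coeff_mul_C, PowerSeries.coeff_map, Algebra.smul_def]

/-- Partial fractions for `1 / ((u - y) (u - l))`. -/
theorem invSub_mul_invSub {y l : K} (h : y ≠ l) :
    invSub K y * invSub K l = PowerSeries.C (y - l)⁻¹ * (invSub K y - invSub K l) := by
  have h1 := invSub_spec K y
  have h2 := invSub_spec K l
  have h3 : (PowerSeries.C (y - l)⁻¹ : K⟦X⟧) * (PowerSeries.C y - PowerSeries.C l) = 1 := by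
    rw [← map_sub, ← map_mul, inv_mul_cancel₀ (sub_ne_zero.2 h), map_one]
  apply mul_right_cancel₀ (one_sub_C_mul_X_ne_zero y)
  apply mul_right_cancel₀ (one_sub_C_mul_X_ne_zero l)
  have e1 : invSub K y * invSub K l * (1 - PowerSeries.C y * PowerSeries.X) *
      (1 - PowerSeries.C l * PowerSeries.X) = PowerSeries.X * PowerSeries.X := by
    linear_combination (invSub K l * (1 - PowerSeries.C l * PowerSeries.X)) * h1 + PowerSeries.X * h2
  rw [e1]
  linear_combination (-PowerSeries.C (y - l)⁻¹ * (1 - PowerSeries.C l * PowerSeries.X)) * h1 +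
    (PowerSeries.C (y - l)⁻¹ * (1 - PowerSeries.C y * PowerSeries.X)) * h2 -
      (PowerSeries.X * PowerSeries.X) * h3

theorem coeff_succ_invSub_sq (y : K) (r : ℕ) :
    PowerSeries.coeff (r + 1) (invSub K y * invSub K y) = r * y ^ (r - 1) := by
  have h : invSub K y * invSub K y =
      PowerSeries.X * invSub K y + PowerSeries.C y * (PowerSeries.X * (invSub K y * invSub K y)) := by
    linear_combination invSub K y * invSub_spec K y
  induction r with
  | zero =>
    rw [h, map_add, PowerSeries.coeff_C_mul, PowerSeries.coeff_succ_X_mul, PowerSeries.coeff_succ_X_mul,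
      coeff_zero_invSub, PowerSeries.coeff_mul]
    simp [coeff_zero_invSub]
  | succ r ih =>
    rw [h, map_add, PowerSeries.coeff_C_mul, PowerSeries.coeff_succ_X_mul, PowerSeries.coeff_succ_X_mul,
      coeff_succ_invSub, ih]
    rcases r with _ | r
    · simp
    · simp [pow_succ]
      ring

/-- The series `∑ E_y / (u - y)` over `y ∈ S`. -/
def poleSum (S : Finset K) (E : K → B) : B⟦X⟧ := ∑ y ∈ S, invSub K y • PowerSeries.C (E y)

theorem coeff_succ_poleSum (S : Finset K) (E : K → B) (r : ℕ) :
    PowerSeries.coeff (r + 1) (poleSum S E) = ∑ y ∈ S, y ^ r • E y := by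
  simp only [poleSum, map_sum, coeff_smul_C, coeff_succ_invSub]

theorem coeff_zero_poleSum (S : Finset K) (E : K → B) :
    PowerSeries.coeff 0 (poleSum S E) = 0 := by
  simp only [poleSum, map_sum, coeff_smul_C, coeff_zero_invSub, zero_smul, Finset.sum_const_zero]

/-- The series `g(u)` has at most simple poles, all in `S`. -/
def HasPoles (S : Finset K) (g : B⟦X⟧) : Prop := ∃ E : K → B, g = poleSum S E

theorem HasPoles.add {S : Finset K} {g h : B⟦X⟧} (hg : HasPoles S g) (hh : HasPoles S h) :
    HasPoles S (g + h) := by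
  obtain ⟨E, rfl⟩ := hg
  obtain ⟨F, rfl⟩ := hh
  exact ⟨E + F, by simp [poleSum, Finset.sum_add_distrib]⟩

theorem HasPoles.zero (S : Finset K) : HasPoles S (0 : B⟦X⟧) := ⟨0, by simp [poleSum]⟩

theorem HasPoles.C_mul {S : Finset K} {g : B⟦X⟧} (hg : HasPoles S g) (b : B) :
    HasPoles S (PowerSeries.C b * g) := by
  obtain ⟨E, rfl⟩ := hg
  exact ⟨fun y => b * E y, by simp only [poleSum, Finset.mul_sum, mul_smul_comm, map_mul]⟩

theorem HasPoles.mul_C {S : Finset K} {g : B⟦X⟧} (hg : HasPoles S g) (b : B) :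
    HasPoles S (g * PowerSeries.C b) := by
  obtain ⟨E, rfl⟩ := hg
  exact ⟨fun y => E y * b, by simp only [poleSum, Finset.sum_mul, smul_mul_assoc, map_mul]⟩

theorem HasPoles.neg {S : Finset K} {g : B⟦X⟧} (hg : HasPoles S g) : HasPoles S (-g) := by
  simpa using hg.C_mul (-1)

theorem HasPoles.sub {S : Finset K} {g h : B⟦X⟧} (hg : HasPoles S g) (hh : HasPoles S h) :
    HasPoles S (g - h) := sub_eq_add_neg g h ▸ hg.add hh.neg

theorem HasPoles.sum {ι : Type*} {S : Finset K} {s : Finset ι} {g : ι → B⟦X⟧}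
    (h : ∀ i ∈ s, HasPoles S (g i)) : HasPoles S (∑ i ∈ s, g i) := by
  classical
  induction s using Finset.induction with
  | empty => simpa using HasPoles.zero S
  | insert i s hi ih =>
    rw [Finset.sum_insert hi]
    exact (h i (Finset.mem_insert_self _ _)).add (ih fun j hj => h j (Finset.mem_insert_of_mem hj))

theorem hasPoles_invSub_smul_C {S : Finset K} {y : K} (hy : y ∈ S) (b : B) :
    HasPoles S (invSub K y • (PowerSeries.C b : B⟦X⟧)) := by
  classical
  refine ⟨Pi.single y b, ?_⟩
  rw [poleSum, Finset.sum_eq_single y]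
  · simp
  · intro j _ hj
    simp [hj]
  · exact fun h => absurd hy h

theorem HasPoles.mono {S S' : Finset K} {g : B⟦X⟧} (hg : HasPoles S g) (h : S ⊆ S') :
    HasPoles S' g := by
  obtain ⟨E, rfl⟩ := hg
  exact HasPoles.sum fun y hy => hasPoles_invSub_smul_C (h hy) _

theorem hasPoles_mul_invSub_smul_C {S : Finset K} {y l : K} (hy : y ∈ S) (hl : l ∈ S) (h : y ≠ l) (b : B) :
    HasPoles S ((invSub K y * invSub K l) • (PowerSeries.C b : B⟦X⟧)) := by
  have : (invSub K y * invSub K l) • (PowerSeries.C b : B⟦X⟧) =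
      PowerSeries.C (algebraMap K B (y - l)⁻¹) * (invSub K y • PowerSeries.C b - invSub K l • PowerSeries.C b) := by
    rw [invSub_mul_invSub h, mul_smul, sub_smul, series_smul_def (PowerSeries.C _), PowerSeries.map_C]
  rw [this]
  exact ((hasPoles_invSub_smul_C hy b).sub (hasPoles_invSub_smul_C hl b)).C_mul _

/-- The new pole `l` must lie outside of `S`, so that no double pole appears. -/
theorem HasPoles.invSub_smul {S S' : Finset K} {g : B⟦X⟧} (hg : HasPoles S g) (h : S ⊆ S') {l : K}
    (hl : l ∈ S') (hlS : l ∉ S) : HasPoles S' (invSub K l • g) := by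
  obtain ⟨E, rfl⟩ := hg
  rw [poleSum, Finset.smul_sum]
  refine HasPoles.sum fun y hy => ?_
  rw [smul_smul]
  exact hasPoles_mul_invSub_smul_C hl (h hy) (fun e => hlS (e ▸ hy)) _

variable {a e : B⟦X⟧} {S : Finset K} {E : K → B}

/-- The residues of `e(u)` square to zero. -/
theorem HalfRel.residue_sq (H : HalfRel a e) (he : e = poleSum S E) {y : K} (hy : y ∈ S) :
    E y * E y = 0 := by
  classical
  -- Since `e(u)² = [e⁽¹⁾, e(u)]`, the square has only simple poles. Expanding it by partial
  -- fractions, its double pole at `y` has coefficient `E y * E y`, which must vanish.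
  have hp : HasPoles S (e * e) := by
    have : e * e = PowerSeries.C (PowerSeries.coeff 1 e) * e - e * PowerSeries.C (PowerSeries.coeff 1 e) := by
      ext r
      rw [← H.e_one, map_sub, PowerSeries.coeff_C_mul, PowerSeries.coeff_mul_C]
    rw [this]
    exact (HasPoles.C_mul ⟨E, he⟩ _).sub (HasPoles.mul_C ⟨E, he⟩ _)
  have h1 : e * e = ∑ y ∈ S, (invSub K y * invSub K y) • PowerSeries.C (E y * E y) +
      ∑ y ∈ S, ∑ l ∈ S with l ≠ y, (invSub K y * invSub K l) • PowerSeries.C (E y * E l) := by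
    rw [← Finset.sum_add_distrib, he, poleSum, Finset.sum_mul_sum]
    refine Finset.sum_congr rfl fun y hy => ?_
    rw [Finset.sum_filter, ← Finset.add_sum_erase S _ hy, ← Finset.add_sum_erase S _ hy]
    simp only [smul_mul_smul_comm, map_mul, ne_eq, not_true_eq_false, if_false, zero_add]
    congr 1
    refine Finset.sum_congr rfl fun l hl => ?_
    rw [if_pos (Finset.ne_of_mem_erase hl)]
  have h2 : HasPoles S (∑ y ∈ S, (invSub K y * invSub K y) • (PowerSeries.C (E y * E y) : B⟦X⟧)) := by
    rw [eq_sub_of_add_eq h1.symm]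
    refine hp.sub (HasPoles.sum fun y hy => HasPoles.sum fun l hl => ?_)
    rw [Finset.mem_filter] at hl
    exact hasPoles_mul_invSub_smul_C hy hl.1 (Ne.symm hl.2) _
  obtain ⟨F, hF⟩ := h2
  refine eq_zero_of_confluent_sum (S := S) (G := fun y => E y * E y) (H := fun y => - F y) (fun r => ?_) hy
  have := congrArg (PowerSeries.coeff (r + 1)) hF
  rw [coeff_succ_poleSum, map_sum] at this
  simp only [coeff_smul_C, coeff_succ_invSub_sq] at this
  rw [Finset.sum_add_distrib, this]
  simp

/-- The exchange relation between the residues of `e(u)`. -/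
theorem HalfRel.residue_exchange (H : HalfRel a e) (he : e = poleSum S E) {y l : K} (hy : y ∈ S) (hl : l ∈ S) :
    (y - l + 1) • (E y * E l) = (y - l - 1) • (E l * E y) := by
  -- The exchange relation in degrees `r + 1` and `s + 1`, expanded in residues. Applying the
  -- Vandermonde argument in each variable extracts a single pair of points.
  have key : ∀ r s : ℕ, ∑ y ∈ S, y ^ r • ∑ l ∈ S, l ^ s •
      ((y - l + 1) • (E y * E l) - (y - l - 1) • (E l * E y)) = 0 := by
    intro r s
    have h := H.e_e (r + 1) (s + 1) r.succ_pos s.succ_pos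
    rw [← sub_eq_zero] at h
    rw [← h, he]
    simp only [coeff_succ_poleSum]
    have e1 : ∀ r s, (∑ y ∈ S, y ^ r • E y) * (∑ l ∈ S, l ^ s • E l) =
        ∑ y ∈ S, ∑ l ∈ S, (y ^ r * l ^ s) • (E y * E l) := by
      intro r s
      rw [Finset.sum_mul_sum]
      simp only [smul_mul_smul_comm]
    have e2 : ∀ r s, (∑ y ∈ S, y ^ r • E y) * (∑ l ∈ S, l ^ s • E l) =
        ∑ y ∈ S, ∑ l ∈ S, (l ^ r * y ^ s) • (E l * E y) := by
      intro r s
      rw [e1, Finset.sum_comm]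
    rw [e1 (r + 1) s, e2 s (r + 1), e1 r (s + 1), e2 (s + 1) r, e1 r s, e2 s r]
    simp only [← Finset.sum_sub_distrib, ← Finset.sum_add_distrib, Finset.smul_sum, ← Finset.sum_neg_distrib]
    refine Finset.sum_congr rfl fun y _ => Finset.sum_congr rfl fun l _ => ?_
    module
  rw [← sub_eq_zero]
  refine eq_zero_of_pow_smul_sum (S := S)
    (G := fun l => (y - l + 1) • (E y * E l) - (y - l - 1) • (E l * E y)) (fun s => ?_) hl
  exact eq_zero_of_pow_smul_sum (S := S) (G := fun y => ∑ l ∈ S, l ^ s •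
      ((y - l + 1) • (E y * E l) - (y - l - 1) • (E l * E y))) (fun r => key r s) hy

theorem HalfRel.coeff_pow_eq_zero (H : HalfRel a e) (he : HasPoles S e) (p : ℕ) (hp : 0 < p) [CharP K p]
    (hS : ∀ k ∈ S, ∀ l ∈ S, k - l ≠ 1) (r : ℕ) : PowerSeries.coeff r e ^ p = 0 := by
  obtain ⟨E, he⟩ := he
  rcases r with _ | r
  · rw [H.const_e, zero_pow hp.ne']
  · rw [he, coeff_succ_poleSum]
    exact sum_pow_char_eq_zero p hp (fun k hk l hl _ => H.residue_exchange he hk hl)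
      (fun k hk => H.residue_sq he hk) hS fun y => y ^ r

/-- Commuting a residue of `e(u)` past `a(u)`. -/
theorem HalfRel.residue_mul (H : HalfRel a e) (ha : PowerSeries.coeff 0 a = 1) (he : e = poleSum S E)
    {y : K} (hy : y ∈ S) :
    PowerSeries.C (E y) * a = (1 - invSub K y) • (a * PowerSeries.C (E y)) := by
  have key : ∀ r, (PowerSeries.coeff (r + 1) a * E y - E y * PowerSeries.coeff (r + 1) a) -
      y • (PowerSeries.coeff r a * E y - E y * PowerSeries.coeff r a) - PowerSeries.coeff r a * E y = 0 := by
    intro r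
    refine eq_zero_of_pow_smul_sum (S := S) (G := fun y =>
      (PowerSeries.coeff (r + 1) a * E y - E y * PowerSeries.coeff (r + 1) a) -
      y • (PowerSeries.coeff r a * E y - E y * PowerSeries.coeff r a) - PowerSeries.coeff r a * E y)
      (fun s => ?_) hy
    have h := H.a_e r (s + 1) s.succ_pos
    rw [← sub_eq_zero] at h
    rw [← h, he]
    simp only [coeff_succ_poleSum, Finset.mul_sum, Finset.sum_mul, ← Finset.sum_sub_distrib]
    refine Finset.sum_congr rfl fun y _ => ?_
    simp only [mul_smul_comm, smul_mul_assoc]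
    module
  set D := a * PowerSeries.C (E y) - PowerSeries.C (E y) * a with hD
  -- For `D = [a(u), E y]`, the recurrence `key` says `(1 - y u⁻¹) D = u⁻¹ a(u) E y`, that is, `D =
  -- a(u) E y / (u - y)`.
  have h1 : D = PowerSeries.X * (y • D) + PowerSeries.X * (a * PowerSeries.C (E y)) := by
    ext r
    rcases r with _ | r
    · rw [map_add, PowerSeries.coeff_zero_X_mul, PowerSeries.coeff_zero_X_mul, hD, map_sub,
        PowerSeries.coeff_mul_C, PowerSeries.coeff_C_mul, ha]
      simp
    · rw [map_add, PowerSeries.coeff_succ_X_mul, PowerSeries.coeff_succ_X_mul, hD, map_sub,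
        PowerSeries.coeff_smul, map_sub, PowerSeries.coeff_mul_C, PowerSeries.coeff_C_mul,
        PowerSeries.coeff_mul_C, PowerSeries.coeff_C_mul]
      rw [← sub_eq_zero, ← key r]
      abel
  have h2 : (1 - PowerSeries.C y * PowerSeries.X : K⟦X⟧) • D =
      (PowerSeries.X : K⟦X⟧) • (a * PowerSeries.C (E y)) := by
    rw [sub_smul, one_smul, sub_eq_iff_eq_add, mul_comm, mul_smul, X_smul, C_smul, X_smul, add_comm]
    exact h1
  have h3 : D = invSub K y • (a * PowerSeries.C (E y)) := by
    obtain ⟨u, hu⟩ : IsUnit (1 - PowerSeries.C y * PowerSeries.X : K⟦X⟧) := by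
      rw [PowerSeries.isUnit_iff_constantCoeff]
      simp
    have h4 : (1 - PowerSeries.C y * PowerSeries.X : K⟦X⟧) • D =
        (1 - PowerSeries.C y * PowerSeries.X : K⟦X⟧) • (invSub K y • (a * PowerSeries.C (E y))) := by
      rw [h2, smul_smul, mul_comm, invSub_spec]
    rw [← hu] at h4
    have := congrArg (fun z => (↑u⁻¹ : K⟦X⟧) • z) h4
    simpa only [smul_smul, Units.inv_mul_cancel_left, Units.inv_mul, one_smul] using this
  rw [sub_smul, one_smul, ← h3, hD]
  abel

end HasPoles

/-! ### Restricted series -/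

section Restricted

variable {K : Type*} [Field K]

theorem shiftProd_mul (p : ℕ) (g h : K⟦X⟧) : shiftProd K p (g * h) = shiftProd K p g * shiftProd K p h := by
  simp only [shiftProd_eq_prod, shift_mul, Finset.prod_mul_distrib]

theorem shiftProd_one (p : ℕ) : shiftProd K p (1 : K⟦X⟧) = 1 := by
  simp only [shiftProd_eq_prod, shift_one, Finset.prod_const_one]

theorem IsRestricted.mul {p : ℕ} {g h : K⟦X⟧} (hg : IsRestricted p g) (hh : IsRestricted p h) :
    IsRestricted p (g * h) :=
  ⟨by rw [map_mul, hg.1, hh.1, one_mul], by rw [shiftProd_mul, hg.2, hh.2, one_mul]⟩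

theorem IsRestricted.of_mul_eq_one {p : ℕ} {g h : K⟦X⟧} (hg : IsRestricted p g) (H : g * h = 1) :
    IsRestricted p h := by
  refine ⟨?_, ?_⟩
  · have := congrArg PowerSeries.constantCoeff H
    rwa [map_mul, hg.1, one_mul, map_one] at this
  · have := congrArg (shiftProd K p) H
    rwa [shiftProd_mul, hg.2, one_mul, shiftProd_one] at this

theorem IsRestricted.one (p : ℕ) : IsRestricted p (1 : K⟦X⟧) := ⟨map_one _, shiftProd_one p⟩

theorem IsRestricted.prod {ι : Type*} {p : ℕ} {s : Finset ι} {g : ι → K⟦X⟧}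
    (h : ∀ i ∈ s, IsRestricted p (g i)) : IsRestricted p (∏ i ∈ s, g i) :=
  Finset.prod_induction g (IsRestricted p) (fun _ _ => IsRestricted.mul) (IsRestricted.one p) h

theorem one_sub_invSub_mul (y : K) : (1 - invSub K y) * (1 - PowerSeries.C y * PowerSeries.X) =
    1 - PowerSeries.C (y + 1) * PowerSeries.X := by
  rw [map_add, map_one]
  linear_combination -invSub_spec K y

theorem one_add_invSub_mul (y : K) :
    (1 + invSub K (y + 1)) * (1 - PowerSeries.C (y + 1) * PowerSeries.X) =
      1 - PowerSeries.C y * PowerSeries.X := by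
  have := invSub_spec K (y + 1)
  rw [map_add, map_one] at *
  linear_combination this

/-- The factors are `(u - y - 1) / (u - y)` and its inverse `(u - y) / (u - y - 1)`. -/
theorem one_sub_mul_one_add_invSub (y : K) : (1 - invSub K y) * (1 + invSub K (y + 1)) = 1 := by
  apply mul_right_cancel₀ (one_sub_C_mul_X_ne_zero y)
  linear_combination (1 + invSub K (y + 1)) * one_sub_invSub_mul y + one_add_invSub_mul y

theorem isRestricted_one_sub_invSub (p : ℕ) [CharP K p] (y : K) : IsRestricted p (1 - invSub K y) := by
  refine ⟨?_, ?_⟩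
  · rw [map_sub, map_one, ← PowerSeries.coeff_zero_eq_constantCoeff_apply, coeff_zero_invSub, sub_zero]
  -- The product telescopes to `(u - y - n) / (u - y)`, which is `1` for `n = p`.
  · have : ∀ n : ℕ, (∏ j ∈ Finset.range n, shift (j : K) (1 - invSub K y)) *
        (1 - PowerSeries.C y * PowerSeries.X) = 1 - PowerSeries.C (y + n) * PowerSeries.X := by
      intro n
      induction n with
      | zero => simp
      | succ n ih =>
        rw [Finset.prod_range_succ, mul_right_comm, ih, shift_sub, shift_one, shift_invSub, mul_comm,
          add_comm (n : K) y, one_sub_invSub_mul, Nat.cast_succ, add_assoc]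
    apply mul_right_cancel₀ (one_sub_C_mul_X_ne_zero y)
    rw [shiftProd_eq_prod, this, CharP.cast_eq_zero, add_zero, one_mul]

theorem isRestricted_one_add_invSub (p : ℕ) [CharP K p] (y : K) : IsRestricted p (1 + invSub K (y + 1)) :=
  (isRestricted_one_sub_invSub p y).of_mul_eq_one (one_sub_mul_one_add_invSub y)

end Restricted

/-! ### Commutation with `a(u) a(u - 1) ⋯ a(u - p + 1)` -/

section Central

variable {K : Type*} [Field K] {B : Type*} [Ring B] [Algebra K B]

attribute [local instance] seriesAlgebra

/-- If `b` and `a(u)` commute up to a restricted series, then `b` and `a(u) ⋯ a(u - p + 1)` commute. -/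
theorem shiftProd_commute_C {p : ℕ} {φ : K⟦X⟧} (hφ : IsRestricted p φ) {a : B⟦X⟧} {b : B}
    (h : PowerSeries.C b * a = φ • (a * PowerSeries.C b)) :
    PowerSeries.C b * shiftProd K p a = shiftProd K p a * PowerSeries.C b := by
  have key : ∀ n : ℕ, PowerSeries.C b * ((List.range n).map fun j : ℕ => shift (j : K) a).prod =
      (∏ j ∈ Finset.range n, shift (j : K) φ) •
        (((List.range n).map fun j : ℕ => shift (j : K) a).prod * PowerSeries.C b) := by
    intro n
    induction n with
    | zero => simp
    | succ n ih =>
      have h1 : PowerSeries.C b * shift (n : K) a = shift (n : K) φ • (shift (n : K) a * PowerSeries.C b) := by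
        have := congrArg (shift (n : K)) h
        rwa [shift_mul, shift_smul, shift_mul, shift_C] at this
      rw [List.range_succ, List.map_append, List.prod_append, List.map_singleton, List.prod_singleton,
        ← mul_assoc, ih, smul_mul_assoc, mul_assoc, h1, mul_smul_comm, smul_smul,
        Finset.prod_range_succ, mul_assoc]
  have := key p
  rw [← shiftProd_eq_prod, hφ.2, one_smul] at this
  exact this

end Central

/-! ### Matrices of series and series of matrices -/

section MatSeries

variable {K : Type*} [Field K] {B : Type*} [Ring B] [Algebra K B]

attribute [local instance] seriesAlgebra

/-- A matrix of power series, regarded as a power series of matrices. -/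
def matSeries (B : Type*) [Ring B] :
    Matrix (Fin 2) (Fin 2) B⟦X⟧ →+* (Matrix (Fin 2) (Fin 2) B)⟦X⟧ where
  toFun M := PowerSeries.mk fun n => M.map (PowerSeries.coeff n)
  map_one' := by
    ext n i j
    rw [PowerSeries.coeff_mk, Matrix.map_apply, PowerSeries.coeff_one, Matrix.one_apply]
    split_ifs <;> simp_all [PowerSeries.coeff_one, Matrix.one_apply]
  map_zero' := by
    ext n i j
    simp
  map_add' M N := by
    ext n i j
    simp
  map_mul' M N := by
    ext n i j
    simp only [PowerSeries.coeff_mk, Matrix.map_apply, Matrix.mul_apply, PowerSeries.coeff_mul,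
      Matrix.sum_apply, map_sum]
    exact Finset.sum_comm

theorem coeff_matSeries (n : ℕ) (M : Matrix (Fin 2) (Fin 2) B⟦X⟧) :
    PowerSeries.coeff n (matSeries B M) = M.map (PowerSeries.coeff n) := by
  change PowerSeries.coeff n (PowerSeries.mk fun n => M.map (PowerSeries.coeff n)) = _
  rw [PowerSeries.coeff_mk]

theorem matSeries_smul (φ : K⟦X⟧) (M : Matrix (Fin 2) (Fin 2) B⟦X⟧) :
    matSeries B (φ • M) = φ • matSeries B M := by
  ext n i j
  simp only [coeff_matSeries, Matrix.map_apply, Matrix.smul_apply, coeff_series_smul, Matrix.sum_apply]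

theorem matSeries_C (M : Matrix (Fin 2) (Fin 2) B) :
    matSeries B (M.map PowerSeries.C) = PowerSeries.C M := by
  ext n i j
  simp only [coeff_matSeries, Matrix.map_apply, PowerSeries.coeff_C]
  split_ifs <;> simp

theorem shift_matSeries (c : K) (M : Matrix (Fin 2) (Fin 2) B⟦X⟧) :
    shift c (matSeries B M) = matSeries B (M.map (shift c)) := by
  ext n i j
  simp [shift, coeff_matSeries, Matrix.sum_apply]

theorem hasPoles_matSeries {S : Finset K} {M : Matrix (Fin 2) (Fin 2) B⟦X⟧}
    (h : ∀ i j, HasPoles S (M i j)) : HasPoles S (matSeries B M) := by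
  choose E hE using h
  refine ⟨fun y => Matrix.of fun i j => E i j y, ?_⟩
  ext n i j
  rw [coeff_matSeries, Matrix.map_apply, hE]
  rcases n with _ | n
  · simp [coeff_zero_poleSum]
  · simp [coeff_succ_poleSum, Matrix.sum_apply]

end MatSeries

/-! ### Products of commuting solutions of the RTT relations -/

section RTTProduct

variable {A : Type*} [Ring A]

theorem IsRTT.of_twoVarRel {T : Fin 2 → Fin 2 → A⟦X⟧}
    (h0 : ∀ i j, PowerSeries.coeff 0 (T i j) = if i = j then 1 else 0)
    (h : ∀ i j k l, TwoVarRel (T i j) (T k l) (T k j) (T i l) (T k j) (T i l)) : IsRTT T :=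
  ⟨h0, fun i j k l => (h i j k l).coeffRel.rel⟩

/-- The mechanism behind the coproduct of the Yangian: if the entries of `T` and `L` commute with
each other, the matrix product `T L` again satisfies the relations. -/
theorem rtt_mul_abstract {R S : Type*} [CommRing R] [Ring S] [Algebra R S] {s t : R}
    {T T' L L' : Fin 2 → Fin 2 → S}
    (hT : ∀ i j k l, s • (T i j * T' k l - T' k l * T i j) = t • (T k j * T' i l - T' k j * T i l))
    (hL : ∀ i j k l, s • (L i j * L' k l - L' k l * L i j) = t • (L k j * L' i l - L' k j * L i l))
    (h : ∀ i j k l, L i j * T' k l = T' k l * L i j) (h' : ∀ i j k l, L' i j * T k l = T k l * L' i j)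
    (i j k l : Fin 2) :
    s • ((∑ a, T i a * L a j) * (∑ b, T' k b * L' b l) - (∑ b, T' k b * L' b l) * (∑ a, T i a * L a j)) =
      t • ((∑ a, T k a * L a j) * (∑ b, T' i b * L' b l) - (∑ b, T' k b * L' b j) * (∑ a, T i a * L a l)) := by
  have e1 : ∀ i j k l, (∑ a, T i a * L a j) * (∑ b, T' k b * L' b l) =
      ∑ a, ∑ b, T i a * T' k b * (L a j * L' b l) := by
    intro i j k l
    rw [Finset.sum_mul_sum]
    refine Finset.sum_congr rfl fun a _ => Finset.sum_congr rfl fun b _ => ?_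
    rw [mul_assoc, ← mul_assoc (L a j), h, mul_assoc, mul_assoc]
  have e2 : ∀ i j k l, (∑ b, T' k b * L' b l) * (∑ a, T i a * L a j) =
      ∑ a, ∑ b, T' k b * T i a * (L' b l * L a j) := by
    intro i j k l
    rw [Finset.sum_mul_sum, Finset.sum_comm]
    refine Finset.sum_congr rfl fun a _ => Finset.sum_congr rfl fun b _ => ?_
    rw [mul_assoc, ← mul_assoc (L' b l), h', mul_assoc, mul_assoc]
  rw [e1, e1, e2, e2]
  -- First the `T` factors are exchanged, then the `L` factors. The last two terms are the cross
  -- terms; they cancel after summation because interchanging `a` and `b` maps one to the other.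
  have k1 : ∀ a b, s • (T i a * T' k b * (L a j * L' b l)) - s • (T' k b * T i a * (L' b l * L a j)) =
      (t • (T k a * T' i b * (L a j * L' b l)) - t • (T' k b * T i a * (L' b j * L a l))) +
      (t • (T' k b * T i a * (L b j * L' a l)) - t • (T' k a * T i b * (L a j * L' b l))) := by
    intro a b
    have h1 := congrArg (· * (L a j * L' b l)) (hT i a k b)
    have h2 := congrArg (T' k b * T i a * ·) (hL a j b l)
    simp only [smul_mul_assoc, mul_smul_comm, smul_sub, sub_mul, mul_sub] at h1 h2
    rw [← sub_eq_zero] at h1 h2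
    rw [← sub_eq_zero, ← add_zero (0 : S)]
    nth_rewrite 1 [← h1]
    rw [← h2]
    abel
  have k2 := Finset.sum_congr rfl fun a (_ : a ∈ (Finset.univ : Finset (Fin 2))) =>
    Finset.sum_congr rfl fun b (_ : b ∈ (Finset.univ : Finset (Fin 2))) => k1 a b
  have k3 : ∑ a, ∑ b, t • (T' k b * T i a * (L b j * L' a l)) =
      ∑ a, ∑ b, t • (T' k a * T i b * (L a j * L' b l)) := Finset.sum_comm
  simp only [Finset.sum_sub_distrib, Finset.sum_add_distrib, k3, sub_self, add_zero] at k2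
  simpa only [smul_sub, Finset.smul_sum] using k2

theorem IsRTT.mul {T L : Fin 2 → Fin 2 → A⟦X⟧} (hT : IsRTT T) (hL : IsRTT L)
    (h : ∀ i j k l r s, Commute (PowerSeries.coeff r (L i j)) (PowerSeries.coeff s (T k l))) :
    IsRTT fun i j => ∑ k, T i k * L k j := by
  refine IsRTT.of_twoVarRel (fun i j => ?_) fun i j k l => ?_
  · simp only [map_sum, PowerSeries.coeff_mul, Finset.Nat.antidiagonal_zero,
      Finset.sum_singleton, hT.const, hL.const]
    simp
  · have := rtt_mul_abstract (fun i j k l => (hT.coeffRel i j k l).twoVarRel)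
      (fun i j k l => (hL.coeffRel i j k l).twoVarRel) (fun i j k l => inX_inY_comm (h i j k l))
      (fun i j k l => (inX_inY_comm fun r s => (h i j k l s r).symm).symm) i j k l
    simpa only [TwoVarRel, map_sum, map_mul] using this

theorem IsRTT.map {A' : Type*} [Ring A'] {T : Fin 2 → Fin 2 → A⟦X⟧} (hT : IsRTT T) (φ : A →+* A') :
    IsRTT fun i j => PowerSeries.map φ (T i j) := by
  refine ⟨fun i j => ?_, fun i j k l r s => ?_⟩
  · rw [PowerSeries.coeff_map, hT.const]
    split_ifs <;> simp
  · simpa only [PowerSeries.coeff_map, map_sub, map_mul] using congrArg φ (hT.rel i j k l r s)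

end RTTProduct

/-! ### Tensor products with vector representations -/

section Tensor

variable {K : Type*} [Field K] {B : Type*} [Ring B] [Algebra K B]

attribute [local instance] seriesAlgebra

/-- The matrix `L(u) = 1 + E / (u - y - 1)` of the vector representation. -/
def vecL (B : Type*) [Ring B] [Algebra K B] (y : K) (i j : Fin 2) : Matrix (Fin 2) (Fin 2) B⟦X⟧ :=
  (if i = j then 1 else 0) + invSub K (y + 1) • Matrix.single i j 1

theorem coeff_smul_single (φ : K⟦X⟧) (i j : Fin 2) (r : ℕ) :
    PowerSeries.coeff r (matSeries B (φ • Matrix.single i j 1)) =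
      PowerSeries.coeff r φ • Matrix.single i j (1 : B) := by
  have : (Matrix.single i j 1 : Matrix (Fin 2) (Fin 2) B⟦X⟧) =
      (Matrix.single i j (1 : B)).map PowerSeries.C := by
    rw [Matrix.map_single, map_one]
  rw [matSeries_smul, this, matSeries_C, coeff_smul_C]

theorem coeff_zero_vecL (y : K) (i j : Fin 2) :
    PowerSeries.coeff 0 (matSeries B (vecL B y i j)) = if i = j then 1 else 0 := by
  rw [vecL, map_add, map_add, coeff_smul_single, coeff_zero_invSub]
  split_ifs <;> simp

theorem coeff_succ_vecL (y : K) (i j : Fin 2) (r : ℕ) :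
    PowerSeries.coeff (r + 1) (matSeries B (vecL B y i j)) = (y + 1) ^ r • Matrix.single i j (1 : B) := by
  rw [vecL, map_add, map_add, coeff_smul_single, coeff_succ_invSub]
  split_ifs <;> simp [PowerSeries.coeff_one]

theorem isRTT_vecL (y : K) : IsRTT fun i j => matSeries B (vecL B y i j) := by
  refine ⟨coeff_zero_vecL y, fun i j k l r s => ?_⟩
  have hE : (Matrix.single i j (1 : B) * Matrix.single k l 1 - Matrix.single k l 1 * Matrix.single i j 1 :
      Matrix (Fin 2) (Fin 2) B) = (if k = j then 1 else 0) * Matrix.single i l 1 -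
        Matrix.single k j 1 * (if i = l then 1 else 0) := by
    congr 1
    · split_ifs with h
      · subst h
        simp
      · rw [Matrix.single_mul_single_of_ne _ _ _ _ (Ne.symm h), zero_mul]
    · split_ifs with h
      · subst h
        simp
      · rw [Matrix.single_mul_single_of_ne _ _ _ _ (Ne.symm h), mul_zero]
  have hE' : (Matrix.single k j (1 : B) * Matrix.single i l 1 : Matrix (Fin 2) (Fin 2) B) = 
      if j = i then Matrix.single k l 1 else 0 := by
    split_ifs with h
    · subst h
      simp
    · rw [Matrix.single_mul_single_of_ne _ _ _ _ h]
  rcases r with _ | r <;> rcases s with _ | s <;>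
    simp only [coeff_zero_vecL, coeff_succ_vecL, zero_add, smul_mul_assoc, mul_smul_comm]
  · split_ifs <;> simp
  · rw [← smul_sub ((y + 1) ^ s) (_ * _), ← hE]
    split_ifs <;> simp [smul_sub]
  · have hE'' := congrArg (fun z => (y + 1) ^ r • z) hE
    simp only [smul_sub] at hE''
    rw [pow_zero, one_smul, one_smul, hE'']
    split_ifs <;> simp
  · simp only [smul_smul, hE']
    rw [mul_comm ((y + 1) ^ r), mul_comm ((y + 1) ^ r), mul_comm ((y + 1) ^ (s + 1)),
      mul_comm ((y + 1) ^ s), sub_self]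
    simp only [pow_succ]
    module

/-- The monodromy matrix `T(u) L(u)` of the tensor product with a vector representation. -/
def tensorT (T : Fin 2 → Fin 2 → B⟦X⟧) (y : K) (i j : Fin 2) : (Matrix (Fin 2) (Fin 2) B)⟦X⟧ :=
  matSeries B (∑ k, Matrix.scalar (Fin 2) (T i k) * vecL B y k j)

theorem isRTT_tensorT {T : Fin 2 → Fin 2 → B⟦X⟧} (hT : IsRTT T) (y : K) : IsRTT (tensorT T y) := by
  have h1 := hT.map (Matrix.scalar (Fin 2) : B →+* Matrix (Fin 2) (Fin 2) B)
  have h2 : ∀ g : B⟦X⟧, PowerSeries.map (Matrix.scalar (Fin 2) : B →+* Matrix (Fin 2) (Fin 2) B) g =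
      matSeries B (Matrix.scalar (Fin 2) g) := by
    intro g
    ext n i j
    simp only [coeff_matSeries, PowerSeries.coeff_map, Matrix.map_apply, Matrix.scalar_apply,
      Matrix.diagonal_apply]
    split_ifs <;> simp
  simp only [h2] at h1
  have h3 := h1.mul (isRTT_vecL (B := B) y) (fun i j k l r s => by
    rw [← h2, PowerSeries.coeff_map]
    rcases r with _ | r
    · rw [coeff_zero_vecL]
      split_ifs
      exacts [Commute.one_left _, Commute.zero_left _]
    · rw [coeff_succ_vecL]
      refine Commute.smul_left ?_ _
      rw [Commute, SemiconjBy]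
      ext α β
      simp [Matrix.single])
  have h4 : tensorT T y = fun i j => ∑ k, matSeries B (Matrix.scalar (Fin 2) (T i k)) *
      matSeries B (vecL B y k j) := by
    funext i j
    simp only [tensorT, map_sum, map_mul]
  rw [h4]
  exact h3

theorem tensorT_eq (T : Fin 2 → Fin 2 → B⟦X⟧) (y : K) (i j : Fin 2) :
    tensorT T y i j = matSeries B (Matrix.of fun α β =>
      (if α = β then T i j else 0) + if j = β then invSub K (y + 1) • T i α else 0) := by
  rw [tensorT]
  congr 1
  ext1 α β
  fin_cases i <;> fin_cases j <;> fin_cases α <;> fin_cases β <;>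
    simp [vecL, Matrix.single, Fin.sum_univ_two, mul_add]

theorem tensorT_00 (T : Fin 2 → Fin 2 → B⟦X⟧) (y : K) :
    tensorT T y 0 0 = matSeries B !![(1 + invSub K (y + 1)) • T 0 0, 0; invSub K (y + 1) • T 0 1, T 0 0] := by
  rw [tensorT_eq]
  congr 1
  ext1 α β
  fin_cases α <;> fin_cases β <;> simp [add_smul]

theorem tensorT_01 (T : Fin 2 → Fin 2 → B⟦X⟧) (y : K) :
    tensorT T y 0 1 = matSeries B !![T 0 1, invSub K (y + 1) • T 0 0; 0, (1 + invSub K (y + 1)) • T 0 1] := by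
  rw [tensorT_eq]
  congr 1
  ext1 α β
  fin_cases α <;> fin_cases β <;> simp [add_smul]

theorem tensorT_10 (T : Fin 2 → Fin 2 → B⟦X⟧) (y : K) :
    tensorT T y 1 0 = matSeries B !![(1 + invSub K (y + 1)) • T 1 0, 0; invSub K (y + 1) • T 1 1, T 1 0] := by
  rw [tensorT_eq]
  congr 1
  ext1 α β
  fin_cases α <;> fin_cases β <;> simp [add_smul]

theorem tensorT_11 (T : Fin 2 → Fin 2 → B⟦X⟧) (y : K) :
    tensorT T y 1 1 = matSeries B !![T 1 1, invSub K (y + 1) • T 1 0; 0, (1 + invSub K (y + 1)) • T 1 1] := by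
  rw [tensorT_eq]
  congr 1
  ext1 α β
  fin_cases α <;> fin_cases β <;> simp [add_smul]

/-- The inverse of `tensorT T y 0 0`. -/
def tensorInv (T : Fin 2 → Fin 2 → B⟦X⟧) (ai : B⟦X⟧) (y : K) : (Matrix (Fin 2) (Fin 2) B)⟦X⟧ :=
  matSeries B !![(1 - invSub K y) • ai, 0; -(invSub K y • (ai * T 0 1 * ai)), ai]

theorem invSub_mul_one_add (y : K) : invSub K y * (1 + invSub K (y + 1)) = invSub K (y + 1) := by
  linear_combination -one_sub_mul_one_add_invSub y

section

variable {T : Fin 2 → Fin 2 → B⟦X⟧} {ai : B⟦X⟧} (y : K)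

theorem tensorT_mul_tensorInv (h1 : T 0 0 * ai = 1) : tensorT T y 0 0 * tensorInv T ai y = 1 := by
  have e1 : (1 - invSub K y) * (1 + invSub K (y + 1)) = 1 := one_sub_mul_one_add_invSub y
  have e2 : (1 - invSub K y) * invSub K (y + 1) = invSub K y := by
    linear_combination one_sub_mul_one_add_invSub y
  rw [tensorT_00, tensorInv, ← map_mul, ← map_one (matSeries B)]
  congr 1
  rw [Matrix.mul_fin_two, Matrix.one_fin_two]
  simp only [smul_mul_assoc, mul_smul_comm, smul_smul, h1, e1, e2, mul_neg, ← mul_assoc, one_mul, mul_zero,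
    zero_mul, smul_zero, add_zero, zero_add, one_smul, add_neg_cancel, neg_zero]

theorem tensorInv_mul_tensorT (h2 : ai * T 0 0 = 1) : tensorInv T ai y * tensorT T y 0 0 = 1 := by
  have e1 : (1 + invSub K (y + 1)) * (1 - invSub K y) = 1 := by
    linear_combination one_sub_mul_one_add_invSub y
  have e2 : (1 + invSub K (y + 1)) * invSub K y = invSub K (y + 1) := by
    linear_combination invSub_mul_one_add y
  rw [tensorT_00, tensorInv, ← map_mul, ← map_one (matSeries B)]
  congr 1
  rw [Matrix.mul_fin_two, Matrix.one_fin_two]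
  simp only [smul_mul_assoc, mul_smul_comm, smul_smul, smul_neg, h2, e1, e2, neg_mul, mul_assoc, mul_one,
    mul_zero, zero_mul, smul_zero, add_zero, zero_add, one_smul, neg_add_cancel]

/-- The entries show the pole structure of the new `e(u)`: products of `1 / (u - y)` with `1`, `e`
or `e²`, besides `e` itself. -/
theorem tensor_e (h2 : ai * T 0 0 = 1) : tensorInv T ai y * tensorT T y 0 1 = matSeries B
    !![(1 - invSub K y) • (ai * T 0 1), invSub K y • 1;
      -(invSub K y • (ai * T 0 1 * (ai * T 0 1))), (1 + invSub K y) • (ai * T 0 1)] := by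
  have e3 : invSub K (y + 1) * (1 - invSub K y) = invSub K y := by
    linear_combination one_sub_mul_one_add_invSub y
  have e4 : 1 + invSub K y = 1 + invSub K (y + 1) - invSub K (y + 1) * invSub K y := by
    linear_combination invSub_mul_one_add y
  rw [tensorT_01, tensorInv, ← map_mul]
  congr 1
  rw [Matrix.mul_fin_two, e4]
  simp only [smul_mul_assoc, mul_smul_comm, smul_smul, smul_neg, h2, e3, neg_mul, mul_assoc, mul_one,
    mul_zero, zero_mul, smul_zero, add_zero]
  rw [neg_add_eq_sub, sub_smul (1 + invSub K (y + 1))]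

/-- The only new pole is in the corner, with factor `d₂(u) d₁(u)⁻¹`; its own poles are found from
`IsRTT.bracket_one_f`. -/
theorem tensor_f : tensorT T y 1 0 * tensorInv T ai y = matSeries B
    !![T 1 0 * ai, 0; invSub K y • ((T 1 1 - T 1 0 * ai * T 0 1) * ai), T 1 0 * ai] := by
  have e1 : (1 - invSub K y) * (1 + invSub K (y + 1)) = 1 := one_sub_mul_one_add_invSub y
  have e2 : (1 - invSub K y) * invSub K (y + 1) = invSub K y := by
    linear_combination one_sub_mul_one_add_invSub y
  rw [tensorT_10, tensorInv, ← map_mul]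
  congr 1
  rw [Matrix.mul_fin_two]
  simp only [smul_mul_assoc, mul_smul_comm, smul_smul, e1, e2, mul_neg, mul_zero, zero_mul, smul_zero,
    add_zero, zero_add, one_smul, sub_mul, smul_sub, mul_assoc, ← sub_eq_add_neg, sub_zero]

theorem tensor_d2 (h2 : ai * T 0 0 = 1) : tensorT T y 1 1 - tensorT T y 1 0 * tensorInv T ai y * tensorT T y 0 1 = matSeries B
    !![T 1 1 - T 1 0 * ai * T 0 1, 0;
      -(invSub K y • ((T 1 1 - T 1 0 * ai * T 0 1) * ai * T 0 1)),
      (1 + invSub K y) • (T 1 1 - T 1 0 * ai * T 0 1)] := by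
  have e2 := invSub_mul_one_add y
  rw [tensor_f, tensorT_11, tensorT_01, ← map_mul, ← map_sub]
  congr 1
  rw [Matrix.mul_fin_two]
  set D := T 1 1 - T 1 0 * ai * T 0 1 with hD
  have hfa : T 1 0 * ai * T 0 0 = T 1 0 := by rw [mul_assoc, h2, mul_one]
  have hDa : D * ai * T 0 0 = D := by rw [mul_assoc, h2, mul_one]
  ext1 α β
  fin_cases α <;> fin_cases β <;>
    simp only [Fin.zero_eta, Fin.mk_one, Matrix.sub_apply, Matrix.of_apply, Matrix.cons_val', Matrix.cons_val_zero,
      Matrix.cons_val_one, Matrix.cons_val_fin_one, mul_zero, add_zero, zero_mul, smul_smul, smul_zero,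
      smul_mul_assoc, mul_smul_comm, hfa, hDa, zero_sub, sub_self]
  · rw [hD]
  · rw [hD, smul_sub, smul_sub]
    rw [← sub_eq_zero]
    have e4 : 1 + invSub K y = 1 + invSub K (y + 1) - invSub K (y + 1) * invSub K y := by
      linear_combination e2
    rw [e4]
    simp only [sub_smul, add_smul, one_smul]
    abel

end

/-- This is `[e⁽¹⁾, f(u)] = 1 - d₂(u) d₁(u)⁻¹`, as `e⁽¹⁾ = t₁₂⁽¹⁾`. It shows that `d₂(u) d₁(u)⁻¹`
has simple poles whenever `f(u)` does. -/
theorem IsRTT.bracket_one_f {T : Fin 2 → Fin 2 → B⟦X⟧} (H : IsRTT T) {ai : B⟦X⟧} (h1 : T 0 0 * ai = 1)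
    (h2 : ai * T 0 0 = 1) : (T 1 1 - T 1 0 * ai * T 0 1) * ai =
      1 - (PowerSeries.C (PowerSeries.coeff 1 (T 0 1)) * (T 1 0 * ai) -
        T 1 0 * ai * PowerSeries.C (PowerSeries.coeff 1 (T 0 1))) := by
  set x := PowerSeries.C (PowerSeries.coeff 1 (T 0 1)) with hx
  have ha : x * T 0 0 = T 0 0 * x - T 0 1 := by
    ext s
    have := H.commutator 0 1 0 0 1 s
    simp only [Finset.sum_range_one, H.const, Nat.add_sub_cancel_left, Nat.sub_zero] at this
    simp only [hx, map_sub, PowerSeries.coeff_C_mul, PowerSeries.coeff_mul_C]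
    rw [sub_eq_iff_eq_add.1 this]
    simp
    abel
  have hc : x * T 1 0 = T 1 0 * x + (T 0 0 - T 1 1) := by
    ext s
    have := H.commutator 0 1 1 0 1 s
    simp only [Finset.sum_range_one, H.const, Nat.add_sub_cancel_left, Nat.sub_zero] at this
    simp only [hx, map_add, map_sub, PowerSeries.coeff_C_mul, PowerSeries.coeff_mul_C]
    rw [sub_eq_iff_eq_add.1 this]
    simp
    abel
  have hai : x * ai = ai * x + ai * T 0 1 * ai := by
    have : ai * (x * T 0 0) * ai = ai * (T 0 0 * x - T 0 1) * ai := by rw [ha]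
    have e1 : ai * (x * T 0 0) * ai = ai * x := by rw [mul_assoc, mul_assoc, h1, mul_one]
    have e2 : ai * (T 0 0 * x - T 0 1) * ai = x * ai - ai * T 0 1 * ai := by
      rw [mul_sub, ← mul_assoc, h2, one_mul, sub_mul]
    rw [e1, e2] at this
    rw [this]
    abel
  have : x * (T 1 0 * ai) = T 1 0 * ai * x + T 1 0 * ai * T 0 1 * ai + (1 - T 1 1 * ai) := by
    rw [← mul_assoc, hc, add_mul, mul_assoc (T 1 0), hai, sub_mul, h1]
    simp only [mul_add, mul_assoc]
  rw [this, sub_mul]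
  abel

/-- A representation of the RTT relations with simple poles in `S`, scalar quantum determinant, and
a highest weight vector `q` of weight `(lam1, lam2)`. -/
structure Model (S : Finset K) (lam1 lam2 : K⟦X⟧) (T : Fin 2 → Fin 2 → B⟦X⟧) (ai : B⟦X⟧) (q : B) : Prop where
  rtt : IsRTT T
  mul_inv : T 0 0 * ai = 1
  inv_mul : ai * T 0 0 = 1
  poles_e : HasPoles S (ai * T 0 1)
  poles_f : HasPoles S (T 1 0 * ai)
  qdet : T 0 0 * shift (1 : K) (T 1 1 - T 1 0 * ai * T 0 1) = (lam1 * shift (1 : K) lam2) • 1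
  ne_zero : q ≠ 0
  hw00 : T 0 0 * PowerSeries.C q = lam1 • PowerSeries.C q
  hw01 : T 0 1 * PowerSeries.C q = 0
  hw11 : T 1 1 * PowerSeries.C q = lam2 • PowerSeries.C q

theorem coeff_zero_T00 {T : Fin 2 → Fin 2 → B⟦X⟧} (H : IsRTT T) : PowerSeries.coeff 0 (T 0 0) = 1 := by
  simp [H.const]

/-- This is `d₁(u) e(u) = e(u - 1) d₁(u)`, checked residue by residue: moving `E y` past `a` gives
the factor that turns `1 / (u - y - 1)` into `1 / (u - y)`. -/
theorem HalfRel.mul_eq_shift_mul {S : Finset K} {a e : B⟦X⟧} (H : HalfRel a e) (ha : PowerSeries.coeff 0 a = 1)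
    (he : HasPoles S e) : a * e = shift (1 : K) e * a := by
  obtain ⟨E, hE⟩ := he
  rw [← shiftHom_apply, hE]
  simp only [poleSum, map_sum, Finset.mul_sum, Finset.sum_mul, shiftHom_apply, shift_smul, shift_C, shift_invSub]
  refine Finset.sum_congr rfl fun y hy => ?_
  rw [smul_mul_assoc, H.residue_mul ha hE hy, smul_smul, mul_smul_comm]
  congr 1
  rw [add_comm 1 y]
  linear_combination -one_sub_mul_one_add_invSub y

/-- Tensoring with the vector representation of parameter `y` multiplies the first weight by `(u -
y) / (u - y - 1)` and adds `y` to the set of poles. Poles stay simple since `e(u)²` and `d₂(u)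
d₁(u)⁻¹`, up to a constant, are commutators with a fixed element and `y ∉ S`. -/
theorem Model.step {S S' : Finset K} {lam1 lam2 : K⟦X⟧} {T : Fin 2 → Fin 2 → B⟦X⟧} {ai : B⟦X⟧} {q : B}
    (H : Model S lam1 lam2 T ai q) {y : K} (hS : S ⊆ S') (hy : y ∈ S') (hyS : y ∉ S) :
    Model S' ((1 + invSub K (y + 1)) * lam1) lam2 (tensorT T y) (tensorInv T ai y) (Matrix.single 0 0 q) := by
  have half := H.rtt.halfRel H.mul_inv H.inv_mul
  have hCq : (PowerSeries.C (Matrix.single 0 0 q : Matrix (Fin 2) (Fin 2) B)) =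
      matSeries B !![PowerSeries.C q, 0; 0, 0] := by
    rw [← matSeries_C]
    congr 1
    ext1 α β
    fin_cases α <;> fin_cases β <;> simp [Matrix.single]
  have pe : HasPoles S' (ai * T 0 1) := H.poles_e.mono hS
  have pf : HasPoles S' (T 1 0 * ai) := H.poles_f.mono hS
  have p1 : HasPoles S' (invSub K y • (1 : B⟦X⟧)) := by
    rw [← map_one PowerSeries.C]
    exact hasPoles_invSub_smul_C hy 1
  refine ⟨isRTT_tensorT H.rtt y, tensorT_mul_tensorInv y H.mul_inv, tensorInv_mul_tensorT y H.inv_mul,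
    ?_, ?_, ?_, ?_, ?_, ?_, ?_⟩
  · rw [tensor_e y H.inv_mul]
    apply hasPoles_matSeries
    have hee : ai * T 0 1 * (ai * T 0 1) = PowerSeries.C (PowerSeries.coeff 1 (ai * T 0 1)) * (ai * T 0 1) -
        ai * T 0 1 * PowerSeries.C (PowerSeries.coeff 1 (ai * T 0 1)) := by
      ext r
      rw [← half.e_one, map_sub, PowerSeries.coeff_C_mul, PowerSeries.coeff_mul_C]
    intro α β
    fin_cases α <;> fin_cases β
    · simpa [sub_smul] using pe.sub (H.poles_e.invSub_smul hS hy hyS)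
    · simpa using p1
    · simpa [hee] using (HasPoles.sub (H.poles_e.C_mul _) (H.poles_e.mul_C _) |>.invSub_smul hS hy hyS).neg
    · simpa [add_smul] using pe.add (H.poles_e.invSub_smul hS hy hyS)
  · rw [tensor_f]
    apply hasPoles_matSeries
    have hh := H.rtt.bracket_one_f H.mul_inv H.inv_mul
    intro α β
    fin_cases α <;> fin_cases β
    · simpa using pf
    · simpa using HasPoles.zero S'
    · simpa [hh, smul_sub] using
        p1.sub ((HasPoles.sub (H.poles_f.C_mul _) (H.poles_f.mul_C _)).invSub_smul hS hy hyS)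
    · simpa using pf
  · rw [tensor_d2 y H.inv_mul, shift_matSeries, tensorT_00, ← map_mul, ← map_one (matSeries B), ← matSeries_smul]
    congr 1
    have hq := H.qdet
    set D := T 1 1 - T 1 0 * ai * T 0 1 with hD
    have k1 : shift (1 : K) (invSub K y) = invSub K (y + 1) := by rw [shift_invSub, add_comm]
    -- The two contributions to the lower left entry of the quantum determinant. By `k2` and `k3`
    -- both are the same multiple of `e(u - 1)`, so they cancel.
    have k2 : T 0 1 * shift (1 : K) D =
        (lam1 * shift (1 : K) lam2) • shift (1 : K) (ai * T 0 1) := by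
      have h1 := half.mul_eq_shift_mul (coeff_zero_T00 H.rtt) H.poles_e
      rw [← mul_assoc, H.mul_inv, one_mul] at h1
      have h2 := congrArg (· * shift (1 : K) D) h1
      simp only [mul_assoc _ (T 0 0), hq, mul_smul_comm, mul_one] at h2
      exact h2
    have k3 : T 0 0 * shift (1 : K) (D * (ai * T 0 1)) =
        (lam1 * shift (1 : K) lam2) • shift (1 : K) (ai * T 0 1) := by
      rw [shift_mul, ← mul_assoc, hq, smul_mul_assoc, one_mul]
    have k0 : shift (1 : K) (0 : B⟦X⟧) = 0 := map_zero (shiftHom K B 1)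
    have kn : ∀ g : B⟦X⟧, shift (1 : K) (-g) = - shift (1 : K) g := map_neg (shiftHom K B 1)
    ext1 α β
    fin_cases α <;> fin_cases β <;>
      simp [Matrix.mul_apply, Fin.sum_univ_two, k0, kn, shift_smul, k1, shift_add, shift_one, hq, k2, k3,
        smul_smul, mul_assoc]
  · intro h
    apply H.ne_zero
    have := congrFun (congrFun h 0) 0
    simpa using this
  · rw [hCq, tensorT_00, ← map_mul, ← matSeries_smul]
    congr 1
    ext1 α β
    fin_cases α <;> fin_cases β <;>
      simp [Matrix.mul_apply, Fin.sum_univ_two, H.hw00, H.hw01, smul_smul]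
  · rw [hCq, tensorT_01, ← map_mul, ← map_zero (matSeries B)]
    congr 1
    ext1 α β
    fin_cases α <;> fin_cases β <;>
      simp [Matrix.mul_apply, Fin.sum_univ_two, H.hw01]
  · rw [hCq, tensorT_11, ← map_mul, ← matSeries_smul]
    congr 1
    ext1 α β
    fin_cases α <;> fin_cases β <;>
      simp [Matrix.mul_apply, Fin.sum_univ_two, H.hw11]

end Tensor

/-! ### Existence of models -/

section ModelExists

universe v

attribute [local instance] seriesAlgebra

/-- Induction on `S`, starting with the one-dimensional representation in which `T(u)` is `φ(u)`
times the identity matrix. The algebra acts on itself from the left, and the highest weight vector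
is an element of it. -/
theorem exists_model {K : Type v} [Field K] (S : Finset K) (φ : K⟦X⟧) (hφ : PowerSeries.constantCoeff φ = 1) :
    ∃ (B : Type v) (_ : Ring B) (_ : Algebra K B) (T : Fin 2 → Fin 2 → B⟦X⟧) (ai : B⟦X⟧) (q : B),
      Model S ((∏ y ∈ S, (1 + invSub K (y + 1))) * φ) φ T ai q := by
  classical
  induction S using Finset.induction with
  | empty =>
    have hu : φ * PowerSeries.invOfUnit φ 1 = 1 := PowerSeries.mul_invOfUnit φ 1 (by simpa using hφ)
    refine ⟨K, inferInstance, inferInstance, fun i j => if i = j then φ else 0, PowerSeries.invOfUnit φ 1, 1,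
      ⟨⟨?_, ?_⟩, ?_, ?_, ?_, ?_, ?_, one_ne_zero, ?_, ?_, ?_⟩⟩
    · intro i j
      split_ifs <;> simp [hφ]
    · intro i j k l r s
      fin_cases i <;> fin_cases j <;> fin_cases k <;> fin_cases l <;> simp <;> ring
    · simpa using hu
    · simpa [mul_comm] using hu
    · simpa using HasPoles.zero _
    · simpa using HasPoles.zero _
    · simp [series_smul_def]
    · simp [series_smul_def]
    · simp
    · simp [series_smul_def]
  | insert y S hy ih =>
    obtain ⟨B, _, _, T, ai, q, H⟩ := ih
    refine ⟨Matrix (Fin 2) (Fin 2) B, inferInstance, inferInstance, tensorT T y, tensorInv T ai y,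
      Matrix.single 0 0 q, ?_⟩
    rw [Finset.prod_insert hy, mul_assoc]
    exact H.step (Finset.subset_insert y S) (Finset.mem_insert_self y S) hy

end ModelExists

/-! ### The Yangian as the universal solution of the RTT relations -/

section YangianRTT

variable {K : Type*} [Field K]

/-- The terms with `s ≤ t < r` cancel, as the summand is antisymmetric under `t ↦ r + s - 1 - t`.
The bound `min r s` in the defining relations may thus be replaced by `r`. -/
theorem sum_min_eq {A : Type*} [AddCommGroup A] (g : ℕ → ℕ → A) (r s : ℕ) :
    ∑ t ∈ Finset.range (min r s), (g t (r + s - 1 - t) - g (r + s - 1 - t) t) =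
      ∑ t ∈ Finset.range r, (g t (r + s - 1 - t) - g (r + s - 1 - t) t) := by
  rcases le_total r s with h | h
  · rw [min_eq_left h]
  · rw [min_eq_right h, ← Finset.sum_range_add_sum_Ico _ h, left_eq_add, Finset.sum_sub_distrib, sub_eq_zero]
    refine Finset.sum_bij' (fun t _ => r + s - 1 - t) (fun t _ => r + s - 1 - t) ?_ ?_ ?_ ?_ ?_
    all_goals
      intro t ht
      rw [Finset.mem_Ico] at ht
    · rw [Finset.mem_Ico]; omega
    · rw [Finset.mem_Ico]; omega
    · omega
    · omega
    · have : r + s - 1 - (r + s - 1 - t) = t := by omega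
      rw [this]

theorem t_commutator (i j k l : Fin 2) {r s : ℕ} (hr : 0 < r) (hs : 0 < s) :
    t K i j r * t K k l s - t K k l s * t K i j r =
      ∑ m ∈ Finset.range r, (t K k j m * t K i l (r + s - 1 - m) - t K k j (r + s - 1 - m) * t K i l m) := by
  rw [← sum_min_eq (fun m n => t K k j m * t K i l n)]
  have := RingQuot.mkAlgHom_rel K (RTTRel.rtt (K := K) i j k l r s hr hs)
  change mk K _ = mk K _ at this
  simp only [map_sub, map_mul, map_sum] at this
  exact this

theorem coeff_tSeries (i j : Fin 2) (r : ℕ) : PowerSeries.coeff r (tSeries K i j) = t K i j r :=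
  PowerSeries.coeff_mk _ _

theorem isRTT_tSeries : IsRTT (tSeries K) := by
  have zero_left : ∀ i j k l s, t K i j 0 * t K k l s - t K k l s * t K i j 0 = 0 := by
    intro i j k l s
    rw [t_zero]
    split_ifs <;> simp
  have zero_right : ∀ i j k l r, t K i j r * t K k l 0 - t K k l 0 * t K i j r = 0 := by
    intro i j k l r
    rw [t_zero]
    split_ifs <;> simp
  have comm : ∀ i j k l r s, t K i j r * t K k l s - t K k l s * t K i j r =
      ∑ m ∈ Finset.range r, (t K k j m * t K i l (r + s - 1 - m) - t K k j (r + s - 1 - m) * t K i l m) := by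
    intro i j k l r s
    rcases Nat.eq_zero_or_pos r with rfl | hr
    · rw [zero_left, Finset.sum_range_zero]
    rcases Nat.eq_zero_or_pos s with rfl | hs
    · rw [zero_right, ← sum_min_eq (fun m n => t K k j m * t K i l n), Nat.min_zero, Finset.sum_range_zero]
    exact t_commutator i j k l hr hs
  refine ⟨fun i j => by rw [coeff_tSeries, t_zero], fun i j k l r s => ?_⟩
  simp only [coeff_tSeries]
  rw [comm, comm i j k l r (s + 1), Finset.sum_range_succ]
  have h1 : r + 1 + s - 1 = r + (s + 1) - 1 := by omega
  have h2 : r + (s + 1) - 1 - r = s := by omega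
  rw [h1, h2, add_sub_cancel_left]

/-- The algebra homomorphism out of `Y₂` given by a solution of the RTT relations. -/
theorem exists_algHom_of_isRTT {B : Type*} [Ring B] [Algebra K B] {T : Fin 2 → Fin 2 → B⟦X⟧} (H : IsRTT T) :
    ∃ ρ : Yangian K →ₐ[K] B, ∀ i j, PowerSeries.map ρ.toRingHom (tSeries K i j) = T i j := by
  set F : FreeAlgebra K (Fin 2 × Fin 2 × ℕ) →ₐ[K] B :=
    FreeAlgebra.lift K fun x => PowerSeries.coeff (x.2.2 + 1) (T x.1 x.2.1) with hF
  have hFt : ∀ i j r, F (tFree K i j r) = PowerSeries.coeff r (T i j) := by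
    intro i j r
    rcases r with _ | r
    · rw [tFree, H.const]
      split_ifs <;> simp
    · rw [tFree, hF, FreeAlgebra.lift_ι_apply]
  have hrel : ∀ ⦃x y⦄, RTTRel K x y → F x = F y := by
    rintro _ _ ⟨i, j, k, l, r, s, hr, hs⟩
    simp only [map_sub, map_mul, map_sum, hFt]
    rw [H.commutator, ← sum_min_eq (fun m n => PowerSeries.coeff m (T k j) * PowerSeries.coeff n (T i l))]
  let ρ : Yangian K →ₐ[K] B := RingQuot.liftAlgHom K (s := RTTRel K) ⟨F, hrel⟩
  refine ⟨ρ, fun i j => ?_⟩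
  ext r
  rw [PowerSeries.coeff_map, coeff_tSeries, ← hFt]
  exact RingQuot.liftAlgHom_mkAlgHom_apply K F hrel _

theorem yangian_induction {P : Yangian K → Prop} (hadd : ∀ x y, P x → P y → P (x + y))
    (hmul : ∀ x y, P x → P y → P (x * y)) (hK : ∀ c : K, P (algebraMap K _ c))
    (ht : ∀ i j r, P (t K i j r)) (x : Yangian K) : P x := by
  obtain ⟨y, rfl⟩ := RingQuot.mkAlgHom_surjective K (RTTRel K) x
  change P (mk K y)
  induction y using FreeAlgebra.induction with
  | grade0 c => rw [AlgHom.commutes]; exact hK c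
  | grade1 x => exact ht x.1 x.2.1 (x.2.2 + 1)
  | mul a b ha hb => rw [map_mul]; exact hmul _ _ ha hb
  | add a b ha hb => rw [map_add]; exact hadd _ _ ha hb

variable {B : Type*} [Ring B]

theorem left_inv_unique {a x y : B} (h : x * a = 1) (h' : a * y = 1) : x = y := by
  rw [← mul_one x, ← h', ← mul_assoc, h, one_mul]

variable [Algebra K B] {T : Fin 2 → Fin 2 → B⟦X⟧} {ai : B⟦X⟧} {ρ : Yangian K →ₐ[K] B}

theorem map_tInv (hρ : ∀ i j, PowerSeries.map ρ.toRingHom (tSeries K i j) = T i j) (h : T 0 0 * ai = 1) :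
    PowerSeries.map ρ.toRingHom (tInv K) = ai := by
  refine left_inv_unique (a := T 0 0) ?_ h
  rw [← hρ, ← map_mul, tInv_mul_tSeries, map_one]

theorem map_eSeries (hρ : ∀ i j, PowerSeries.map ρ.toRingHom (tSeries K i j) = T i j) (h : T 0 0 * ai = 1) :
    PowerSeries.map ρ.toRingHom (eSeries K) = ai * T 0 1 := by
  rw [eSeries, map_mul, map_tInv hρ h, hρ]

theorem map_fSeries (hρ : ∀ i j, PowerSeries.map ρ.toRingHom (tSeries K i j) = T i j) (h : T 0 0 * ai = 1) :
    PowerSeries.map ρ.toRingHom (fSeries K) = T 1 0 * ai := by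
  rw [fSeries, map_mul, map_tInv hρ h, hρ]

theorem map_dSeries_zero (hρ : ∀ i j, PowerSeries.map ρ.toRingHom (tSeries K i j) = T i j) :
    PowerSeries.map ρ.toRingHom (dSeries K 0) = T 0 0 := hρ 0 0

theorem map_dSeries_one (hρ : ∀ i j, PowerSeries.map ρ.toRingHom (tSeries K i j) = T i j) (h : T 0 0 * ai = 1) :
    PowerSeries.map ρ.toRingHom (dSeries K 1) = T 1 1 - T 1 0 * ai * T 0 1 := by
  change PowerSeries.map ρ.toRingHom (tSeries K 1 1 - tSeries K 1 0 * tInv K * tSeries K 0 1) = _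
  rw [map_sub, map_mul, map_mul, map_tInv hρ h, hρ, hρ, hρ]

end YangianRTT

/-! ### The `p`-center on a model -/

section ModelCentral

variable {K : Type*} [Field K] {B : Type*} [Ring B] [Algebra K B]

attribute [local instance] seriesAlgebra

theorem commute_C_iff {b : B} {g : B⟦X⟧} :
    Commute (PowerSeries.C b) g ↔ ∀ r, Commute b (PowerSeries.coeff r g) := by
  constructor
  · intro h r
    have := congrArg (PowerSeries.coeff r) h.eq
    rwa [PowerSeries.coeff_C_mul, PowerSeries.coeff_mul_C] at this
  · intro h
    ext r
    rw [PowerSeries.coeff_C_mul, PowerSeries.coeff_mul_C]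
    exact h r

theorem Commute.series_smul {b : B} {g : B⟦X⟧} (φ : K⟦X⟧) (h : Commute (PowerSeries.C b) g) :
    Commute (PowerSeries.C b) (φ • g) := by
  rw [Commute, SemiconjBy, mul_smul_comm, smul_mul_assoc, h.eq]

theorem Commute.shift {b : B} {g : B⟦X⟧} (c : K) (h : Commute (PowerSeries.C b) g) :
    Commute (PowerSeries.C b) (shift c g) := by
  have := congrArg (RestrictedYangianTwo.shift c) h.eq
  rwa [shift_mul, shift_mul, shift_C] at this

theorem commute_poleSum {S : Finset K} {E : K → B} {b : B} (h : ∀ y ∈ S, Commute b (E y)) :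
    Commute (PowerSeries.C b) (poleSum S E) := by
  rw [poleSum]
  refine Commute.sum_right _ _ _ fun y hy => Commute.series_smul _ ?_
  exact (h y hy).map PowerSeries.C

/-- On the highest weight vector `d_i(u) ⋯ d_i(u - p + 1)` acts by the corresponding product for the
weight, which is `1` for restricted weights. -/
theorem shiftProd_mul_C {p : ℕ} {φ : K⟦X⟧} {g : B⟦X⟧} {q : B}
    (h : g * PowerSeries.C q = φ • PowerSeries.C q) :
    shiftProd K p g * PowerSeries.C q = shiftProd K p φ • PowerSeries.C q := by
  have key : ∀ n : ℕ, ((List.range n).map fun j : ℕ => shift (j : K) g).prod * PowerSeries.C q =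
      (∏ j ∈ Finset.range n, shift (j : K) φ) • (PowerSeries.C q : B⟦X⟧) := by
    intro n
    induction n with
    | zero => simp
    | succ n ih =>
      have h1 : shift (n : K) g * PowerSeries.C q = shift (n : K) φ • (PowerSeries.C q : B⟦X⟧) := by
        have := congrArg (shift (n : K)) h
        rwa [shift_mul, shift_smul, shift_C] at this
      rw [List.range_succ, List.map_append, List.prod_append, List.map_singleton, List.prod_singleton,
        mul_assoc, h1, mul_smul_comm, ih, smul_smul, Finset.prod_range_succ, mul_comm]
  rw [shiftProd_eq_prod]
  exact key p

theorem opSeries_poleSum (S : Finset K) (F : K → B) :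
    opSeries (poleSum S F) = poleSum S fun y => MulOpposite.op (F y) := by
  ext r
  rw [coeff_opSeries]
  rcases r with _ | r
  · rw [coeff_zero_poleSum, coeff_zero_poleSum, MulOpposite.op_zero]
  · simp only [coeff_succ_poleSum, Finset.op_sum, MulOpposite.op_smul]

theorem opSeries_injective {A : Type*} [Ring A] {g h : A⟦X⟧} (H : opSeries g = opSeries h) : g = h := by
  ext r
  have := congrArg (PowerSeries.coeff r) H
  rw [coeff_opSeries, coeff_opSeries] at this
  exact MulOpposite.op_injective this

theorem opSeries_C {A : Type*} [Ring A] (x : A) :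
    opSeries (PowerSeries.C x) = PowerSeries.C (MulOpposite.op x) := by
  ext r
  rw [coeff_opSeries, PowerSeries.coeff_C, PowerSeries.coeff_C]
  split_ifs <;> simp

theorem opSeries_smul (φ : K⟦X⟧) (g : B⟦X⟧) : opSeries (φ • g) = φ • opSeries g := by
  ext r
  simp only [coeff_opSeries, coeff_series_smul, Finset.op_sum, MulOpposite.op_smul]

/-- Commuting a residue of `f(u)` past `a(u)`. -/
theorem residue_f_mul {a f : B⟦X⟧} {S : Finset K} {F : K → B} (H : HalfRel (opSeries a) (opSeries f))
    (ha : PowerSeries.coeff 0 a = 1) (hf : f = poleSum S F) {y : K} (hy : y ∈ S) :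
    PowerSeries.C (F y) * a = (1 + invSub K (y + 1)) • (a * PowerSeries.C (F y)) := by
  have h := H.residue_mul (by rw [coeff_opSeries, ha, MulOpposite.op_one])
    (by rw [hf, opSeries_poleSum]) hy
  rw [← opSeries_C, ← opSeries_mul, ← opSeries_mul, ← opSeries_smul] at h
  rw [opSeries_injective h, smul_smul, mul_comm, one_sub_mul_one_add_invSub, one_smul]

theorem Model.pow_e {S : Finset K} {lam1 lam2 : K⟦X⟧} {T : Fin 2 → Fin 2 → B⟦X⟧} {ai : B⟦X⟧} {q : B}
    (H : Model S lam1 lam2 T ai q) (p : ℕ) (hp : 0 < p) [CharP K p] (hS : ∀ k ∈ S, ∀ l ∈ S, k - l ≠ 1)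
    (r : ℕ) : PowerSeries.coeff r (ai * T 0 1) ^ p = 0 :=
  (H.rtt.halfRel H.mul_inv H.inv_mul).coeff_pow_eq_zero H.poles_e p hp hS r

theorem Model.pow_f {S : Finset K} {lam1 lam2 : K⟦X⟧} {T : Fin 2 → Fin 2 → B⟦X⟧} {ai : B⟦X⟧} {q : B}
    (H : Model S lam1 lam2 T ai q) (p : ℕ) (hp : 0 < p) [CharP K p] (hS : ∀ k ∈ S, ∀ l ∈ S, k - l ≠ 1)
    (r : ℕ) : PowerSeries.coeff r (T 1 0 * ai) ^ p = 0 := by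
  obtain ⟨F, hF⟩ := H.poles_f
  have := (H.rtt.halfRel_op H.mul_inv H.inv_mul).coeff_pow_eq_zero
    ⟨_, by rw [hF, opSeries_poleSum]⟩ p hp hS r
  rw [coeff_opSeries, ← MulOpposite.op_pow] at this
  exact MulOpposite.op_injective this

/-- The coefficients of `d_i(u) ⋯ d_i(u - p + 1)` act centrally on a model. -/
theorem Model.commute_shiftProd {S : Finset K} {lam1 lam2 : K⟦X⟧} {T : Fin 2 → Fin 2 → B⟦X⟧} {ai : B⟦X⟧}
    {q : B} (H : Model S lam1 lam2 T ai q) (p : ℕ) [CharP K p] (r : ℕ) (i j : Fin 2) :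
    Commute (PowerSeries.C (PowerSeries.coeff r (shiftProd K p (T 0 0)))) (T i j) ∧
    Commute (PowerSeries.C (PowerSeries.coeff r (shiftProd K p (T 1 1 - T 1 0 * ai * T 0 1)))) (T i j) := by
  obtain ⟨E, hE⟩ := H.poles_e
  obtain ⟨F, hF⟩ := H.poles_f
  have ha := coeff_zero_T00 H.rtt
  set a := T 0 0 with hadef
  set D := T 1 1 - T 1 0 * ai * T 0 1 with hD
  set ψ := lam1 * shift (1 : K) lam2
  -- As the quantum determinant is a scalar series, `d₂` is a scalar multiple of a shift of `d₁⁻¹`.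
  -- Commutation rules for `d₁` then give those for `d₂`, with inverted and shifted factors; this is
  -- `scal`.
  have hDa : D = shift (-1 : K) (ψ • ai) := by
    have h1 : shift (1 : K) D = ψ • ai := by
      have := congrArg (ai * ·) H.qdet
      simpa only [← mul_assoc, H.inv_mul, one_mul, mul_smul_comm, mul_one] using this
    rw [← h1, shift_shift, neg_add_cancel, shift_zero]
  have scal : ∀ (b : B) (φ φ' : K⟦X⟧), φ' * φ = 1 → PowerSeries.C b * a = φ • (a * PowerSeries.C b) →
      PowerSeries.C b * D = shift (-1 : K) φ' • (D * PowerSeries.C b) := by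
    intro b φ φ' hφ h
    have h2 : PowerSeries.C b * ai = φ' • (ai * PowerSeries.C b) := by
      have := congrArg (fun g => φ' • (ai * g * ai)) h
      simp only [mul_smul_comm, smul_mul_assoc, smul_smul, hφ, one_smul] at this
      rw [mul_assoc ai _ ai, mul_assoc _ a ai, H.mul_inv, mul_one, ← mul_assoc ai a, H.inv_mul, one_mul] at this
      exact this.symm
    have := congrArg (shift (-1 : K)) (congrArg (ψ • ·) h2)
    simp only [shift_smul, shift_mul, shift_C, smul_smul] at this
    rw [hDa, shift_smul, mul_smul_comm, this, smul_mul_assoc, smul_smul, mul_comm]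
  have aa : ∀ s, PowerSeries.C (PowerSeries.coeff s a) * a = (1 : K⟦X⟧) • (a * PowerSeries.C (PowerSeries.coeff s a)) := by
    intro s
    rw [one_smul]
    exact commute_C_iff.2 fun r => H.rtt.commute_self 0 0 s r
  -- By the Gauss factorization it is enough to commute with `d₁` and with the residues of `e` and
  -- `f`. A residue commutes with `g` up to a restricted factor, which disappears in `g(u) ⋯ g(u - p
  -- + 1)`.
  have main : ∀ g : B⟦X⟧,
      (∀ s, PowerSeries.C (PowerSeries.coeff s a) * g = (1 : K⟦X⟧) • (g * PowerSeries.C (PowerSeries.coeff s a))) →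
      (∀ y ∈ S, ∃ φ : K⟦X⟧, IsRestricted p φ ∧ PowerSeries.C (E y) * g = φ • (g * PowerSeries.C (E y))) →
      (∀ y ∈ S, ∃ φ : K⟦X⟧, IsRestricted p φ ∧ PowerSeries.C (F y) * g = φ • (g * PowerSeries.C (F y))) →
      Commute (PowerSeries.C (PowerSeries.coeff r (shiftProd K p g))) (T i j) := by
    intro g h1 h2 h3
    set β := PowerSeries.coeff r (shiftProd K p g) with hβ
    have ca : Commute (PowerSeries.C β) a := commute_C_iff.2 fun s =>
      (commute_C_iff.1 (shiftProd_commute_C (IsRestricted.one p) (h1 s)) r).symm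
    have ce : Commute (PowerSeries.C β) (ai * T 0 1) := by
      rw [hE]
      refine commute_poleSum fun y hy => ?_
      obtain ⟨φ, hφ, hh⟩ := h2 y hy
      exact (commute_C_iff.1 (shiftProd_commute_C hφ hh) r).symm
    have cf : Commute (PowerSeries.C β) (T 1 0 * ai) := by
      rw [hF]
      refine commute_poleSum fun y hy => ?_
      obtain ⟨φ, hφ, hh⟩ := h3 y hy
      exact (commute_C_iff.1 (shiftProd_commute_C hφ hh) r).symm
    have cai : Commute (PowerSeries.C β) ai := by
      have : ai * (PowerSeries.C β * a) * ai = ai * (a * PowerSeries.C β) * ai := by rw [ca.eq]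
      rw [mul_assoc ai _ ai, mul_assoc _ a ai, H.mul_inv, mul_one, ← mul_assoc ai a, H.inv_mul, one_mul] at this
      exact this.symm
    have cD : Commute (PowerSeries.C β) D := by
      rw [hDa]
      exact Commute.shift _ (Commute.series_smul _ cai)
    have c01 : Commute (PowerSeries.C β) (T 0 1) := by
      have := ca.mul_right ce
      rwa [← mul_assoc, H.mul_inv, one_mul] at this
    have c10 : Commute (PowerSeries.C β) (T 1 0) := by
      have := cf.mul_right ca
      rwa [mul_assoc, H.inv_mul, mul_one] at this
    have c11 : Commute (PowerSeries.C β) (T 1 1) := by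
      have := cD.add_right (cf.mul_right c01)
      rwa [hD, sub_add_cancel] at this
    fin_cases i <;> fin_cases j
    exacts [ca, c01, c10, c11]
  have eE := fun y (hy : y ∈ S) => (H.rtt.halfRel H.mul_inv H.inv_mul).residue_mul ha hE hy
  have eF := fun y (hy : y ∈ S) => residue_f_mul (H.rtt.halfRel_op H.mul_inv H.inv_mul) ha hF hy
  refine ⟨main a aa (fun y hy => ⟨_, isRestricted_one_sub_invSub p y, eE y hy⟩)
    (fun y hy => ⟨_, isRestricted_one_add_invSub p y, eF y hy⟩), main D (fun s => ?_) (fun y hy => ?_) fun y hy => ?_⟩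
  · have := scal _ 1 1 (one_mul 1) (aa s)
    rwa [shift_one] at this
  · refine ⟨_, ?_, scal _ _ (1 + invSub K (y + 1)) (by rw [mul_comm, one_sub_mul_one_add_invSub]) (eE y hy)⟩
    rw [shift_add, shift_one, shift_invSub]
    have := isRestricted_one_add_invSub p (y - 1)
    rwa [show y - 1 + 1 = -1 + (y + 1) by ring] at this
  · refine ⟨_, ?_, scal _ _ (1 - invSub K y) (one_sub_mul_one_add_invSub y) (eF y hy)⟩
    rw [shift_sub, shift_one, shift_invSub]
    exact isRestricted_one_sub_invSub p _

end ModelCentral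

/-! ### From models to representations of `Y₂^{[p]}` -/

section Representation

variable {K : Type*} [Field K] {B : Type*} [Ring B] [Algebra K B]

attribute [local instance] seriesAlgebra

/-- A generic model with restricted weight yields a highest weight representation of `Y₂^{[p]}`. -/
theorem Model.exists_rep {S : Finset K} {lam : Fin 2 → K⟦X⟧} {T : Fin 2 → Fin 2 → B⟦X⟧} {ai : B⟦X⟧}
    {q : B} (H : Model S (lam 0) (lam 1) T ai q) (p : ℕ) (hp : 0 < p) [CharP K p] (hS : ∀ k ∈ S, ∀ l ∈ S, k - l ≠ 1)
    (hlam : IsRestrictedPair p lam) :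
    ∃ (W : Submodule K B) (Φ : RestrictedYangian K p →ₐ[K] Module.End K W) (v : W), v ≠ 0 ∧
      (∀ r, Φ (proj K p (e K r)) v = 0) ∧
      ∀ i r, Φ (proj K p (d K i r)) v = PowerSeries.coeff r (lam i) • v := by
  obtain ⟨ρ, hρ⟩ := exists_algHom_of_isRTT (K := K) H.rtt
  have he := map_eSeries hρ H.mul_inv
  have hf := map_fSeries hρ H.mul_inv
  have hd0 := map_dSeries_zero hρ
  have hd1 := map_dSeries_one hρ H.mul_inv
  have ρe : ∀ r, ρ (e K r) = PowerSeries.coeff r (ai * T 0 1) := fun r => by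
    rw [← he, PowerSeries.coeff_map]; rfl
  have ρf : ∀ r, ρ (f K r) = PowerSeries.coeff r (T 1 0 * ai) := fun r => by
    rw [← hf, PowerSeries.coeff_map]; rfl
  have ρt : ∀ i j r, ρ (t K i j r) = PowerSeries.coeff r (T i j) := fun i j r => by
    rw [← hρ, PowerSeries.coeff_map, coeff_tSeries]; rfl
  have ρb : ∀ i r, ρ (b K p i r) =
      PowerSeries.coeff r (shiftProd K p (PowerSeries.map ρ.toRingHom (dSeries K i))) := fun i r => by
    rw [← map_shiftProd, PowerSeries.coeff_map]; rfl
  have comm : ∀ i r x, Commute (ρ (b K p i r)) (ρ x) := by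
    intro i r x
    induction x using yangian_induction with
    | hadd x y hx hy => rw [map_add]; exact hx.add_right hy
    | hmul x y hx hy => rw [map_mul]; exact hx.mul_right hy
    | hK c => rw [AlgHom.commutes]; exact Algebra.commute_algebraMap_right c _
    | ht k l s =>
      rw [ρt, ρb]
      have := H.commute_shiftProd p r k l
      fin_cases i
      · change Commute (PowerSeries.coeff r (shiftProd K p (PowerSeries.map ρ.toRingHom (dSeries K 0)))) _
        rw [hd0]
        exact commute_C_iff.1 this.1 s
      · change Commute (PowerSeries.coeff r (shiftProd K p (PowerSeries.map ρ.toRingHom (dSeries K 1)))) _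
        rw [hd1]
        exact commute_C_iff.1 this.2 s
  have hdq : ∀ i, PowerSeries.map ρ.toRingHom (dSeries K i) * PowerSeries.C q = lam i • PowerSeries.C q := by
    intro i
    fin_cases i
    · change PowerSeries.map ρ.toRingHom (dSeries K 0) * _ = _
      rw [hd0]
      exact H.hw00
    · change PowerSeries.map ρ.toRingHom (dSeries K 1) * _ = _
      rw [hd1, sub_mul, mul_assoc _ (T 0 1), H.hw01, mul_zero, sub_zero]
      exact H.hw11
  -- The powers of `e⁽ʳ⁾` and `f⁽ʳ⁾` vanish on the whole model, but the `b_i⁽ʳ⁾` may not. They are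
  -- central, so their common kernel is a submodule, and it contains `q` because the weight is
  -- restricted.
  let W : Submodule K B :=
    { carrier := {x | ∀ i r, 0 < r → ρ (b K p i r) * x = 0}
      add_mem' := fun {x y} hx hy i r hr => by rw [mul_add, hx i r hr, hy i r hr, add_zero]
      zero_mem' := fun i r _ => mul_zero _
      smul_mem' := fun c x hx i r hr => by rw [mul_smul_comm, hx i r hr, smul_zero] }
  have stable : ∀ (y : Yangian K) (x : W), ρ y * (x : B) ∈ W := by
    intro y x i r hr
    rw [← mul_assoc, (comm i r y).eq, mul_assoc, x.2 i r hr, mul_zero]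
  let Φ₀ : Yangian K →ₐ[K] Module.End K W :=
    { toFun := fun y =>
        { toFun := fun x => ⟨ρ y * x, stable y x⟩
          map_add' := fun x x' => Subtype.ext (mul_add _ _ _)
          map_smul' := fun c x => Subtype.ext (mul_smul_comm _ _ _) }
      map_one' := LinearMap.ext fun x => Subtype.ext (by
        change ρ 1 * (x : B) = x
        rw [map_one, one_mul])
      map_mul' := fun y y' => LinearMap.ext fun x => Subtype.ext (by
        change ρ (y * y') * (x : B) = ρ y * (ρ y' * x)
        rw [map_mul, mul_assoc])
      map_zero' := LinearMap.ext fun x => Subtype.ext (by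
        change ρ 0 * (x : B) = 0
        rw [map_zero, zero_mul])
      map_add' := fun y y' => LinearMap.ext fun x => Subtype.ext (by
        change ρ (y + y') * (x : B) = ρ y * x + ρ y' * x
        rw [map_add, add_mul])
      commutes' := fun c => LinearMap.ext fun x => Subtype.ext (by
        change ρ (algebraMap K _ c) * (x : B) = c • (x : B)
        rw [AlgHom.commutes, Algebra.smul_def]) }
  have Φ₀_apply : ∀ y (x : W), ((Φ₀ y x : W) : B) = ρ y * x := fun y x => rfl
  have Φ₀_zero : ∀ y, ρ y = 0 → Φ₀ y = 0 := fun y hy => LinearMap.ext fun x => Subtype.ext (by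
    rw [Φ₀_apply, hy, zero_mul]; rfl)
  have hrel : ∀ ⦃x y⦄, PCenterRel K p x y → Φ₀ x = Φ₀ y := by
    rintro _ _ (⟨i, r, hr⟩ | ⟨r, hr⟩ | ⟨r, hr⟩)
    · rw [map_zero]
      exact LinearMap.ext fun x => Subtype.ext (x.2 i (r * p) (Nat.mul_pos hr hp))
    · rw [map_zero]
      exact Φ₀_zero _ (by rw [map_pow, ρe, H.pow_e p hp hS])
    · rw [map_zero]
      exact Φ₀_zero _ (by rw [map_pow, ρf, H.pow_f p hp hS])
  let Φ : RestrictedYangian K p →ₐ[K] Module.End K W :=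
    RingQuot.liftAlgHom K (s := PCenterRel K p) ⟨Φ₀, hrel⟩
  have Φ_proj : ∀ y, Φ (proj K p y) = Φ₀ y := fun y => RingQuot.liftAlgHom_mkAlgHom_apply K Φ₀ hrel y
  have hq : q ∈ W := by
    intro i r hr
    have := congrArg (PowerSeries.coeff r) (shiftProd_mul_C (p := p) (hdq i))
    rw [(hlam i).2, one_smul, PowerSeries.coeff_mul_C, ← ρb, PowerSeries.coeff_C, if_neg hr.ne'] at this
    exact this
  refine ⟨W, Φ, ⟨q, hq⟩, fun h => H.ne_zero (congrArg Subtype.val h), fun r => ?_, fun i r => ?_⟩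
  · rw [Φ_proj]
    refine Subtype.ext ?_
    rw [Φ₀_apply, ρe, ← PowerSeries.coeff_mul_C, mul_assoc, H.hw01, mul_zero, map_zero]
    rfl
  · rw [Φ_proj]
    refine Subtype.ext ?_
    have := congrArg (PowerSeries.coeff r) (hdq i)
    rw [PowerSeries.coeff_mul_C, PowerSeries.coeff_map, coeff_smul_C] at this
    exact this

end Representation

/-! ### Approximation of restricted series by generic products -/

section Hilbert90

variable {K : Type*} [Field K]

theorem invSub_injective : Function.Injective (invSub K) := by
  intro a b h
  have := congrArg (PowerSeries.coeff 2) h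
  rwa [coeff_succ_invSub, coeff_succ_invSub, pow_one, pow_one] at this

/-- A multiplicative form of Hilbert's Theorem 90 for the shift `u ↦ u - 1`. -/
theorem exists_mul_shift_eq (p : ℕ) (hp : 0 < p) [CharP K p] {lam : K⟦X⟧} (hlam : IsRestricted p lam) :
    ∃ G : K⟦X⟧, G ≠ 0 ∧ lam * shift (1 : K) G = G := by
  set Λ : ℕ → K⟦X⟧ := fun j => ∏ k ∈ Finset.range j, shift (k : K) lam with hΛ
  have hΛp : Λ p = 1 := by rw [hΛ]; simp only; rw [← shiftProd_eq_prod, hlam.2]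
  have hΛs : ∀ j, lam * shift (1 : K) (Λ j) = Λ (j + 1) := by
    intro j
    simp only [hΛ]
    rw [Finset.prod_range_succ', ← shiftHom_apply, map_prod, Nat.cast_zero, shift_zero, mul_comm]
    congr 1
    refine Finset.prod_congr rfl fun k _ => ?_
    rw [shiftHom_apply, shift_shift, Nat.cast_succ, add_comm]
  by_contra! hcon
  -- The sums are Lagrange resolvents: `g ↦ λ(u) g(u - 1)` sends the `j`-th term to the `(j +
  -- 1)`-st, and the `p`-th term equals the `0`-th. Each resolvent is a solution, so under `hcon`
  -- all vanish; the Vandermonde determinant of the distinct `1 / (u - j)` then gives `Λ 0 = 0`,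
  -- although `Λ 0 = 1`.
  have hG : ∀ i : ℕ, ∑ j ∈ Finset.range p, Λ j * invSub K (j : K) ^ i = 0 := by
    intro i
    by_contra hne
    refine hcon _ hne ?_
    set h : ℕ → K⟦X⟧ := fun j => Λ j * invSub K (j : K) ^ i with hh
    rw [← shiftHom_apply, map_sum, Finset.mul_sum]
    have h1 : ∀ j ∈ Finset.range p, lam * shiftHom K K 1 (h j) = h (j + 1) := by
      intro j _
      rw [hh]
      simp only
      rw [map_mul, map_pow, shiftHom_apply, shiftHom_apply, shift_invSub, ← mul_assoc, hΛs, Nat.cast_succ,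
        add_comm (1 : K) (j : K)]
    rw [Finset.sum_congr rfl h1]
    have h2 := Finset.sum_range_succ h p
    rw [Finset.sum_range_succ' h p] at h2
    have h3 : h 0 = h p := by
      simp only [hh, hΛp, CharP.cast_eq_zero, Nat.cast_zero]
      simp [hΛ]
    rw [h3] at h2
    exact add_right_cancel h2
  have inj : Function.Injective fun j : Fin p => invSub K ((j : ℕ) : K) := by
    intro i j hij
    have := (CharP.natCast_eq_natCast K p).1 (invSub_injective hij)
    exact Fin.ext (Nat.ModEq.eq_of_lt_of_lt this i.2 j.2)
  have := Matrix.eq_zero_of_forall_pow_sum_mul_pow_eq_zero (v := fun j : Fin p => Λ j) inj fun i => by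
    rw [← hG i, Finset.sum_range]
  have h0 := congrFun this ⟨0, hp⟩
  simp [hΛ] at h0

/-- A double root of `F = P + c₁ X + c₀` is a root of `P' + c₁`, and if `l` and `l + 1` are roots
then `l` is a root of `P(X + 1) - P + c₁`. Generic `c₁` makes both polynomials nonzero, and generic
`c₀` moves the roots of `F` away from their finitely many roots. -/
theorem exists_generic_roots [Infinite K] (P : Polynomial K) (hP : ∀ c₁ c₀ : K, P + Polynomial.C c₁ * Polynomial.X +
    Polynomial.C c₀ ≠ 0) : ∃ c₁ c₀ : K,
      (P + Polynomial.C c₁ * Polynomial.X + Polynomial.C c₀).roots.Nodup ∧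
      ∀ k ∈ (P + Polynomial.C c₁ * Polynomial.X + Polynomial.C c₀).roots,
        ∀ l ∈ (P + Polynomial.C c₁ * Polynomial.X + Polynomial.C c₀).roots, k - l ≠ 1 := by
  classical
  set R := P.comp (Polynomial.X + 1) - P with hR
  obtain ⟨c₁, hc₁⟩ := Infinite.exists_notMem_finset ({-(P.derivative.coeff 0), -(R.coeff 0)} : Finset K)
  simp only [Finset.mem_insert, Finset.mem_singleton, not_or] at hc₁
  set Q₁ := P.derivative + Polynomial.C c₁ with hQ₁
  set Q₂ := R + Polynomial.C c₁ with hQ₂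
  have hQ₁0 : Q₁ ≠ 0 := by
    intro h
    have := congrArg (Polynomial.coeff · 0) h
    simp only [hQ₁, Polynomial.coeff_add, Polynomial.coeff_C_zero, Polynomial.coeff_zero] at this
    exact hc₁.1 (eq_neg_of_add_eq_zero_right this)
  have hQ₂0 : Q₂ ≠ 0 := by
    intro h
    have := congrArg (Polynomial.coeff · 0) h
    simp only [hQ₂, Polynomial.coeff_add, Polynomial.coeff_C_zero, Polynomial.coeff_zero] at this
    exact hc₁.2 (eq_neg_of_add_eq_zero_right this)
  obtain ⟨c₀, hc₀⟩ := Infinite.exists_notMem_finset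
    ((Q₁.roots.toFinset ∪ Q₂.roots.toFinset).image fun x => -(P.eval x + c₁ * x))
  refine ⟨c₁, c₀, ?_⟩
  set F := P + Polynomial.C c₁ * Polynomial.X + Polynomial.C c₀ with hF
  have hF0 : F ≠ 0 := hP c₁ c₀
  have avoid : ∀ x, F.IsRoot x → Q₁.eval x ≠ 0 ∧ Q₂.eval x ≠ 0 := by
    intro x hx
    have hx' : c₀ = -(P.eval x + c₁ * x) := by
      have : P.eval x + c₁ * x + c₀ = 0 := by simpa [hF, Polynomial.IsRoot] using hx
      exact eq_neg_of_add_eq_zero_right this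
    constructor <;> intro h <;> refine hc₀ (Finset.mem_image.2 ⟨x, ?_, hx'.symm⟩)
    · rw [Finset.mem_union, Multiset.mem_toFinset, Polynomial.mem_roots hQ₁0]
      exact Or.inl h
    · rw [Finset.mem_union, Multiset.mem_toFinset, Multiset.mem_toFinset, Polynomial.mem_roots hQ₂0]
      exact Or.inr h
  refine ⟨?_, ?_⟩
  · rw [Multiset.nodup_iff_count_le_one]
    intro x
    rw [Polynomial.count_roots]
    by_contra! h
    rw [Polynomial.one_lt_rootMultiplicity_iff_isRoot hF0] at h
    refine (avoid x h.1).1 ?_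
    have := h.2
    simpa [hF, hQ₁, Polynomial.IsRoot] using this
  · intro k hk l hl hkl
    rw [Polynomial.mem_roots hF0] at hk hl
    refine (avoid l hl).2 ?_
    have e1 : k = l + 1 := by linear_combination hkl
    have h1 : P.eval (l + 1) + c₁ * (l + 1) + c₀ = 0 := by simpa [hF, Polynomial.IsRoot, e1] using hk
    have h2 : P.eval l + c₁ * l + c₀ = 0 := by simpa [hF, Polynomial.IsRoot] using hl
    simp only [hQ₂, hR, Polynomial.eval_add, Polynomial.eval_sub, Polynomial.eval_comp, Polynomial.eval_X,
      Polynomial.eval_one, Polynomial.eval_C]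
    linear_combination h1 - h2

theorem reverse_X_sub_C (y : K) : (Polynomial.X - Polynomial.C y).reverse = 1 - Polynomial.C y * Polynomial.X := by
  rw [Polynomial.reverse, Polynomial.natDegree_X_sub_C, sub_eq_add_neg, Polynomial.reflect_add, ← Polynomial.C_neg,
    Polynomial.reflect_C, Polynomial.reflect_one_X, pow_one, Polynomial.C_neg, neg_mul, sub_eq_add_neg]

theorem reverse_prod_X_sub_C (S : Finset K) : (∏ y ∈ S, (Polynomial.X - Polynomial.C y)).reverse =
    ∏ y ∈ S, (1 - Polynomial.C y * Polynomial.X) := by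
  classical
  induction S using Finset.induction with
  | empty => simp [Polynomial.reverse]
  | insert y S hy ih =>
    rw [Finset.prod_insert hy, Finset.prod_insert hy, Polynomial.reverse_mul_of_domain, ih, reverse_X_sub_C]

/-- A power series with constant term `1` is, to any order, a product `∏ (1 - y X)` over a generic
set of any prescribed large size. -/
theorem exists_generic_prod [IsAlgClosed K] (H : K⟦X⟧) (h0 : PowerSeries.constantCoeff H = 1) (D : ℕ) (hD : 2 ≤ D) :
    ∃ S : Finset K, S.card = D ∧ (∀ k ∈ S, ∀ l ∈ S, k - l ≠ 1) ∧
      (PowerSeries.X : K⟦X⟧) ^ (D - 1) ∣ H - ∏ y ∈ S, (1 - PowerSeries.C y * PowerSeries.X) := by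
  classical
  set T := PowerSeries.trunc (D - 1) H with hT
  have hTc : ∀ m, T.coeff m = if m < D - 1 then PowerSeries.coeff m H else 0 := fun m =>
    PowerSeries.coeff_trunc m (D - 1) H
  -- Reversal turns `∏ (1 - y X)` into `∏ (X - y)`. The free constants `c₁`, `c₀` correspond to the
  -- coefficients of `X ^ (D - 1)` and `X ^ D` before reversal, so they do not affect the
  -- approximation.
  set F : K → K → Polynomial K := fun c₁ c₀ =>
    Polynomial.reflect D T + Polynomial.C c₁ * Polynomial.X + Polynomial.C c₀ with hF
  have hrefl : ∀ c₁ c₀, F c₁ c₀ = Polynomial.reflect D (T + Polynomial.C c₁ * Polynomial.X ^ (D - 1) +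
      Polynomial.C c₀ * Polynomial.X ^ D) := by
    intro c₁ c₀
    simp only [hF, Polynomial.reflect_add, Polynomial.reflect_C_mul_X_pow]
    rw [Polynomial.revAt_le (by omega), Polynomial.revAt_le le_rfl, Nat.sub_self, pow_zero, mul_one,
      show D - (D - 1) = 1 by omega, pow_one]
  have hdeg : ∀ c₁ c₀, (F c₁ c₀).natDegree ≤ D := by
    intro c₁ c₀
    rw [Polynomial.natDegree_le_iff_coeff_eq_zero]
    intro m hm
    simp only [hF, Polynomial.coeff_add, Polynomial.coeff_reflect, Polynomial.coeff_C_mul, Polynomial.coeff_X,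
      Polynomial.coeff_C]
    rw [Polynomial.revAt_eq_self_of_lt hm, hTc, if_neg (by omega), if_neg (by omega), if_neg (by omega)]
    simp
  have hlead : ∀ c₁ c₀, (F c₁ c₀).coeff D = 1 := by
    intro c₁ c₀
    simp only [hF, Polynomial.coeff_add, Polynomial.coeff_reflect, Polynomial.coeff_C_mul, Polynomial.coeff_X,
      Polynomial.coeff_C]
    rw [Polynomial.revAt_le le_rfl, Nat.sub_self, hTc, if_pos (by omega), if_neg (by omega), if_neg (by omega)]
    simpa using h0
  have hmonic : ∀ c₁ c₀, (F c₁ c₀).Monic := fun c₁ c₀ =>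
    Polynomial.monic_of_natDegree_le_of_coeff_eq_one D (hdeg c₁ c₀) (hlead c₁ c₀)
  have hnat : ∀ c₁ c₀, (F c₁ c₀).natDegree = D := fun c₁ c₀ =>
    le_antisymm (hdeg c₁ c₀) (Polynomial.le_natDegree_of_ne_zero (by rw [hlead]; exact one_ne_zero))
  have : Infinite K := IsAlgClosed.instInfinite
  obtain ⟨c₁, c₀, hnd, hgen⟩ := exists_generic_roots (Polynomial.reflect D T) fun c₁ c₀ => (hmonic c₁ c₀).ne_zero
  change (F c₁ c₀).roots.Nodup at hnd
  change ∀ k ∈ (F c₁ c₀).roots, ∀ l ∈ (F c₁ c₀).roots, k - l ≠ 1 at hgen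
  have hsplit := IsAlgClosed.splits (F c₁ c₀)
  have hval : (F c₁ c₀).roots.toFinset.val = (F c₁ c₀).roots := by
    rw [Multiset.toFinset_val, hnd.dedup]
  have hprod : F c₁ c₀ = ∏ y ∈ (F c₁ c₀).roots.toFinset, (Polynomial.X - Polynomial.C y) := by
    have h1 := hsplit.eq_prod_roots_of_monic (hmonic c₁ c₀)
    rw [Finset.prod_eq_multiset_prod, hval]
    exact h1
  have hcard : (F c₁ c₀).roots.toFinset.card = D := by
    rw [Finset.card_def, hval, ← hnat c₁ c₀, hsplit.natDegree_eq_card_roots]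
  refine ⟨(F c₁ c₀).roots.toFinset, hcard, fun k hk l hl => hgen k (Multiset.mem_toFinset.1 hk) l
    (Multiset.mem_toFinset.1 hl), ?_⟩
  have hrev : T + Polynomial.C c₁ * Polynomial.X ^ (D - 1) + Polynomial.C c₀ * Polynomial.X ^ D =
      ∏ y ∈ (F c₁ c₀).roots.toFinset, (1 - Polynomial.C y * Polynomial.X) := by
    rw [← reverse_prod_X_sub_C, ← hprod, Polynomial.reverse, hnat, hrefl, Polynomial.reflect_reflect]
  have hser : (∏ y ∈ (F c₁ c₀).roots.toFinset, (1 - PowerSeries.C y * PowerSeries.X) : K⟦X⟧) =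
      ((T + Polynomial.C c₁ * Polynomial.X ^ (D - 1) + Polynomial.C c₀ * Polynomial.X ^ D : Polynomial K) : K⟦X⟧) := by
    rw [hrev, ← Polynomial.coeToPowerSeries.ringHom_apply, map_prod]
    simp
  rw [hser, PowerSeries.X_pow_dvd_iff]
  intro m hm
  rw [map_sub, Polynomial.coeff_coe, Polynomial.coeff_add, Polynomial.coeff_add, hTc, if_pos hm,
    Polynomial.coeff_C_mul_X_pow, Polynomial.coeff_C_mul_X_pow, if_neg (by omega), if_neg (by omega)]
  simp

theorem X_pow_dvd_shift {k : ℕ} {g : K⟦X⟧} (c : K) (h : (PowerSeries.X : K⟦X⟧) ^ k ∣ g) :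
    (PowerSeries.X : K⟦X⟧) ^ k ∣ shift c g := by
  obtain ⟨g', rfl⟩ := h
  rw [shift_mul, shift_pow, shift_X, invSub, mul_pow, mul_assoc]
  exact dvd_mul_right _ _

/-- Restricted series are, to any order, products of generic factors `1 + 1 / (u - y - 1)`. -/
theorem exists_generic_approx [IsAlgClosed K] (p : ℕ) (hp : 0 < p) [CharP K p] {lam : K⟦X⟧}
    (hlam : IsRestricted p lam) (N : ℕ) : ∃ S : Finset K, (∀ k ∈ S, ∀ l ∈ S, k - l ≠ 1) ∧
      ∀ r ≤ N, PowerSeries.coeff r (∏ y ∈ S, (1 + invSub K (y + 1))) = PowerSeries.coeff r lam := by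
  have hprime : p.Prime := (CharP.char_is_prime_or_zero K p).resolve_right hp.ne'
  have : Fact p.Prime := ⟨hprime⟩
  obtain ⟨G, hG0, hG⟩ := exists_mul_shift_eq p hp hlam
  obtain ⟨n, H₀, hH₀, hGH⟩ : ∃ (n : ℕ) (H₀ : K⟦X⟧), PowerSeries.constantCoeff H₀ ≠ 0 ∧ G = PowerSeries.X ^ n * H₀ :=
    ⟨G.order.toNat, PowerSeries.divXPowOrder G, PowerSeries.constantCoeff_divXPowOrder_eq_zero_iff.not.2 hG0,
      PowerSeries.X_pow_order_mul_divXPowOrder.symm⟩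
  set c := PowerSeries.constantCoeff H₀
  set H := PowerSeries.C c⁻¹ * H₀ with hH
  have hHc : PowerSeries.constantCoeff H = 1 := by simp [hH, c, hH₀]
  have hι : invSub K 1 * (1 - PowerSeries.X) = PowerSeries.X := by simpa using invSub_spec K 1
  -- Removing the factor `X ^ n` from `G` costs `(1 - X) ^ n`, because the shift by `1` sends `X` to
  -- `X / (1 - X)`.
  have hHrel : lam * shift (1 : K) H = (1 - PowerSeries.X) ^ n * H := by
    rw [hGH, shift_mul, shift_pow, shift_X] at hG
    have h1 : PowerSeries.X ^ n * (lam * shift (1 : K) H₀) = PowerSeries.X ^ n * ((1 - PowerSeries.X) ^ n * H₀) := by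
      have h2 : (PowerSeries.X : K⟦X⟧) ^ n = invSub K 1 ^ n * (1 - PowerSeries.X) ^ n := by rw [← mul_pow, hι]
      calc PowerSeries.X ^ n * (lam * shift (1 : K) H₀)
          = (1 - PowerSeries.X) ^ n * (lam * (invSub K 1 ^ n * shift (1 : K) H₀)) := by rw [h2]; ring
        _ = _ := by rw [hG]; ring
    have h3 := mul_left_cancel₀ (pow_ne_zero n PowerSeries.X_ne_zero) h1
    rw [hH, shift_mul, shift_C]
    linear_combination PowerSeries.C c⁻¹ * h3
  -- With `M - n` factors, `L = Tp / U`, where `U = (1 - X) ^ (M - n) * shift 1 Tp`, is close to `λ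
  -- / (1 - X) ^ M`. For `M` a power of `p` the denominator is `1 - X ^ M`, so it is invisible to
  -- low order.
  obtain ⟨M, hM, k, hk⟩ : ∃ M, N + n + 2 ≤ M ∧ ∃ k, M = p ^ k :=
    ⟨p ^ (N + n + 2), (Nat.lt_pow_self hprime.one_lt).le, _, rfl⟩
  obtain ⟨S, hcard, hgen, hdvd⟩ := exists_generic_prod H hHc (M - n) (by omega)
  refine ⟨S, hgen, ?_⟩
  set Tp := ∏ y ∈ S, (1 - PowerSeries.C y * PowerSeries.X) with hTp
  set L := ∏ y ∈ S, (1 + invSub K (y + 1)) with hL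
  have e1 : L * ∏ y ∈ S, (1 - PowerSeries.C (y + 1) * PowerSeries.X) = Tp := by
    rw [hL, hTp, ← Finset.prod_mul_distrib]
    exact Finset.prod_congr rfl fun y _ => one_add_invSub_mul y
  have e2 : shift (1 : K) Tp * (1 - PowerSeries.X) ^ (M - n) =
      ∏ y ∈ S, (1 - PowerSeries.C (y + 1) * PowerSeries.X) := by
    rw [hTp, ← shiftHom_apply, map_prod, ← hcard, ← Finset.prod_const, ← Finset.prod_mul_distrib]
    refine Finset.prod_congr rfl fun y _ => ?_
    rw [shiftHom_apply, shift_sub, shift_one, shift_mul, shift_C, shift_X, map_add, map_one]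
    linear_combination -PowerSeries.C y * hι
  set U := ∏ y ∈ S, (1 - PowerSeries.C (y + 1) * PowerSeries.X) with hU
  have hUunit : IsUnit U := by
    rw [PowerSeries.isUnit_iff_constantCoeff, hU, map_prod]
    simp
  have d1 : (PowerSeries.X : K⟦X⟧) ^ (M - n - 1) ∣ lam * shift (1 : K) (H - Tp) :=
    (X_pow_dvd_shift 1 hdvd).mul_left _
  have d2 : (PowerSeries.X : K⟦X⟧) ^ (M - n - 1) ∣ (1 - PowerSeries.X) ^ n * (H - Tp) := hdvd.mul_left _
  have d3 : (PowerSeries.X : K⟦X⟧) ^ (M - n - 1) ∣ PowerSeries.X ^ M * Tp :=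
    (pow_dvd_pow _ (by omega)).mul_right _
  have hfrob : (1 - PowerSeries.X : K⟦X⟧) ^ (M - n) * (1 - PowerSeries.X) ^ n = 1 - PowerSeries.X ^ M := by
    have : CharP K⟦X⟧ p := charP_of_injective_ringHom (f := PowerSeries.C) PowerSeries.C_injective p
    rw [← pow_add, Nat.sub_add_cancel (by omega), hk, sub_pow_char_pow, one_pow]
  have d4 : (PowerSeries.X : K⟦X⟧) ^ (M - n - 1) ∣ (lam - L) * U := by
    -- The first two terms measure how far `Tp` is from `H`; the last is the error of the Frobenius
    -- identity `hfrob`.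
    have : (lam - L) * U = (1 - PowerSeries.X) ^ (M - n) *
        ((1 - PowerSeries.X) ^ n * (H - Tp) - lam * shift (1 : K) (H - Tp)) - PowerSeries.X ^ M * Tp := by
      rw [shift_sub]
      linear_combination (-lam) * e2 - e1 + (1 - PowerSeries.X) ^ (M - n) * hHrel + Tp * hfrob
    rw [this]
    exact ((d2.sub d1).mul_left _).sub d3
  rw [hUunit.dvd_mul_right, PowerSeries.X_pow_dvd_iff] at d4
  intro r hr
  have := d4 r (by omega)
  rw [map_sub, sub_eq_zero] at this
  exact this.symm

end Hilbert90

/-! ### Nilpotency, common kernels and common eigenvectors -/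

section LongProducts

variable {K : Type*} [Field K] {A : Type*} [Ring A] [Algebra K A]

/-- The span of the products of at least `n` of the elements `g 0, …, g l`. -/
def productSpan (K : Type*) [Field K] {A : Type*} [Ring A] [Algebra K A] (g : ℕ → A) (l n : ℕ) :
    Submodule K A :=
  Submodule.span K {x | ∃ L : List ℕ, n ≤ L.length ∧ (∀ r ∈ L, r ≤ l) ∧ (L.map g).prod = x}

theorem productSpan_mono (g : ℕ → A) (n : ℕ) {l l' : ℕ} (h : l ≤ l') :
    productSpan K g l n ≤ productSpan K g l' n := by
  refine Submodule.span_mono ?_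
  rintro x ⟨L, h1, h2, h3⟩
  exact ⟨L, h1, fun r hr => (h2 r hr).trans h, h3⟩

theorem mul_mem_productSpan {g : ℕ → A} {l m n : ℕ} {x y : A} (hx : x ∈ productSpan K g l m)
    (hy : y ∈ productSpan K g l n) : x * y ∈ productSpan K g l (m + n) := by
  have : productSpan K g l m * productSpan K g l n ≤ productSpan K g l (m + n) := by
    rw [productSpan, productSpan, Submodule.span_mul_span, Submodule.span_le]
    rintro _ ⟨_, ⟨L, h1, h2, rfl⟩, _, ⟨L', h1', h2', rfl⟩, rfl⟩
    refine Submodule.subset_span ⟨L ++ L', by simp; omega, fun r hr => ?_, by simp⟩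
    rcases List.mem_append.1 hr with hr | hr
    exacts [h2 r hr, h2' r hr]
  exact this (Submodule.mul_mem_mul hx hy)

theorem mem_productSpan_one {g : ℕ → A} {l r : ℕ} (hr : r ≤ l) : g r ∈ productSpan K g l 1 :=
  Submodule.subset_span ⟨[r], by simp, by simpa using hr, by simp⟩

theorem mul_mem_productSpan_one {g : ℕ → A} {l : ℕ} {x y : A} (hx : x ∈ productSpan K g l 1)
    (hy : y ∈ productSpan K g l 1) : x * y ∈ productSpan K g l 1 := by
  refine (Submodule.span_mono ?_) (mul_mem_productSpan hx hy)
  rintro _ ⟨L, h1, h2, h3⟩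
  exact ⟨L, by omega, h2, h3⟩

/-- Long products of `g 0, …, g l` vanish, for every `l`. -/
def LongProductsVanish (g : ℕ → A) : Prop :=
  ∀ l, ∃ n, ∀ L : List ℕ, (∀ r ∈ L, r ≤ l) → n ≤ L.length → (L.map g).prod = 0

theorem LongProductsVanish.isNilpotent {g : ℕ → A} (hg : LongProductsVanish g) {l : ℕ} {y : A}
    (hy : y ∈ productSpan K g l 1) : IsNilpotent y := by
  obtain ⟨n, hn⟩ := hg l
  have pow_mem : ∀ m, y ^ m ∈ productSpan K g l m := by
    intro m
    induction m with
    | zero => exact Submodule.subset_span ⟨[], by simp, by simp, by simp⟩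
    | succ m ih => rw [pow_succ]; exact mul_mem_productSpan ih hy
  have bot : productSpan K g l n = ⊥ := by
    rw [productSpan, Submodule.span_eq_bot]
    rintro _ ⟨L, h1, h2, rfl⟩
    exact hn L h2 h1
  exact ⟨n, by simpa [bot] using pow_mem n⟩

theorem HalfRel.longProductsVanish {a e : A⟦X⟧} (H : HalfRel a e) {p : ℕ}
    (hp : ∀ r, 0 < r → PowerSeries.coeff r e ^ p = 0) : LongProductsVanish fun r => PowerSeries.coeff r e := by
  intro l
  refine ⟨l * (p - 1) + 1, fun L hL hn => ?_⟩
  by_cases h0 : 0 ∈ L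
  · exact List.prod_eq_zero (List.mem_map.2 ⟨0, h0, H.const_e⟩)
  · exact H.list_prod_eq_zero hp l L (fun x hx => ⟨Nat.pos_of_ne_zero fun h => h0 (h ▸ hx), hL x hx⟩) hn

theorem LongProductsVanish.of_op {g : ℕ → A} (h : LongProductsVanish fun r => MulOpposite.op (g r)) :
    LongProductsVanish g := by
  intro l
  obtain ⟨n, hn⟩ := h l
  refine ⟨n, fun L hL hlen => ?_⟩
  have := hn L.reverse (by simpa using hL) (by simpa using hlen)
  rw [List.map_reverse] at this
  apply MulOpposite.op_injective
  rw [MulOpposite.op_list_prod, List.map_map, MulOpposite.op_zero]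
  exact this

variable {V : Type*} [AddCommGroup V] [Module K V] [Module A V] [IsScalarTower K A V]

/-- A family of operators with vanishing long products on a nonzero finite-dimensional space has
a common kernel. -/
theorem LongProductsVanish.exists_common_kernel [FiniteDimensional K V] [Nontrivial V] {g : ℕ → A}
    (hg : LongProductsVanish g) : ∃ x : V, x ≠ 0 ∧ ∀ r, g r • x = 0 := by
  set ρ := Algebra.lsmul K K V (A := A)
  -- There are infinitely many operators, and the bound on lengths depends on `l`; in finite
  -- dimension finitely many of them span the rest.
  obtain ⟨l, hl⟩ := monotone_stabilizes_iff_noetherian.2 (inferInstance : IsNoetherian K (Module.End K V))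
    ⟨fun l => Submodule.span K ((fun r => ρ (g r)) '' Set.Iic l), fun l l' h =>
      Submodule.span_mono (Set.image_mono (Set.Iic_subset_Iic.2 h))⟩
  have hspan : ∀ r, ρ (g r) ∈ Submodule.span K ((fun r => ρ (g r)) '' Set.Iic l) := by
    intro r
    rcases le_total r l with h | h
    · exact Submodule.subset_span ⟨r, h, rfl⟩
    · have := hl r h
      change Submodule.span K ((fun r => ρ (g r)) '' Set.Iic l) = Submodule.span K ((fun r => ρ (g r)) '' Set.Iic r) at this
      rw [this]
      exact Submodule.subset_span ⟨r, Set.mem_Iic.2 le_rfl, rfl⟩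
  obtain ⟨n, hn⟩ := hg l
  -- If `x` is not yet in the common kernel, replace it by some `g r • x ≠ 0`; this shortens the
  -- products that are known to kill the vector.
  have key : ∀ n, ∀ x : V, x ≠ 0 → (∀ L : List ℕ, (∀ r ∈ L, r ≤ l) → n ≤ L.length → (L.map g).prod • x = 0) →
      ∃ x : V, x ≠ 0 ∧ ∀ r ≤ l, g r • x = 0 := by
    intro n
    induction n with
    | zero =>
      intro x hx h
      exact absurd (by simpa using h [] (by simp) (by simp)) hx
    | succ n ih =>
      intro x hx h
      by_cases hall : ∀ r ≤ l, g r • x = 0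
      · exact ⟨x, hx, hall⟩
      · push Not at hall
        obtain ⟨r, hr, hne⟩ := hall
        refine ih _ hne fun L hL hlen => ?_
        have := h (L ++ [r]) (fun s hs => ?_) (by simpa using hlen)
        · simpa [mul_smul] using this
        · rcases List.mem_append.1 hs with hs | hs
          · exact hL s hs
          · rw [List.mem_singleton.1 hs]; exact hr
  obtain ⟨x₀, hx₀⟩ := exists_ne (0 : V)
  obtain ⟨x, hx, hker⟩ := key n x₀ hx₀ fun L h1 h2 => by rw [hn L h1 h2, zero_smul]
  refine ⟨x, hx, fun r => ?_⟩
  have : Submodule.span K ((fun r => ρ (g r)) '' Set.Iic l) ≤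
      LinearMap.ker (LinearMap.applyₗ (R := K) (M₂ := V) x) := by
    rw [Submodule.span_le]
    rintro _ ⟨s, hs, rfl⟩
    exact hker s hs
  exact this (hspan r)

/-- Commuting operators on a nonzero finite-dimensional subspace have a common eigenvector. -/
theorem exists_common_eigenvector [IsAlgClosed K] [FiniteDimensional K V] {ι : Type*} (g : ι → A)
    (U : Submodule K V) (hU : U ≠ ⊥) (hstable : ∀ i, ∀ x ∈ U, g i • x ∈ U)
    (hcomm : ∀ i j, ∀ x ∈ U, g i • g j • x = g j • g i • x) :
    ∃ x ∈ U, x ≠ 0 ∧ ∀ i, ∃ c : K, g i • x = c • x := by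
  induction hn : Module.finrank K U using Nat.strong_induction_on generalizing U with
  | _ n ih =>
  by_cases hscal : ∀ i, ∃ c : K, ∀ x ∈ U, g i • x = c • x
  · obtain ⟨x, hx, hx0⟩ := U.ne_bot_iff.1 hU
    exact ⟨x, hx, hx0, fun i => (hscal i).imp fun c hc => hc x hx⟩
  push Not at hscal
  obtain ⟨i, hi⟩ := hscal
  have : Nontrivial U := U.nontrivial_iff_ne_bot.2 hU
  obtain ⟨c, hc⟩ := Module.End.exists_eigenvalue (((Algebra.lsmul K K V (g i)).restrict (hstable i) : Module.End K U))
  obtain ⟨u, hu⟩ := hc.exists_hasEigenvector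
  -- If some `g i` is not a scalar on `U`, its eigenspace in `U` is nonzero, smaller, and stable
  -- under the other operators.
  let U' : Submodule K V := U ⊓ LinearMap.ker (Algebra.lsmul K K V (g i) - c • LinearMap.id)
  have mem_U' : ∀ x, x ∈ U' ↔ x ∈ U ∧ g i • x = c • x := fun x => by
    rw [Submodule.mem_inf, LinearMap.mem_ker, LinearMap.sub_apply, sub_eq_zero]
    rfl
  obtain ⟨y, hy, hyne⟩ := hi c
  have hlt : U' < U := lt_of_le_of_ne inf_le_left fun h => hyne ((mem_U' y).1 (h ▸ hy)).2
  have hU' : U' ≠ ⊥ := U'.ne_bot_iff.2 ⟨u, (mem_U' _).2 ⟨u.2, congrArg Subtype.val hu.apply_eq_smul⟩,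
    fun h => hu.2 (Subtype.ext h)⟩
  have hstable' : ∀ j, ∀ x ∈ U', g j • x ∈ U' := by
    intro j x hx
    rw [mem_U'] at hx ⊢
    exact ⟨hstable j x hx.1, by rw [hcomm i j x hx.1, hx.2, smul_comm]⟩
  obtain ⟨x, hx, hx0, hxe⟩ := ih _ (hn ▸ Submodule.finrank_lt_finrank_of_lt hlt) U' hU' hstable'
    (fun j k x hx => hcomm j k x (hlt.le hx)) rfl
  exact ⟨x, hlt.le hx, hx0, hxe⟩

end LongProducts

/-! ### Subspaces generated by a set of operators -/

section Orbit

variable {K : Type*} [Field K] {A : Type*} [Ring A] {V : Type*} [AddCommGroup V] [Module K V] [Module A V]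

/-- The smallest subspace containing `v` and stable under `s`. -/
def orbitSpan (K : Type*) [Field K] {A : Type*} [Ring A] {V : Type*} [AddCommGroup V] [Module K V]
    [Module A V] (s : Set A) (v : V) : Submodule K V :=
  sInf {N | v ∈ N ∧ ∀ a ∈ s, ∀ x ∈ N, a • x ∈ N}

theorem self_mem_orbitSpan (s : Set A) (v : V) : v ∈ orbitSpan K s v :=
  Submodule.mem_sInf.2 fun _ hN => hN.1

theorem smul_mem_orbitSpan {s : Set A} {v : V} {a : A} (ha : a ∈ s) {x : V} (hx : x ∈ orbitSpan K s v) :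
    a • x ∈ orbitSpan K s v :=
  Submodule.mem_sInf.2 fun N hN => hN.2 a ha x (Submodule.mem_sInf.1 hx N hN)

theorem orbitSpan_le {s : Set A} {v : V} {N : Submodule K V} (hv : v ∈ N)
    (hN : ∀ a ∈ s, ∀ x ∈ N, a • x ∈ N) : orbitSpan K s v ≤ N := sInf_le ⟨hv, hN⟩

variable [Algebra K A] [IsScalarTower K A V]

/-- The vectors of `N` that all elements of `s` map into `N`. -/
def stablePart (s : Set A) (N : Submodule K V) : Submodule K V where
  carrier := {x | x ∈ N ∧ ∀ a ∈ s, a • x ∈ N}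
  add_mem' hx hy := ⟨N.add_mem hx.1 hy.1, fun a ha => by
    rw [smul_add]; exact N.add_mem (hx.2 a ha) (hy.2 a ha)⟩
  zero_mem' := ⟨N.zero_mem, fun a _ => by rw [smul_zero]; exact N.zero_mem⟩
  smul_mem' c x hx := ⟨N.smul_mem c hx.1, fun a ha => by
    rw [smul_comm]; exact N.smul_mem c (hx.2 a ha)⟩

/-- To show that the orbit is stable under `u`, it suffices to treat `v` and to pass from `x` to `b
• x` for `b ∈ s`: the vectors of the orbit sent into it by `u` form a subspace. -/
theorem smul_mem_orbitSpan_of_stable {s u : Set A} {v : V} (hv : ∀ a ∈ u, a • v ∈ orbitSpan K s v)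
    (h : ∀ b ∈ s, ∀ x ∈ orbitSpan K s v, (∀ a ∈ u, a • x ∈ orbitSpan K s v) → ∀ a ∈ u, a • b • x ∈ orbitSpan K s v)
    {a : A} (ha : a ∈ u) {x : V} (hx : x ∈ orbitSpan K s v) : a • x ∈ orbitSpan K s v := by
  have : orbitSpan K s v ≤ stablePart u (orbitSpan K s v) :=
    orbitSpan_le ⟨self_mem_orbitSpan s v, hv⟩ fun b hb x hx => ⟨smul_mem_orbitSpan hb hx.1, h b hb x hx.1 hx.2⟩
  exact (this hx).2 a ha

theorem orbitSpan_eq_top {s : Set A} (hs : Algebra.adjoin K s = ⊤) {v : V} (hv : Submodule.span A {v} = ⊤) :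
    orbitSpan K s v = ⊤ := by
  have stable : ∀ a : A, ∀ x ∈ orbitSpan K s v, a • x ∈ orbitSpan K s v := by
    intro a
    have ha : a ∈ Algebra.adjoin K s := hs ▸ Algebra.mem_top
    induction ha using Algebra.adjoin_induction with
    | mem a ha => exact fun x hx => smul_mem_orbitSpan ha hx
    | algebraMap c => exact fun x hx => by rw [algebraMap_smul]; exact Submodule.smul_mem _ c hx
    | add a b _ _ iha ihb => exact fun x hx => by rw [add_smul]; exact Submodule.add_mem _ (iha x hx) (ihb x hx)
    | mul a b _ _ iha ihb => exact fun x hx => by rw [mul_smul]; exact iha _ (ihb x hx)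
  rw [eq_top_iff]
  intro x _
  obtain ⟨a, rfl⟩ := Submodule.mem_span_singleton.1 (hv ▸ Submodule.mem_top : x ∈ Submodule.span A {v})
  exact stable a v (self_mem_orbitSpan s v)

end Orbit

/-! ### Highest weight modules -/

section Triangular

/-- An algebra generated by a solution of the RTT relations in which the Drinfeld generators
`e⁽ʳ⁾` and `f⁽ʳ⁾` have vanishing `p`-th powers. -/
structure RestrictedRTT (K : Type*) [Field K] {A : Type*} [Ring A] [Algebra K A] (p : ℕ)
    (T : Fin 2 → Fin 2 → A⟦X⟧) (ai : A⟦X⟧) : Prop where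
  rtt : IsRTT T
  mul_inv : T 0 0 * ai = 1
  inv_mul : ai * T 0 0 = 1
  pow_e : ∀ r, 0 < r → PowerSeries.coeff r (ai * T 0 1) ^ p = 0
  pow_f : ∀ r, 0 < r → PowerSeries.coeff r (T 1 0 * ai) ^ p = 0
  gen : Algebra.adjoin K {x | ∃ i j r, x = PowerSeries.coeff r (T i j)} = ⊤

variable {K : Type*} [Field K] {A : Type*} [Ring A] [Algebra K A] {p : ℕ}
  {T : Fin 2 → Fin 2 → A⟦X⟧} {ai : A⟦X⟧}
  {V : Type*} [AddCommGroup V] [Module K V] [Module A V] [IsScalarTower K A V]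

theorem RestrictedRTT.long_e (H : RestrictedRTT K p T ai) :
    LongProductsVanish fun r => PowerSeries.coeff r (ai * T 0 1) :=
  (H.rtt.halfRel H.mul_inv H.inv_mul).longProductsVanish H.pow_e

theorem RestrictedRTT.long_f (H : RestrictedRTT K p T ai) :
    LongProductsVanish fun r => PowerSeries.coeff r (T 1 0 * ai) := by
  have := (H.rtt.halfRel_op H.mul_inv H.inv_mul).longProductsVanish (p := p) fun r hr => by
    rw [coeff_opSeries, ← MulOpposite.op_pow, H.pow_f r hr, MulOpposite.op_zero]
  simp only [coeff_opSeries] at this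
  exact this.of_op

/-- The commutator `[t_{i,j}⁽ʳ⁾, t_{k,l}⁽ˢ⁾]`, applied to a vector. -/
theorem IsRTT.smul_smul (H : IsRTT T) (i j k l : Fin 2) (r s : ℕ) (x : V) :
    PowerSeries.coeff r (T i j) • PowerSeries.coeff s (T k l) • x =
      PowerSeries.coeff s (T k l) • PowerSeries.coeff r (T i j) • x +
        ∑ t ∈ Finset.range r,
          (PowerSeries.coeff t (T k j) • PowerSeries.coeff (r + s - 1 - t) (T i l) • x -
            PowerSeries.coeff (r + s - 1 - t) (T k j) • PowerSeries.coeff t (T i l) • x) := by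
  have := congrArg (· • x) (H.commutator i j k l r s)
  simp only [sub_smul, mul_smul, Finset.sum_smul] at this
  rw [← this, add_sub_cancel]

theorem IsRTT.smul_smul' (H : IsRTT T) (i j k l : Fin 2) (r s : ℕ) (x : V) :
    PowerSeries.coeff s (T k l) • PowerSeries.coeff r (T i j) • x =
      PowerSeries.coeff r (T i j) • PowerSeries.coeff s (T k l) • x -
        ∑ t ∈ Finset.range r,
          (PowerSeries.coeff t (T k j) • PowerSeries.coeff (r + s - 1 - t) (T i l) • x -
            PowerSeries.coeff (r + s - 1 - t) (T k j) • PowerSeries.coeff t (T i l) • x) :=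
  eq_sub_of_add_eq (H.smul_smul i j k l r s x).symm

/-- A vector annihilated by `t_{1,2}(u)` on which `t_{1,1}(u)` and `t_{2,2}(u)` act by scalars. -/
structure IsHighestWeight (T : Fin 2 → Fin 2 → A⟦X⟧) (lam : Fin 2 → K⟦X⟧) (v : V) : Prop where
  t01 : ∀ r, PowerSeries.coeff r (T 0 1) • v = 0
  diag : ∀ i r, PowerSeries.coeff r (T i i) • v = PowerSeries.coeff r (lam i) • v

/-- The set of coefficients of a series. -/
def coeffSet (g : A⟦X⟧) : Set A := Set.range fun r => PowerSeries.coeff r g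

/-- The space `∑ t_{2,1}⁽ʳ⁾ V`. -/
def lowerPart (K : Type*) [Field K] {A : Type*} [Ring A] (T : Fin 2 → Fin 2 → A⟦X⟧)
    (V : Type*) [AddCommGroup V] [Module K V] [Module A V] : Submodule K V :=
  Submodule.span K {x | ∃ (r : ℕ) (y : V), x = PowerSeries.coeff r (T 1 0) • y}

omit [Algebra K A] [IsScalarTower K A V] in
theorem smul_mem_lowerPart (r : ℕ) (y : V) : PowerSeries.coeff r (T 1 0) • y ∈ lowerPart K T V :=
  Submodule.subset_span ⟨r, y, rfl⟩

omit [Algebra K A] [IsScalarTower K A V] in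
theorem RestrictedRTT.f_smul_mem_lowerPart (r : ℕ) (y : V) :
    PowerSeries.coeff r (T 1 0 * ai) • y ∈ lowerPart K T V := by
  rw [PowerSeries.coeff_mul, Finset.sum_smul]
  refine Submodule.sum_mem _ fun x _ => ?_
  rw [mul_smul]
  exact smul_mem_lowerPart _ _

/-- Each term in the commutator of `t_{i,i}` with `t_{2,1}`, taken in the right order, has a factor
`t_{2,1}` on the left. The space is stable under the diagonal generators though not, in general, a
submodule. -/
theorem IsRTT.diag_smul_mem_lowerPart (H : IsRTT T) (i : Fin 2) (r : ℕ) {x : V} (hx : x ∈ lowerPart K T V) :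
    PowerSeries.coeff r (T i i) • x ∈ lowerPart K T V := by
  have : lowerPart K T V ≤ stablePart (coeffSet (T i i)) (lowerPart K T V) := by
    refine Submodule.span_le.2 ?_
    rintro _ ⟨s, y, rfl⟩
    refine ⟨smul_mem_lowerPart _ _, ?_⟩
    rintro _ ⟨r, rfl⟩
    fin_cases i
    · change PowerSeries.coeff r (T 0 0) • _ ∈ _
      rw [H.smul_smul]
      exact Submodule.add_mem _ (smul_mem_lowerPart _ _)
        (Submodule.sum_mem _ fun t _ => Submodule.sub_mem _ (smul_mem_lowerPart _ _) (smul_mem_lowerPart _ _))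
    · change PowerSeries.coeff r (T 1 1) • _ ∈ _
      rw [H.smul_smul']
      exact Submodule.sub_mem _ (smul_mem_lowerPart _ _)
        (Submodule.sum_mem _ fun t _ => Submodule.sub_mem _ (smul_mem_lowerPart _ _) (smul_mem_lowerPart _ _))
  exact (this hx).2 _ ⟨r, rfl⟩

variable {lam : Fin 2 → K⟦X⟧} {v : V}

/-- A cyclic highest weight module is spanned by the images of `v` under products of `t_{2,1}⁽ʳ⁾`. -/
theorem RestrictedRTT.orbitSpan_t_eq_top (H : RestrictedRTT K p T ai) (hv : IsHighestWeight T lam v)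
    (hgen : Submodule.span A {v} = ⊤) : orbitSpan K (coeffSet (T 1 0)) v = ⊤ := by
  set C := orbitSpan K (coeffSet (T 1 0)) v
  have c10 : ∀ r, ∀ x ∈ C, PowerSeries.coeff r (T 1 0) • x ∈ C := fun r x hx =>
    smul_mem_orbitSpan (s := coeffSet (T 1 0)) (Set.mem_range_self r) hx
  have c00 : ∀ r, ∀ x ∈ C, PowerSeries.coeff r (T 0 0) • x ∈ C := by
    intro r x hx
    refine smul_mem_orbitSpan_of_stable (u := coeffSet (T 0 0)) ?_ ?_ ⟨r, rfl⟩ hx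
    · rintro _ ⟨r, rfl⟩
      simp only [hv.diag]
      exact Submodule.smul_mem _ _ (self_mem_orbitSpan _ _)
    · rintro _ ⟨s, rfl⟩ x hx h _ ⟨r, rfl⟩
      have h' : ∀ r, PowerSeries.coeff r (T 0 0) • x ∈ C := fun r => h _ ⟨r, rfl⟩
      change PowerSeries.coeff r (T 0 0) • PowerSeries.coeff s (T 1 0) • x ∈ C
      rw [H.rtt.smul_smul]
      exact Submodule.add_mem _ (c10 _ _ (h' _))
        (Submodule.sum_mem _ fun t _ => Submodule.sub_mem _ (c10 _ _ (h' _)) (c10 _ _ (h' _)))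
  have c11 : ∀ r, ∀ x ∈ C, PowerSeries.coeff r (T 1 1) • x ∈ C := by
    intro r x hx
    refine smul_mem_orbitSpan_of_stable (u := coeffSet (T 1 1)) ?_ ?_ ⟨r, rfl⟩ hx
    · rintro _ ⟨r, rfl⟩
      simp only [hv.diag]
      exact Submodule.smul_mem _ _ (self_mem_orbitSpan _ _)
    · rintro _ ⟨s, rfl⟩ x hx h _ ⟨r, rfl⟩
      have h' : ∀ r, PowerSeries.coeff r (T 1 1) • x ∈ C := fun r => h _ ⟨r, rfl⟩
      change PowerSeries.coeff r (T 1 1) • PowerSeries.coeff s (T 1 0) • x ∈ C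
      rw [H.rtt.smul_smul']
      exact Submodule.sub_mem _ (c10 _ _ (h' _))
        (Submodule.sum_mem _ fun t _ => Submodule.sub_mem _ (c10 _ _ (h' _)) (c10 _ _ (h' _)))
  -- This comes last: the commutator of `t_{1,2}` with `t_{2,1}` is expressed through `t_{2,2}
  -- t_{1,1}`, so stability under the diagonal generators is needed.
  have c01 : ∀ r, ∀ x ∈ C, PowerSeries.coeff r (T 0 1) • x ∈ C := by
    intro r x hx
    refine smul_mem_orbitSpan_of_stable (u := coeffSet (T 0 1)) ?_ ?_ ⟨r, rfl⟩ hx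
    · rintro _ ⟨r, rfl⟩
      simp only [hv.t01]
      exact Submodule.zero_mem _
    · rintro _ ⟨s, rfl⟩ x hx h _ ⟨r, rfl⟩
      change PowerSeries.coeff r (T 0 1) • PowerSeries.coeff s (T 1 0) • x ∈ C
      rw [H.rtt.smul_smul]
      exact Submodule.add_mem _ (c10 _ _ (h _ ⟨r, rfl⟩))
        (Submodule.sum_mem _ fun t _ => Submodule.sub_mem _ (c11 _ _ (c00 _ _ hx)) (c11 _ _ (c00 _ _ hx)))
  rw [eq_top_iff, ← orbitSpan_eq_top H.gen hgen]
  refine orbitSpan_le (self_mem_orbitSpan _ _) ?_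
  rintro _ ⟨i, j, r, rfl⟩ x hx
  fin_cases i <;> fin_cases j
  exacts [c00 r x hx, c01 r x hx, c10 r x hx, c11 r x hx]

/-- A cyclic highest weight module is spanned by the images of `v` under products of `f⁽ʳ⁾`. -/
theorem RestrictedRTT.orbitSpan_f_eq_top (H : RestrictedRTT K p T ai) (hv : IsHighestWeight T lam v)
    (hgen : Submodule.span A {v} = ⊤) : orbitSpan K (coeffSet (T 1 0 * ai)) v = ⊤ := by
  set W := orbitSpan K (coeffSet (T 1 0 * ai)) v
  have wf : ∀ r, ∀ x ∈ W, PowerSeries.coeff r (T 1 0 * ai) • x ∈ W := fun r x hx =>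
    smul_mem_orbitSpan (s := coeffSet (T 1 0 * ai)) (Set.mem_range_self r) hx
  have hop := H.rtt.halfRel_op H.mul_inv H.inv_mul
  have f0 : PowerSeries.coeff 0 (T 1 0 * ai) = 0 := by
    have := hop.const_e
    rw [coeff_opSeries] at this
    exact MulOpposite.op_injective this
  have af : ∀ r s, 0 < s → ∀ x : V,
      PowerSeries.coeff (r + 1) (T 0 0) • PowerSeries.coeff s (T 1 0 * ai) • x =
        PowerSeries.coeff s (T 1 0 * ai) • PowerSeries.coeff (r + 1) (T 0 0) • x -
          PowerSeries.coeff (s + 1) (T 1 0 * ai) • PowerSeries.coeff r (T 0 0) • x +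
          PowerSeries.coeff r (T 0 0) • PowerSeries.coeff (s + 1) (T 1 0 * ai) • x -
          PowerSeries.coeff s (T 1 0 * ai) • PowerSeries.coeff r (T 0 0) • x := by
    intro r s hs x
    have := hop.a_e r s hs
    simp only [coeff_opSeries, ← MulOpposite.op_mul, ← MulOpposite.op_sub] at this
    have := congrArg (· • x) (MulOpposite.op_injective this)
    simp only [sub_smul, mul_smul] at this
    rw [← this]
    abel
  have wa : ∀ r, ∀ x ∈ W, PowerSeries.coeff r (T 0 0) • x ∈ W := by
    intro r x hx
    refine smul_mem_orbitSpan_of_stable (u := coeffSet (T 0 0)) ?_ ?_ ⟨r, rfl⟩ hx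
    · rintro _ ⟨r, rfl⟩
      simp only [hv.diag]
      exact Submodule.smul_mem _ _ (self_mem_orbitSpan _ _)
    · rintro _ ⟨s, rfl⟩ x hx h _ ⟨r, rfl⟩
      have h' : ∀ r, PowerSeries.coeff r (T 0 0) • x ∈ W := fun r => h _ ⟨r, rfl⟩
      change PowerSeries.coeff r (T 0 0) • PowerSeries.coeff s (T 1 0 * ai) • x ∈ W
      -- The relation `af` replaces `a⁽ʳ⁺¹⁾ f⁽ˢ⁾` by `a⁽ʳ⁾ f⁽ˢ⁺¹⁾` and terms with `f` on the left,
      -- so `s` must vary in the induction.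
      induction r generalizing s with
      | zero =>
        rw [H.rtt.const, if_pos rfl, one_smul]
        exact wf s x hx
      | succ r ih =>
        rcases Nat.eq_zero_or_pos s with rfl | hs
        · rw [f0, zero_smul, smul_zero]
          exact Submodule.zero_mem _
        rw [af r s hs]
        exact Submodule.sub_mem _ (Submodule.add_mem _ (Submodule.sub_mem _ (wf _ _ (h' _)) (wf _ _ (h' _)))
          (ih _)) (wf _ _ (h' _))
  rw [eq_top_iff, ← H.orbitSpan_t_eq_top hv hgen]
  refine orbitSpan_le (self_mem_orbitSpan _ _) ?_
  rintro _ ⟨r, rfl⟩ x hx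
  have : T 1 0 = T 1 0 * ai * T 0 0 := by rw [mul_assoc, H.inv_mul, mul_one]
  change PowerSeries.coeff r (T 1 0) • x ∈ W
  rw [this, PowerSeries.coeff_mul, Finset.sum_smul]
  refine Submodule.sum_mem _ fun y _ => ?_
  rw [mul_smul]
  exact wf _ _ (wa _ _ hx)

/-- The scalar part is separated from the products of at least one `f⁽ʳ⁾` because the latter, and
their combinations, are nilpotent. -/
theorem RestrictedRTT.exists_eq_smul_add (H : RestrictedRTT K p T ai) (hv : IsHighestWeight T lam v)
    (hgen : Submodule.span A {v} = ⊤) (x : V) : ∃ (c : K) (l : ℕ),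
      ∃ y ∈ productSpan K (fun r => PowerSeries.coeff r (T 1 0 * ai)) l 1, x = c • v + y • v := by
  set g : ℕ → A := fun r => PowerSeries.coeff r (T 1 0 * ai) with hg
  let N : Submodule K V :=
    { carrier := {x | ∃ (c : K) (l : ℕ), ∃ y ∈ productSpan K g l 1, x = c • v + y • v}
      add_mem' := by
        rintro _ _ ⟨c, l, y, hy, rfl⟩ ⟨c', l', y', hy', rfl⟩
        refine ⟨c + c', max l l', y + y', Submodule.add_mem _ (productSpan_mono g 1 (le_max_left _ _) hy)
          (productSpan_mono g 1 (le_max_right _ _) hy'), ?_⟩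
        rw [add_smul, add_smul]
        abel
      zero_mem' := ⟨0, 0, 0, Submodule.zero_mem _, by simp⟩
      smul_mem' := by
        rintro a _ ⟨c, l, y, hy, rfl⟩
        exact ⟨a * c, l, a • y, Submodule.smul_mem _ _ hy, by rw [smul_add, mul_smul, smul_assoc]⟩ }
  have : orbitSpan K (coeffSet (T 1 0 * ai)) v ≤ N := by
    refine orbitSpan_le ⟨1, 0, 0, Submodule.zero_mem _, by simp⟩ ?_
    rintro _ ⟨r, rfl⟩ _ ⟨c, l, y, hy, rfl⟩
    have hr : g r ∈ productSpan K g (max l r) 1 := mem_productSpan_one (le_max_right _ _)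
    refine ⟨0, max l r, c • g r + g r * y, Submodule.add_mem _ (Submodule.smul_mem _ _ hr)
      (mul_mem_productSpan_one hr (productSpan_mono g 1 (le_max_left _ _) hy)), ?_⟩
    rw [zero_smul, zero_add, add_smul, mul_smul, smul_assoc, smul_add, smul_comm]
  rw [H.orbitSpan_f_eq_top hv hgen] at this
  exact this Submodule.mem_top

theorem RestrictedRTT.productSpan_smul_mem {l : ℕ} {y : A}
    (hy : y ∈ productSpan K (fun r => PowerSeries.coeff r (T 1 0 * ai)) l 1) (x : V) :
    y • x ∈ lowerPart K T V := by
  induction hy using Submodule.span_induction with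
  | mem y hy =>
    obtain ⟨L, h1, -, rfl⟩ := hy
    obtain ⟨r, L, rfl⟩ := List.exists_cons_of_length_pos (l := L) h1
    rw [List.map_cons, List.prod_cons, mul_smul]
    exact f_smul_mem_lowerPart _ _
  | zero => rw [zero_smul]; exact Submodule.zero_mem _
  | add y z _ _ hy hz => rw [add_smul]; exact Submodule.add_mem _ hy hz
  | smul c y _ hy => rw [smul_assoc]; exact Submodule.smul_mem _ c hy

theorem RestrictedRTT.exists_eq_of_mem_lowerPart (H : RestrictedRTT K p T ai) (hv : IsHighestWeight T lam v)
    (hgen : Submodule.span A {v} = ⊤) {x : V} (hx : x ∈ lowerPart K T V) : ∃ l : ℕ,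
      ∃ y ∈ productSpan K (fun r => PowerSeries.coeff r (T 1 0 * ai)) l 1, x = y • v := by
  set g : ℕ → A := fun r => PowerSeries.coeff r (T 1 0 * ai) with hg
  let N : Submodule K V :=
    { carrier := {x | ∃ l : ℕ, ∃ y ∈ productSpan K g l 1, x = y • v}
      add_mem' := by
        rintro _ _ ⟨l, y, hy, rfl⟩ ⟨l', y', hy', rfl⟩
        exact ⟨max l l', y + y', Submodule.add_mem _ (productSpan_mono g 1 (le_max_left _ _) hy)
          (productSpan_mono g 1 (le_max_right _ _) hy'), (add_smul _ _ _).symm⟩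
      zero_mem' := ⟨0, 0, Submodule.zero_mem _, (zero_smul _ _).symm⟩
      smul_mem' := by
        rintro a _ ⟨l, y, hy, rfl⟩
        exact ⟨l, a • y, Submodule.smul_mem _ _ hy, (smul_assoc _ _ _).symm⟩ }
  have hf : ∀ r x, PowerSeries.coeff r (T 1 0 * ai) • x ∈ N := by
    intro r x
    obtain ⟨c, l, y, hy, rfl⟩ := H.exists_eq_smul_add hv hgen x
    have hr : g r ∈ productSpan K g (max l r) 1 := mem_productSpan_one (le_max_right _ _)
    refine ⟨max l r, c • g r + g r * y, Submodule.add_mem _ (Submodule.smul_mem _ _ hr)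
      (mul_mem_productSpan_one hr (productSpan_mono g 1 (le_max_left _ _) hy)), ?_⟩
    rw [add_smul, mul_smul, smul_assoc, smul_add, smul_comm]
  have : lowerPart K T V ≤ N := by
    refine Submodule.span_le.2 ?_
    rintro _ ⟨r, y, rfl⟩
    have : T 1 0 = T 1 0 * ai * T 0 0 := by rw [mul_assoc, H.inv_mul, mul_one]
    rw [this, PowerSeries.coeff_mul, Finset.sum_smul]
    refine Submodule.sum_mem _ fun z _ => ?_
    rw [mul_smul]
    exact hf _ _
  exact this hx

/-- Otherwise `v = y • v` with `y` nilpotent, and iterating gives `v = 0`. -/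
theorem RestrictedRTT.notMem_lowerPart (H : RestrictedRTT K p T ai) (hv : IsHighestWeight T lam v)
    (hgen : Submodule.span A {v} = ⊤) (hv0 : v ≠ 0) : v ∉ lowerPart K T V := by
  intro h
  obtain ⟨l, y, hy, hyv⟩ := H.exists_eq_of_mem_lowerPart hv hgen h
  obtain ⟨n, hn⟩ := H.long_f.isNilpotent hy
  have : ∀ n, y ^ n • v = v := by
    intro n
    induction n with
    | zero => rw [pow_zero, one_smul]
    | succ n ih => rw [pow_succ, mul_smul, ← hyv, ih]
  refine hv0 ?_
  rw [← this n, hn, zero_smul]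

/-- In a cyclic highest weight module, every vector outside of `∑ t_{2,1}⁽ʳ⁾ V` generates. -/
theorem RestrictedRTT.span_eq_top (H : RestrictedRTT K p T ai) (hv : IsHighestWeight T lam v)
    (hgen : Submodule.span A {v} = ⊤) {x : V} (hx : x ∉ lowerPart K T V) : Submodule.span A {x} = ⊤ := by
  obtain ⟨c, l, y, hy, rfl⟩ := H.exists_eq_smul_add hv hgen x
  have hc : c ≠ 0 := by
    rintro rfl
    rw [zero_smul, zero_add] at hx
    exact hx (productSpan_smul_mem hy v)
  -- A nonzero scalar plus a nilpotent element is invertible, so `v` is recovered from `c • v + y •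
  -- v`.
  have hu : IsUnit (algebraMap K A c + y) :=
    (H.long_f.isNilpotent hy).isUnit_add_left_of_commute ((IsUnit.mk0 c hc).map _) (Algebra.commute_algebraMap_right c y)
  obtain ⟨u, hu⟩ := hu
  rw [eq_top_iff, ← hgen, Submodule.span_singleton_le_iff_mem, Submodule.mem_span_singleton]
  refine ⟨((u⁻¹ : Aˣ) : A), ?_⟩
  have : c • v + y • v = (u : A) • v := by rw [hu, add_smul, algebraMap_smul]
  rw [this, ← mul_smul, Units.inv_mul, one_smul]

/-- The highest weight of a cyclic highest weight module is unique. -/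
theorem RestrictedRTT.highestWeight_unique (H : RestrictedRTT K p T ai) (hv : IsHighestWeight T lam v)
    (hgen : Submodule.span A {v} = ⊤) {mu : Fin 2 → K⟦X⟧} {w : V} (hw : IsHighestWeight T mu w)
    (hgen' : Submodule.span A {w} = ⊤) (hw0 : w ≠ 0) : lam = mu := by
  have hwR := H.notMem_lowerPart hw hgen' hw0
  obtain ⟨c, l, y, hy, rfl⟩ := H.exists_eq_smul_add hv hgen w
  have hyR : y • v ∈ lowerPart K T V := productSpan_smul_mem hy v
  funext i
  ext r
  by_contra hne
  refine hwR (Submodule.add_mem _ ?_ hyR)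
  have h1 := hw.diag i r
  rw [smul_add, smul_add, smul_comm _ c v, hv.diag] at h1
  -- Comparing the two weights on `w = c v + y v`: the right side lies in the lower part, so
  -- different weights would put `c v`, hence `w`, there.
  have h2 : (PowerSeries.coeff r (lam i) - PowerSeries.coeff r (mu i)) • c • v =
      PowerSeries.coeff r (mu i) • y • v - PowerSeries.coeff r (T i i) • y • v := by
    rw [sub_smul, sub_eq_sub_iff_add_eq_add, smul_comm _ c v, h1, add_comm]
  have h3 := Submodule.sub_mem _ (Submodule.smul_mem _ (PowerSeries.coeff r (mu i)) hyR)
    (H.rtt.diag_smul_mem_lowerPart i r hyR)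
  rw [← h2] at h3
  exact ((lowerPart K T V).smul_mem_iff (sub_ne_zero.2 hne)).1 h3

/-- Every finite-dimensional nonzero module contains a highest weight vector. -/
theorem RestrictedRTT.exists_isHighestWeight [IsAlgClosed K] [FiniteDimensional K V] [Nontrivial V]
    (H : RestrictedRTT K p T ai) : ∃ (lam : Fin 2 → K⟦X⟧) (v : V), v ≠ 0 ∧ IsHighestWeight T lam v := by
  -- The common kernel of the `t_{1,2}⁽ʳ⁾`. On it the correction terms in the commutators of
  -- diagonal generators vanish, since each of them ends with some `t_{1,2}`.
  let U : Submodule K V :=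
    { carrier := {x | ∀ r, PowerSeries.coeff r (T 0 1) • x = 0}
      add_mem' := fun hx hy r => by rw [smul_add, hx r, hy r, add_zero]
      zero_mem' := fun r => smul_zero _
      smul_mem' := fun c x hx r => by rw [smul_comm, hx r, smul_zero] }
  have hU : U ≠ ⊥ := by
    obtain ⟨x, hx, hker⟩ := H.long_e.exists_common_kernel (K := K) (V := V)
    refine U.ne_bot_iff.2 ⟨x, fun r => ?_, hx⟩
    have : T 0 1 = T 0 0 * (ai * T 0 1) := by rw [← mul_assoc, H.mul_inv, one_mul]
    rw [this, PowerSeries.coeff_mul, Finset.sum_smul]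
    exact Finset.sum_eq_zero fun y _ => by rw [mul_smul, hker, smul_zero]
  have kill : ∀ x ∈ U, ∀ r, PowerSeries.coeff r (T 0 1) • x = 0 := fun x hx => hx
  have stable : ∀ i : Fin 2 × ℕ, ∀ x ∈ U, PowerSeries.coeff i.2 (T i.1 i.1) • x ∈ U := by
    rintro ⟨i, r⟩ x hx s
    fin_cases i
    · change PowerSeries.coeff s (T 0 1) • PowerSeries.coeff r (T 0 0) • x = 0
      simp [H.rtt.smul_smul' 0 0 0 1, kill x hx]
    · change PowerSeries.coeff s (T 0 1) • PowerSeries.coeff r (T 1 1) • x = 0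
      simp [H.rtt.smul_smul 0 1 1 1, kill x hx]
  have comm : ∀ i j : Fin 2 × ℕ, ∀ x ∈ U, PowerSeries.coeff i.2 (T i.1 i.1) • PowerSeries.coeff j.2 (T j.1 j.1) • x =
      PowerSeries.coeff j.2 (T j.1 j.1) • PowerSeries.coeff i.2 (T i.1 i.1) • x := by
    have h01 : ∀ r s, ∀ x ∈ U, PowerSeries.coeff r (T 0 0) • PowerSeries.coeff s (T 1 1) • x =
        PowerSeries.coeff s (T 1 1) • PowerSeries.coeff r (T 0 0) • x := by
      intro r s x hx
      simp [H.rtt.smul_smul 0 0 1 1, kill x hx]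
    rintro ⟨i, r⟩ ⟨j, s⟩ x hx
    by_cases hij : i = j
    · subst hij
      rw [← mul_smul, ← mul_smul, (H.rtt.commute_self i i r s).eq]
    · fin_cases i <;> fin_cases j
      exacts [absurd rfl hij, h01 r s x hx, (h01 s r x hx).symm, absurd rfl hij]
  obtain ⟨v, hv, hv0, hvc⟩ := exists_common_eigenvector (K := K)
    (fun i : Fin 2 × ℕ => PowerSeries.coeff i.2 (T i.1 i.1)) U hU stable comm
  choose c hc using hvc
  refine ⟨fun i => PowerSeries.mk fun r => c (i, r), v, hv0, hv, fun i r => ?_⟩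
  rw [PowerSeries.coeff_mk]
  exact hc (i, r)

end Triangular

/-! ### Shift invariance of `g(u) ⋯ g(u - p + 1)` -/

section ShiftInvariant

variable {K : Type*} [Field K]

theorem constantCoeff_shiftProd (p : ℕ) {g : K⟦X⟧} (hg : PowerSeries.constantCoeff g = 1) :
    PowerSeries.constantCoeff (shiftProd K p g) = 1 := by
  rw [shiftProd_eq_prod, map_prod]
  exact Finset.prod_eq_one fun j _ => by rw [constantCoeff_shift, hg]

/-- The shift permutes the factors cyclically because `p = 0` in `K`; in the proof, the product of
`p + 1` factors is split at either end. -/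
theorem shift_shiftProd (p : ℕ) [CharP K p] (g : K⟦X⟧) (hg : PowerSeries.constantCoeff g = 1) :
    shift (1 : K) (shiftProd K p g) = shiftProd K p g := by
  have hne : shift (0 : K) g ≠ 0 := by
    intro h
    have := congrArg PowerSeries.constantCoeff h
    rw [constantCoeff_shift, hg, map_zero] at this
    exact one_ne_zero this
  have h1 := Finset.prod_range_succ (fun j : ℕ => shift (j : K) g) p
  rw [Finset.prod_range_succ', Nat.cast_zero, CharP.cast_eq_zero K p] at h1
  have h2 := mul_right_cancel₀ hne h1
  rw [shiftProd_eq_prod, ← shiftHom_apply, map_prod]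
  refine Eq.trans ?_ h2
  refine Finset.prod_congr rfl fun j _ => ?_
  rw [shiftHom_apply, shift_shift, Nat.cast_succ, add_comm]

/-- The coefficients of a shift invariant series are determined by those at multiples of `p`. -/
theorem eq_one_of_shift_eq (p : ℕ) [CharP K p] {B : K⟦X⟧} (h0 : PowerSeries.constantCoeff B = 1)
    (hB : shift (1 : K) B = B) (hp : ∀ r, 0 < r → PowerSeries.coeff (r * p) B = 0) : B = 1 := by
  have key : ∀ m, 0 < m → PowerSeries.coeff m B = 0 := by
    intro m
    induction m using Nat.strong_induction_on with
    | _ m ih =>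
    intro hm
    by_cases hdvd : p ∣ m
    · obtain ⟨r, rfl⟩ := hdvd
      rw [mul_comm]
      exact hp r (Nat.pos_of_ne_zero fun h => by simp [h] at hm)
    have h1 := congrArg (PowerSeries.coeff (m + 1)) hB
    rw [shift, PowerSeries.coeff_mk, Finset.sum_range_succ, Finset.sum_range_succ] at h1
    have h2 : ∑ r ∈ Finset.range m, PowerSeries.coeff (m + 1) (invSub K 1 ^ r) • PowerSeries.coeff r B = 0 := by
      refine Finset.sum_eq_zero fun r hr => ?_
      rcases Nat.eq_zero_or_pos r with rfl | hr0
      · rw [pow_zero, PowerSeries.coeff_one, if_neg (by omega), zero_smul]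
      · rw [ih r (Finset.mem_range.1 hr) hr0, smul_zero]
    -- If all coefficients of positive degree below `m` vanish, then the coefficient of `u^{-(m +
    -- 1)}` in `B(u - 1) = B(u)` reads `m B⁽ᵐ⁾ = 0`. This settles every `m` not divisible by `p`.
    have h3 : PowerSeries.coeff (m + 1) (invSub K 1 ^ m) = (m : K) := by
      rw [invSub, mul_pow, add_comm, PowerSeries.coeff_X_pow_mul, PowerSeries.coeff_one_pow]
      simp
    have h4 : PowerSeries.coeff (m + 1) (invSub K 1 ^ (m + 1)) = 1 := by
      have := PowerSeries.coeff_X_pow_mul ((PowerSeries.mk fun i => (1 : K) ^ i) ^ (m + 1)) (m + 1) 0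
      rw [zero_add] at this
      rw [invSub, mul_pow, this]
      simp
    rw [h2, h3, h4, zero_add, one_smul, add_eq_right, smul_eq_mul, mul_eq_zero] at h1
    exact h1.resolve_left fun h => hdvd ((CharP.cast_eq_zero_iff K p m).1 h)
  ext m
  rcases Nat.eq_zero_or_pos m with rfl | hm
  · rw [PowerSeries.coeff_zero_eq_constantCoeff_apply, h0]; simp
  · rw [key m hm, PowerSeries.coeff_one, if_neg hm.ne']

theorem isRestricted_of_coeff_shiftProd (p : ℕ) [CharP K p] {g : K⟦X⟧} (hg : PowerSeries.constantCoeff g = 1)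
    (h : ∀ r, 0 < r → PowerSeries.coeff (r * p) (shiftProd K p g) = 0) : IsRestricted p g :=
  ⟨hg, eq_one_of_shift_eq p (constantCoeff_shiftProd p hg) (shift_shiftProd p g hg) h⟩

end ShiftInvariant

/-! ### Series acting on a vector by scalars -/

section ScalarAction

variable {K : Type*} [Field K] {A : Type*} [Ring A] [Algebra K A]
  {V : Type*} [AddCommGroup V] [Module K V] [Module A V] [IsScalarTower K A V]

/-- The coefficients of `g` act on `v` by those of the scalar series `φ`. -/
def ActsBy (g : A⟦X⟧) (φ : K⟦X⟧) (v : V) : Prop :=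
  ∀ r, PowerSeries.coeff r g • v = PowerSeries.coeff r φ • v

omit [Algebra K A] [IsScalarTower K A V] in
theorem ActsBy.one (v : V) : ActsBy (1 : A⟦X⟧) (1 : K⟦X⟧) v := by
  intro r
  rw [PowerSeries.coeff_one, PowerSeries.coeff_one]
  split_ifs <;> simp

theorem ActsBy.mul {g h : A⟦X⟧} {φ ψ : K⟦X⟧} {v : V} (hg : ActsBy g φ v) (hh : ActsBy h ψ v) :
    ActsBy (g * h) (φ * ψ) v := by
  intro r
  rw [PowerSeries.coeff_mul, PowerSeries.coeff_mul, Finset.sum_smul, Finset.sum_smul]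
  refine Finset.sum_congr rfl fun x _ => ?_
  rw [mul_smul, hh, smul_comm, hg, smul_smul, mul_comm]

theorem ActsBy.shift {g : A⟦X⟧} {φ : K⟦X⟧} {v : V} (hg : ActsBy g φ v) (c : K) :
    ActsBy (shift c g) (shift c φ) v := by
  intro r
  rw [RestrictedYangianTwo.shift, RestrictedYangianTwo.shift, PowerSeries.coeff_mk, PowerSeries.coeff_mk,
    Finset.sum_smul, Finset.sum_smul]
  refine Finset.sum_congr rfl fun x _ => ?_
  rw [smul_assoc, hg, smul_assoc]

theorem ActsBy.shiftProd {g : A⟦X⟧} {φ : K⟦X⟧} {v : V} (hg : ActsBy g φ v) (p : ℕ) :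
    ActsBy (shiftProd K p g) (shiftProd K p φ) v := by
  have : ∀ L : List ℕ, ActsBy (L.map fun j : ℕ => RestrictedYangianTwo.shift (j : K) g).prod
      (L.map fun j : ℕ => RestrictedYangianTwo.shift (j : K) φ).prod v := by
    intro L
    induction L with
    | nil => exact ActsBy.one v
    | cons j L ih => simpa using (hg.shift _).mul ih
  exact this _

end ScalarAction

/-! ### The restricted Yangian and its highest weights -/

section RestrictedYangianStructure

variable {K : Type*} [Field K] (p : ℕ)

/-- The series `t_{i,j}(u)` over `Y₂^{[p]}`. -/
def tBar (K : Type*) [Field K] (p : ℕ) (i j : Fin 2) : (RestrictedYangian K p)⟦X⟧ := PowerSeries.map (proj K p).toRingHom (tSeries K i j)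

/-- The inverse of `t_{1,1}(u)` over `Y₂^{[p]}`. -/
def tInvBar (K : Type*) [Field K] (p : ℕ) : (RestrictedYangian K p)⟦X⟧ := PowerSeries.map (proj K p).toRingHom (tInv K)

theorem coeff_tBar (i j : Fin 2) (r : ℕ) : PowerSeries.coeff r (tBar K p i j) = proj K p (t K i j r) := by
  rw [tBar, PowerSeries.coeff_map, coeff_tSeries]
  rfl

theorem proj_surjective : Function.Surjective (proj K p) := RingQuot.mkAlgHom_surjective K (PCenterRel K p)

theorem proj_eq_zero {x : Yangian K} (h : PCenterRel K p x 0) : proj K p x = 0 := by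
  have := RingQuot.mkAlgHom_rel K h
  change proj K p x = proj K p 0 at this
  rwa [map_zero] at this

theorem proj_e (r : ℕ) : proj K p (e K r) = PowerSeries.coeff r (tInvBar K p * tBar K p 0 1) := by
  rw [tInvBar, tBar, ← map_mul, PowerSeries.coeff_map]
  rfl

theorem proj_f (r : ℕ) : proj K p (f K r) = PowerSeries.coeff r (tBar K p 1 0 * tInvBar K p) := by
  rw [tInvBar, tBar, ← map_mul, PowerSeries.coeff_map]
  rfl

theorem proj_d_zero (r : ℕ) : proj K p (d K 0 r) = PowerSeries.coeff r (tBar K p 0 0) := by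
  rw [tBar, PowerSeries.coeff_map]
  rfl

theorem proj_d_one (r : ℕ) : proj K p (d K 1 r) =
    PowerSeries.coeff r (tBar K p 1 1 - tBar K p 1 0 * tInvBar K p * tBar K p 0 1) := by
  simp only [tInvBar, tBar]
  rw [← map_mul, ← map_mul, ← map_sub, PowerSeries.coeff_map]
  rfl

theorem restrictedRTT_tBar : RestrictedRTT K p (tBar K p) (tInvBar K p) where
  rtt := isRTT_tSeries.map (proj K p).toRingHom
  mul_inv := by rw [tBar, tInvBar, ← map_mul, tSeries_mul_tInv, map_one]
  inv_mul := by rw [tBar, tInvBar, ← map_mul, tInv_mul_tSeries, map_one]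
  pow_e r hr := by rw [← proj_e, ← map_pow, proj_eq_zero p (PCenterRel.e r hr)]
  pow_f r hr := by rw [← proj_f, ← map_pow, proj_eq_zero p (PCenterRel.f r hr)]
  gen := by
    rw [eq_top_iff]
    intro x _
    obtain ⟨y, rfl⟩ := proj_surjective p x
    induction y using yangian_induction with
    | hadd x y hx hy =>
      rw [map_add]
      exact Subalgebra.add_mem _ (hx Algebra.mem_top) (hy Algebra.mem_top)
    | hmul x y hx hy =>
      rw [map_mul]
      exact Subalgebra.mul_mem _ (hx Algebra.mem_top) (hy Algebra.mem_top)
    | hK c => rw [AlgHom.commutes]; exact Subalgebra.algebraMap_mem _ c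
    | ht i j r => exact Algebra.subset_adjoin ⟨i, j, r, (coeff_tBar p i j r).symm⟩

variable {p} {V : Type*} [AddCommGroup V] [Module K V] [Module (RestrictedYangian K p) V]
  {lam : Fin 2 → K⟦X⟧} {v : V}

/-- Killing `e(u)` is equivalent to killing `t_{1,2}(u) = d₁(u) e(u)`, and on such a vector `d₂(u)`
and `t_{2,2}(u)` agree. -/
theorem isHighestWeight_iff : IsHighestWeight (tBar K p) lam v ↔
    (∀ r, proj K p (e K r) • v = 0) ∧ ∀ i r, proj K p (d K i r) • v = PowerSeries.coeff r (lam i) • v := by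
  have H := restrictedRTT_tBar (K := K) p
  have d1 : (∀ r, PowerSeries.coeff r (tBar K p 0 1) • v = 0) →
      ∀ r, proj K p (d K 1 r) • v = PowerSeries.coeff r (tBar K p 1 1) • v := by
    intro h r
    rw [proj_d_one, map_sub, sub_smul, PowerSeries.coeff_mul (n := r), Finset.sum_smul,
      Finset.sum_eq_zero fun x _ => by rw [mul_smul, h, smul_zero], sub_zero]
  constructor
  · intro h
    refine ⟨fun r => ?_, fun i r => ?_⟩
    · rw [proj_e, PowerSeries.coeff_mul, Finset.sum_smul]
      exact Finset.sum_eq_zero fun x _ => by rw [mul_smul, h.t01, smul_zero]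
    · fin_cases i
      · exact (congrArg (· • v) (proj_d_zero p r)).trans (h.diag 0 r)
      · exact (d1 h.t01 r).trans (h.diag 1 r)
  · rintro ⟨h1, h2⟩
    have h01 : ∀ r, PowerSeries.coeff r (tBar K p 0 1) • v = 0 := by
      intro r
      have : tBar K p 0 1 = tBar K p 0 0 * (tInvBar K p * tBar K p 0 1) := by
        rw [← mul_assoc, H.mul_inv, one_mul]
      rw [this, PowerSeries.coeff_mul, Finset.sum_smul]
      exact Finset.sum_eq_zero fun x _ => by rw [mul_smul, ← proj_e, h1, smul_zero]
    refine ⟨h01, fun i r => ?_⟩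
    fin_cases i
    · exact (congrArg (· • v) (proj_d_zero p r)).symm.trans (h2 0 r)
    · exact (d1 h01 r).symm.trans (h2 1 r)

/-- Highest weights of `Y₂^{[p]}`-modules are restricted. -/
theorem IsHighestWeight.isRestrictedPair [CharP K p] [IsScalarTower K (RestrictedYangian K p) V]
    (h : IsHighestWeight (tBar K p) lam v) (hv : v ≠ 0) : IsRestrictedPair p lam := by
  intro i
  refine isRestricted_of_coeff_shiftProd p ?_ fun r hr => ?_
  · have := h.diag i 0
    rw [(restrictedRTT_tBar (K := K) p).rtt.const, if_pos rfl, one_smul] at this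
    rw [← PowerSeries.coeff_zero_eq_constantCoeff_apply]
    have h' : (PowerSeries.coeff 0 (lam i) - 1) • v = 0 := by rw [sub_smul, one_smul, ← this, sub_self]
    exact sub_eq_zero.1 ((smul_eq_zero.1 h').resolve_right hv)
  · have hact : ActsBy (PowerSeries.map (proj K p).toRingHom (dSeries K i)) (lam i) v := by
      intro r
      rw [PowerSeries.coeff_map]
      exact (isHighestWeight_iff.1 h).2 i r
    have := hact.shiftProd p (r * p)
    rw [← map_shiftProd, PowerSeries.coeff_map] at this
    have hb : (proj K p).toRingHom (PowerSeries.coeff (r * p) (shiftProd K p (dSeries K i))) = 0 :=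
      proj_eq_zero p (PCenterRel.b i r hr)
    rw [hb, zero_smul] at this
    exact (smul_eq_zero.1 this.symm).resolve_right hv

end RestrictedYangianStructure

/-! ### Baby Verma modules and their simple heads -/

section BabyVermaModules

variable {K : Type*} [Field K] (p : ℕ)

theorem e_zero : e K 0 = 0 := by
  have h := (isRTT_tSeries (K := K)).halfRel (tSeries_mul_tInv K) (tInv_mul_tSeries K)
  exact h.const_e

theorem d_zero (i : Fin 2) : d K i 0 = 1 := by
  have h01 : PowerSeries.constantCoeff (tSeries K 0 1) = 0 := by
    rw [← PowerSeries.coeff_zero_eq_constantCoeff_apply, coeff_tSeries, t_zero, if_neg (by decide)]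
  fin_cases i
  · change PowerSeries.coeff 0 (tSeries K 0 0) = 1
    rw [coeff_tSeries, t_zero, if_pos rfl]
  · change PowerSeries.coeff 0 (tSeries K 1 1 - tSeries K 1 0 * tInv K * tSeries K 0 1) = 1
    rw [map_sub, coeff_tSeries, t_zero, if_pos rfl, PowerSeries.coeff_zero_eq_constantCoeff_apply, map_mul, h01,
      mul_zero, sub_zero]

/-- Membership in `babyVermaIdeal` involves only finitely many coefficients of `λ`. -/
theorem exists_mem_babyVermaIdeal_of_coeff_eq {lam : Fin 2 → K⟦X⟧} {x : RestrictedYangian K p}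
    (hx : x ∈ babyVermaIdeal p lam) : ∃ N, ∀ mu : Fin 2 → K⟦X⟧,
      (∀ i, ∀ r ≤ N, PowerSeries.coeff r (mu i) = PowerSeries.coeff r (lam i)) → x ∈ babyVermaIdeal p mu := by
  induction hx using Submodule.span_induction with
  | mem x hx =>
    rcases hx with ⟨r, hr, rfl⟩ | ⟨i, r, hr, rfl⟩
    · exact ⟨0, fun mu _ => Submodule.subset_span (Or.inl ⟨r, hr, rfl⟩)⟩
    · exact ⟨r, fun mu hmu => Submodule.subset_span (Or.inr ⟨i, r, hr, by rw [hmu i r le_rfl]⟩)⟩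
  | zero => exact ⟨0, fun mu _ => Submodule.zero_mem _⟩
  | add x y _ _ hx hy =>
    obtain ⟨N, hN⟩ := hx
    obtain ⟨M, hM⟩ := hy
    exact ⟨max N M, fun mu hmu => Submodule.add_mem _
      (hN mu fun i r hr => hmu i r (hr.trans (le_max_left _ _)))
      (hM mu fun i r hr => hmu i r (hr.trans (le_max_right _ _)))⟩
  | smul a x _ hx =>
    obtain ⟨N, hN⟩ := hx
    exact ⟨N, fun mu hmu => Submodule.smul_mem _ a (hN mu hmu)⟩

/-- The baby Verma module of a restricted pair is nonzero. -/
theorem one_notMem_babyVermaIdeal [IsAlgClosed K] (hp : 0 < p) [CharP K p] {lam : Fin 2 → K⟦X⟧}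
    (hlam : IsRestrictedPair p lam) : (1 : RestrictedYangian K p) ∉ babyVermaIdeal p lam := by
  intro hmem
  obtain ⟨N, hN⟩ := exists_mem_babyVermaIdeal_of_coeff_eq p hmem
  have hinv : lam 1 * PowerSeries.invOfUnit (lam 1) 1 = 1 :=
    PowerSeries.mul_invOfUnit _ _ (by rw [(hlam 1).1, Units.val_one])
  -- Only the ratio `λ₁ / λ₂` has to be approximated: the second weight of the model is `λ₂`
  -- exactly.
  obtain ⟨S, hS, hcoeff⟩ := exists_generic_approx p hp
    ((hlam 0).mul ((hlam 1).of_mul_eq_one hinv)) N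
  obtain ⟨B, _, _, T, ai, q, H⟩ := exists_model S (lam 1) (hlam 1).1
  let mu : Fin 2 → K⟦X⟧ := ![(∏ y ∈ S, (1 + invSub K (y + 1))) * lam 1, lam 1]
  have hmu : IsRestrictedPair p mu := by
    intro i
    fin_cases i
    · exact (IsRestricted.prod fun y _ => isRestricted_one_add_invSub p y).mul (hlam 1)
    · exact hlam 1
  obtain ⟨W, Φ, v, hv, he, hd⟩ := Model.exists_rep (lam := mu) H p hp hS hmu
  have hmem' : (1 : RestrictedYangian K p) ∈ babyVermaIdeal p mu := by
    refine hN mu fun i r hr => ?_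
    fin_cases i
    · change PowerSeries.coeff r ((∏ y ∈ S, (1 + invSub K (y + 1))) * lam 1) = PowerSeries.coeff r (lam 0)
      have : lam 0 = lam 0 * PowerSeries.invOfUnit (lam 1) 1 * lam 1 := by
        rw [mul_assoc, mul_comm _ (lam 1), hinv, mul_one]
      rw [this, PowerSeries.coeff_mul, PowerSeries.coeff_mul]
      refine Finset.sum_congr rfl fun x hx => ?_
      rw [hcoeff x.1 (le_trans (by have := Finset.HasAntidiagonal.mem_antidiagonal.1 hx; omega) hr)]
    · rfl
  -- In the model of weight `mu` the whole left ideal kills `v ≠ 0`, while `1` does not.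
  have kill : ∀ x ∈ babyVermaIdeal p mu, Φ x v = 0 := by
    intro x hx
    induction hx using Submodule.span_induction with
    | mem x hx =>
      rcases hx with ⟨r, hr, rfl⟩ | ⟨i, r, hr, rfl⟩
      · exact he r
      · rw [map_sub, LinearMap.sub_apply, hd, AlgHom.commutes, Module.algebraMap_end_apply, sub_self]
    | zero => rw [map_zero, LinearMap.zero_apply]
    | add x y _ _ hx hy => rw [map_add, LinearMap.add_apply, hx, hy, add_zero]
    | smul a x _ hx => rw [smul_eq_mul, map_mul, Module.End.mul_apply, hx, map_zero]
  have := kill 1 hmem'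
  rw [map_one] at this
  exact hv this

variable {p} {lam : Fin 2 → K⟦X⟧}

/-- The generator of the baby Verma module. -/
def babyVermaGen (p : ℕ) (lam : Fin 2 → K⟦X⟧) : BabyVerma p lam := (babyVermaIdeal p lam).mkQ 1

theorem smul_babyVermaGen (a : RestrictedYangian K p) :
    a • babyVermaGen p lam = (babyVermaIdeal p lam).mkQ a := by
  rw [babyVermaGen, ← map_smul, smul_eq_mul, mul_one]

theorem span_babyVermaGen : Submodule.span (RestrictedYangian K p) {babyVermaGen p lam} = ⊤ := by
  rw [eq_top_iff]
  intro x _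
  obtain ⟨a, rfl⟩ := (babyVermaIdeal p lam).mkQ_surjective x
  exact Submodule.mem_span_singleton.2 ⟨a, smul_babyVermaGen a⟩

theorem isHighestWeight_babyVermaGen (hlam : IsRestrictedPair p lam) :
    IsHighestWeight (tBar K p) lam (babyVermaGen p lam) := by
  refine isHighestWeight_iff.2 ⟨fun r => ?_, fun i r => ?_⟩
  · rcases Nat.eq_zero_or_pos r with rfl | hr
    · rw [e_zero, map_zero, zero_smul]
    · rw [smul_babyVermaGen]
      exact (Submodule.Quotient.mk_eq_zero _).2 (Submodule.subset_span (Or.inl ⟨r, hr, rfl⟩))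
  · rcases Nat.eq_zero_or_pos r with rfl | hr
    · rw [d_zero, map_one, one_smul, PowerSeries.coeff_zero_eq_constantCoeff_apply, (hlam i).1, one_smul]
    · rw [← algebraMap_smul (RestrictedYangian K p) (PowerSeries.coeff r (lam i)), ← sub_eq_zero, ← sub_smul,
        smul_babyVermaGen]
      exact (Submodule.Quotient.mk_eq_zero _).2 (Submodule.subset_span (Or.inr ⟨i, r, hr, rfl⟩))

theorem babyVermaGen_ne_zero [IsAlgClosed K] (hp : 0 < p) [CharP K p] (hlam : IsRestrictedPair p lam) :
    babyVermaGen p lam ≠ 0 := fun h =>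
  one_notMem_babyVermaIdeal p hp hlam ((Submodule.Quotient.mk_eq_zero _).1 h)

theorem mem_lowerPart_of_mem_ne_top (hlam : IsRestrictedPair p lam)
    {N : Submodule (RestrictedYangian K p) (BabyVerma p lam)} (hN : N ≠ ⊤) {x : BabyVerma p lam} (hx : x ∈ N) :
    x ∈ lowerPart K (tBar K p) (BabyVerma p lam) := by
  by_contra h
  have := (restrictedRTT_tBar (K := K) p).span_eq_top (isHighestWeight_babyVermaGen hlam) span_babyVermaGen h
  refine hN (eq_top_iff.2 ?_)
  rw [← this, Submodule.span_singleton_le_iff_mem]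
  exact hx

theorem babyVermaGen_notMem_maxSubmodule [IsAlgClosed K] (hp : 0 < p) [CharP K p] (hlam : IsRestrictedPair p lam) :
    babyVermaGen p lam ∉ maxSubmodule p lam := by
  -- The largest submodule inside the lower part. It contains every proper submodule, hence their
  -- sum, but not the generator.
  let M : Submodule (RestrictedYangian K p) (BabyVerma p lam) :=
    { carrier := {x | ∀ a : RestrictedYangian K p, a • x ∈ lowerPart K (tBar K p) (BabyVerma p lam)}
      add_mem' := fun hx hy a => by rw [smul_add]; exact Submodule.add_mem _ (hx a) (hy a)
      zero_mem' := fun a => by rw [smul_zero]; exact Submodule.zero_mem _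
      smul_mem' := fun c x hx a => by rw [smul_smul]; exact hx _ }
  have hM : maxSubmodule p lam ≤ M :=
    sSup_le fun N hN x hx a => mem_lowerPart_of_mem_ne_top hlam hN (N.smul_mem a hx)
  intro h
  have := hM h 1
  rw [one_smul] at this
  exact (restrictedRTT_tBar (K := K) p).notMem_lowerPart (isHighestWeight_babyVermaGen hlam) span_babyVermaGen
    (babyVermaGen_ne_zero hp hlam) this

theorem isCoatom_iff_eq_maxSubmodule [IsAlgClosed K] (hp : 0 < p) [CharP K p] (hlam : IsRestrictedPair p lam)
    (N : Submodule (RestrictedYangian K p) (BabyVerma p lam)) : IsCoatom N ↔ N = maxSubmodule p lam := by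
  have hne : maxSubmodule p lam ≠ ⊤ := fun h =>
    babyVermaGen_notMem_maxSubmodule hp hlam (h ▸ Submodule.mem_top)
  have hle : ∀ N : Submodule (RestrictedYangian K p) (BabyVerma p lam), N ≠ ⊤ → N ≤ maxSubmodule p lam :=
    fun N hN => le_sSup hN
  constructor
  · intro h
    by_contra hN
    exact hne (h.2 _ (lt_of_le_of_ne (hle N h.1) hN))
  · rintro rfl
    refine ⟨hne, fun N hN => ?_⟩
    by_contra h
    exact (hle N h).not_gt hN

theorem isSimpleModule_simpleHead [IsAlgClosed K] (hp : 0 < p) [CharP K p] (hlam : IsRestrictedPair p lam) :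
    IsSimpleModule (RestrictedYangian K p) (SimpleHead p lam) :=
  isSimpleModule_iff_isCoatom.2 ((isCoatom_iff_eq_maxSubmodule hp hlam _).2 rfl)

theorem IsHighestWeight.map {V W : Type*} [AddCommGroup V] [Module K V] [Module (RestrictedYangian K p) V]
    [IsScalarTower K (RestrictedYangian K p) V] [AddCommGroup W] [Module K W] [Module (RestrictedYangian K p) W]
    [IsScalarTower K (RestrictedYangian K p) W] {v : V} (h : IsHighestWeight (tBar K p) lam v)
    (φ : V →ₗ[RestrictedYangian K p] W) : IsHighestWeight (tBar K p) lam (φ v) where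
  t01 r := by rw [← map_smul, h.t01, map_zero]
  diag i r := by
    rw [← map_smul, h.diag, ← algebraMap_smul (RestrictedYangian K p) (PowerSeries.coeff r (lam i)), map_smul,
      algebraMap_smul]

/-- A simple module with a highest weight vector is the simple head of a baby Verma module. -/
theorem IsHighestWeight.nonempty_equiv_simpleHead [IsAlgClosed K] (hp : 0 < p) [CharP K p] {L : Type*} [AddCommGroup L] [Module K L]
    [Module (RestrictedYangian K p) L] [IsScalarTower K (RestrictedYangian K p) L]
    [IsSimpleModule (RestrictedYangian K p) L] {v : L} (hv : v ≠ 0) (h : IsHighestWeight (tBar K p) lam v) :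
    Nonempty (L ≃ₗ[RestrictedYangian K p] SimpleHead p lam) := by
  have hw := isHighestWeight_iff.1 h
  have hle : babyVermaIdeal p lam ≤ LinearMap.ker (LinearMap.toSpanSingleton (RestrictedYangian K p) L v) := by
    refine Submodule.span_le.2 ?_
    rintro x (⟨r, -, rfl⟩ | ⟨i, r, -, rfl⟩)
    · exact hw.1 r
    · change (proj K p (d K i r) - algebraMap K _ (PowerSeries.coeff r (lam i))) • v = 0
      rw [sub_smul, hw.2, algebraMap_smul, sub_self]
  let φ : BabyVerma p lam →ₗ[RestrictedYangian K p] L := (babyVermaIdeal p lam).liftQ _ hle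
  have hφ : Function.Surjective φ := by
    intro x
    obtain ⟨a, ha⟩ := IsSimpleModule.toSpanSingleton_surjective (RestrictedYangian K p) hv x
    exact ⟨(babyVermaIdeal p lam).mkQ a, ha⟩
  -- The kernel of a map onto a simple module is maximal, so it is the unique maximal submodule.
  -- This uses that the weight of `v` is automatically restricted.
  have hker := (isCoatom_iff_eq_maxSubmodule hp (h.isRestrictedPair hv) _).1
    (LinearMap.isCoatom_ker_of_surjective hφ)
  exact ⟨((Submodule.quotEquivOfEq _ _ hker).symm.trans (φ.quotKerEquivOfSurjective hφ)).symm⟩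

/-- The highest weight of the simple head of a baby Verma module is unique. -/
theorem eq_of_simpleHead_equiv [IsAlgClosed K] (hp : 0 < p) [CharP K p] {mu : Fin 2 → K⟦X⟧}
    (hlam : IsRestrictedPair p lam) (hmu : IsRestrictedPair p mu)
    (φ : SimpleHead p lam ≃ₗ[RestrictedYangian K p] SimpleHead p mu) : lam = mu := by
  have := isSimpleModule_simpleHead hp hmu
  have hne : ∀ {nu : Fin 2 → K⟦X⟧}, IsRestrictedPair p nu →
      (maxSubmodule p nu).mkQ (babyVermaGen p nu) ≠ 0 := fun hnu h =>
    babyVermaGen_notMem_maxSubmodule hp hnu ((Submodule.Quotient.mk_eq_zero _).1 h)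
  have hw : φ ((maxSubmodule p lam).mkQ (babyVermaGen p lam)) ≠ 0 := fun h => hne hlam (by simpa using h)
  have h1 := ((isHighestWeight_babyVermaGen hlam).map (maxSubmodule p lam).mkQ).map φ.toLinearMap
  have h2 := (isHighestWeight_babyVermaGen hmu).map (maxSubmodule p mu).mkQ
  exact (restrictedRTT_tBar (K := K) p).highestWeight_unique h1 (IsSimpleModule.span_singleton_eq_top _ hw) h2
    (IsSimpleModule.span_singleton_eq_top _ (hne hmu)) (hne hmu)

end BabyVermaModules

end RestrictedYangianTwo

end

theorem theorem2p7 {K : Type*} [Field K] [IsAlgClosed K] (p : ℕ) (hp : 0 < p) [CharP K p] :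
    -- the baby Verma module of a restricted pair has a unique maximal submodule
    (∀ lam : Fin 2 → PowerSeries K, RestrictedYangianTwo.IsRestrictedPair p lam →
      (∀ N : Submodule (RestrictedYangianTwo.RestrictedYangian K p)
          (RestrictedYangianTwo.BabyVerma p lam),
        IsCoatom N ↔ N = RestrictedYangianTwo.maxSubmodule p lam) ∧
      IsSimpleModule (RestrictedYangianTwo.RestrictedYangian K p)
        (RestrictedYangianTwo.SimpleHead p lam)) ∧
    -- every finite-dimensional irreducible module is the simple head of a baby Verma module
    (∀ (L : Type*) [AddCommGroup L] [Module K L]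
      [Module (RestrictedYangianTwo.RestrictedYangian K p) L]
      [IsScalarTower K (RestrictedYangianTwo.RestrictedYangian K p) L]
      [FiniteDimensional K L]
      [IsSimpleModule (RestrictedYangianTwo.RestrictedYangian K p) L],
      ∃ lam : Fin 2 → PowerSeries K, RestrictedYangianTwo.IsRestrictedPair p lam ∧
        Nonempty (L ≃ₗ[RestrictedYangianTwo.RestrictedYangian K p]
          RestrictedYangianTwo.SimpleHead p lam)) ∧
    -- distinct restricted pairs give non-isomorphic modules
    (∀ lam mu : Fin 2 → PowerSeries K, RestrictedYangianTwo.IsRestrictedPair p lam →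
      RestrictedYangianTwo.IsRestrictedPair p mu →
      Nonempty (RestrictedYangianTwo.SimpleHead p lam
        ≃ₗ[RestrictedYangianTwo.RestrictedYangian K p]
          RestrictedYangianTwo.SimpleHead p mu) →
      lam = mu) := by
  refine ⟨fun lam hlam => ⟨RestrictedYangianTwo.isCoatom_iff_eq_maxSubmodule hp hlam,
    RestrictedYangianTwo.isSimpleModule_simpleHead hp hlam⟩, ?_, ?_⟩
  · intro L _ _ _ _ _ _
    have := IsSimpleModule.nontrivial (RestrictedYangianTwo.RestrictedYangian K p) L
    obtain ⟨lam, v, hv, h⟩ := (RestrictedYangianTwo.restrictedRTT_tBar (K := K) p).exists_isHighestWeight (V := L)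
    exact ⟨lam, h.isRestrictedPair hv, h.nonempty_equiv_simpleHead hp hv⟩
  · rintro lam mu hlam hmu ⟨φ⟩
    exact RestrictedYangianTwo.eq_of_simpleHead_equiv hp hlam hmu φ
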